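/- (Global single leaf Frobenius theorem.) Let $E$ and $M$ be finite-dimensional smooth (Hausdorff, $C^\infty$) manifolds, $\pi:E\to M$ a smooth submersion, and $\mathcal D\subset TE$ a smooth distribution (smooth vector subbundle) which is horizontal, i.e. $T_xE=\operatorname{Ker}(\mathrm d\pi_x)\oplus\mathcal D_x$ for all $x\in E$. The Levi form of $\mathcal D$ at $x\in E$ is the bilinear map $\mathfrak L^{\mathcal D}_x:\mathcal D_x\times\mathcal D_x\to T_xE/\mathcal D_x$, $\mathfrak L^{\mathcal D}_x(v,w)=[X,Y](x)+\mathcal D_x$, where $X,Y$ are smooth vector fields near $x$ with values in $\mathcal D$ and $X(x)=v$, $Y(x)=w$. Let $\mathcal S$ be a spray on $M$: a smooth vector field on $TM$ such that $\mathrm dp_v(\mathcal S(v))=v$ and $a\,\mathrm d(\mathfrak m_a)_v(\mathcal S(v))=\mathcal S(av)$ for all $v\in TM$, $a\in\mathbb R$, where $p:TM\to M$ is the projection and $\mathfrak m_a:TM\to TM$ is multiplication by $a$. A curve $\gamma$ in $M$ defined on a compact interval is a solution of $\mathcal S$ if $\gamma'$ is an integral curve of $\mathcal S$; a curve $\gamma:[a,b]\to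 M$, $a<b$, is a piecewise solution of $\mathcal S$ if there is a partition $a=t_0<t_1<\dots<t_k=b$ such that each $\gamma|_{[t_i,t_{i+1}]}$ is a solution of $\mathcal S$. A horizontal lifting of $\gamma$ is a piecewise smooth curve $\tilde\gamma:[a,b]\to E$ with $\pi\circ\tilde\gamma=\gamma$ and $\tilde\gamma'(t)\in\mathcal D$ for all $t$ for which $\tilde\gamma'(t)$ exists. Let $x_0\in M$ and $e_0\in\pi^{-1}(x_0)$, and assume that: (a) every piecewise solution $\gamma:[a,b]\to M$ of $\mathcal S$ with $\gamma(a)=x_0$ admits a horizontal lifting $\tilde\gamma:[a,b]\to E$ with $\tilde\gamma(a)=e_0$; (b) if $\tilde\gamma:[a,b]\to E$ is a horizontal lifting of a piecewise solution $\gamma:[a,b]\to M$ of $\mathcal S$ with $\tilde\gamma(a)=e_0$, then $\mathfrak L^{\mathcal D}_{\tilde\gamma(b)}=0$; (c) $M$ is connected and simply connected. Then there is a unique smooth map $s:M\to E$ such that $\pi\circ s=\mathrm{Id}_M$, the range of $\mathrm ds(m)$ is $\mathcal D_{s(m)}$ for every $m\in M$, and $s(x_0)=e_0$. -/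

import Mathlib

open Set
open scoped Manifold ContDiff Topology

noncomputable section

section Curves

/-- `PiecewiseOn P a b`: there is a partition `a = t₀ < t₁ < ⋯ < t_k = b` such that `P tᵢ tᵢ₊₁` holds
for every `i < k`. -/
def PiecewiseOn (P : ℝ → ℝ → Prop) (a b : ℝ) : Prop :=
  ∃ (k : ℕ) (t : Fin (k + 1) → ℝ), StrictMono t ∧ t 0 = a ∧ t (Fin.last k) = b ∧
    ∀ i : Fin k, P (t i.castSucc) (t i.succ)

variable {V : Type*} [NormedAddCommGroup V] [NormedSpace ℝ V]
  {N : Type*} [TopologicalSpace N] [ChartedSpace V N]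

/-- The derivative `γ'(t) ∈ T_{γ(t)} N` of a curve `γ : [a, b] → N` (one-sided at `a` and `b`).
A curve on `[a, b]` is given as a map on `ℝ` of which only the values on `[a, b]` are used. -/
def curveDeriv (γ : ℝ → N) (a b t : ℝ) : TangentSpace 𝓘(ℝ, V) (γ t) :=
  mfderivWithin 𝓘(ℝ, ℝ) 𝓘(ℝ, V) γ (Icc a b) t (1 : ℝ)

/-- The curve `γ' : [a, b] → TN`. -/
def curveVelocity (γ : ℝ → N) (a b : ℝ) (t : ℝ) : TangentBundle 𝓘(ℝ, V) N :=
  ⟨γ t, curveDeriv γ a b t⟩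

/-- `γ : [a, b] → N` is piecewise smooth: it is smooth on each closed interval of some partition
of `[a, b]` (in particular it is continuous on `[a, b]`). -/
def IsPiecewiseSmooth (V : Type*) [NormedAddCommGroup V] [NormedSpace ℝ V]
    {N : Type*} [TopologicalSpace N] [ChartedSpace V N] (γ : ℝ → N) (a b : ℝ) : Prop :=
  PiecewiseOn (fun c d => ContMDiffOn 𝓘(ℝ, ℝ) 𝓘(ℝ, V) ∞ γ (Icc c d)) a b

end Curves

section Sprays

variable {V : Type*} [NormedAddCommGroup V] [NormedSpace ℝ V]
  {M : Type*} [TopologicalSpace M] [ChartedSpace V M] [IsManifold 𝓘(ℝ, V) ∞ M]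

/-- Multiplication by the scalar `a` on the tangent bundle. -/
def tangentScale (a : ℝ) (v : TangentBundle 𝓘(ℝ, V) M) : TangentBundle 𝓘(ℝ, V) M :=
  ⟨v.1, a • v.2⟩

/-- A spray on `M`: a smooth vector field `S` on the manifold `TM` with `dπ(S(v)) = v` and
`a dm_a(S(v)) = S(a v)`, where `π : TM → M` is the projection and `m_a` the multiplication
by `a` on `TM`. -/
structure IsSpray
    (S : (v : TangentBundle 𝓘(ℝ, V) M) → TangentSpace 𝓘(ℝ, V).tangent v) : Prop where
  smooth : ContMDiff 𝓘(ℝ, V).tangent 𝓘(ℝ, V).tangent.tangent ∞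
    (fun v => (⟨v, S v⟩ : TangentBundle 𝓘(ℝ, V).tangent (TangentBundle 𝓘(ℝ, V) M)))
  proj : ∀ v : TangentBundle 𝓘(ℝ, V) M,
    mfderiv 𝓘(ℝ, V).tangent 𝓘(ℝ, V)
      (fun u : TangentBundle 𝓘(ℝ, V) M => u.proj) v (S v) = v.2
  scale : ∀ (a : ℝ) (v : TangentBundle 𝓘(ℝ, V) M),
    a • mfderiv 𝓘(ℝ, V).tangent 𝓘(ℝ, V).tangent (tangentScale a) v (S v) = S (tangentScale a v)

/-- `γ : [a, b] → M` is a solution of `S`: it is differentiable and `γ' : [a, b] → TM` is an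
integral curve of `S`. -/
def IsSpraySolution
    (S : (v : TangentBundle 𝓘(ℝ, V) M) → TangentSpace 𝓘(ℝ, V).tangent v)
    (γ : ℝ → M) (a b : ℝ) : Prop :=
  MDifferentiableOn 𝓘(ℝ, ℝ) 𝓘(ℝ, V) γ (Icc a b) ∧
    IsMIntegralCurveOn (I := 𝓘(ℝ, V).tangent) (curveVelocity γ a b) S (Icc a b)

/-- `γ : [a, b] → M` is a piecewise solution of `S`. -/
def IsPiecewiseSpraySolution
    (S : (v : TangentBundle 𝓘(ℝ, V) M) → TangentSpace 𝓘(ℝ, V).tangent v)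
    (γ : ℝ → M) (a b : ℝ) : Prop :=
  PiecewiseOn (IsSpraySolution S γ) a b

end Sprays

section Distributions

variable {V : Type*} [NormedAddCommGroup V] [NormedSpace ℝ V]
  {E : Type*} [TopologicalSpace E] [ChartedSpace V E] [IsManifold 𝓘(ℝ, V) ∞ E]

/-- The vector field `X` is smooth on the set `U`. -/
def IsSmoothFieldOn (X : (y : E) → TangentSpace 𝓘(ℝ, V) y) (U : Set E) : Prop :=
  ContMDiffOn 𝓘(ℝ, V) 𝓘(ℝ, V).tangent ∞ (fun y => (⟨y, X y⟩ : TangentBundle 𝓘(ℝ, V) E)) U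

/-- `D` is a smooth distribution, i.e. a smooth vector subbundle of `TE`: near every point it is
spanned by a smooth frame. -/
def IsSmoothDistribution (D : (x : E) → Submodule ℝ (TangentSpace 𝓘(ℝ, V) x)) : Prop :=
  ∀ x : E, ∃ (U : Set E) (k : ℕ) (X : Fin k → (y : E) → TangentSpace 𝓘(ℝ, V) y),
    IsOpen U ∧ x ∈ U ∧ (∀ i, IsSmoothFieldOn (X i) U) ∧
      ∀ y ∈ U, LinearIndependent ℝ (fun i => X i y) ∧
        D y = Submodule.span ℝ (Set.range fun i => X i y)

/-- `X` is, on an open neighborhood of `x`, a smooth `D`-horizontal vector field. -/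
def IsHorizontalFieldNear (D : (x : E) → Submodule ℝ (TangentSpace 𝓘(ℝ, V) x))
    (X : (y : E) → TangentSpace 𝓘(ℝ, V) y) (x : E) : Prop :=
  ∃ U : Set E, IsOpen U ∧ x ∈ U ∧ IsSmoothFieldOn X U ∧ ∀ y ∈ U, X y ∈ D y

open Classical in
/-- The Levi form `L_x : D_x × D_x → T_xE / D_x` of the distribution `D` at `x`:
`L_x(v, w) = [X, Y](x) + D_x`, where `X`, `Y` are smooth `D`-horizontal vector fields near `x` with
`X(x) = v` and `Y(x) = w`. Such fields exist and the value does not depend on them, see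
`exists_horizontalFieldNear` and `leviForm_eq` below. -/
def leviForm (D : (x : E) → Submodule ℝ (TangentSpace 𝓘(ℝ, V) x)) (x : E) (v w : D x) :
    TangentSpace 𝓘(ℝ, V) x ⧸ D x :=
  if h : ∃ p : ((y : E) → TangentSpace 𝓘(ℝ, V) y) × ((y : E) → TangentSpace 𝓘(ℝ, V) y),
      IsHorizontalFieldNear D p.1 x ∧ IsHorizontalFieldNear D p.2 x ∧
        p.1 x = (v : TangentSpace 𝓘(ℝ, V) x) ∧ p.2 x = (w : TangentSpace 𝓘(ℝ, V) x)
  then Submodule.Quotient.mk (VectorField.mlieBracket 𝓘(ℝ, V) h.choose.1 h.choose.2 x)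
  else 0

variable {D : (x : E) → Submodule ℝ (TangentSpace 𝓘(ℝ, V) x)} {x : E}

theorem IsSmoothFieldOn.contMDiffAt {X : (y : E) → TangentSpace 𝓘(ℝ, V) y} {U : Set E}
    (h : IsSmoothFieldOn X U) (hU : IsOpen U) {y : E} (hy : y ∈ U) :
    ContMDiffAt 𝓘(ℝ, V) 𝓘(ℝ, V).tangent ∞ (fun y => (⟨y, X y⟩ : TangentBundle 𝓘(ℝ, V) E)) y :=
  ContMDiffOn.contMDiffAt h (hU.mem_nhds hy)

theorem IsHorizontalFieldNear.contMDiffAt {X : (y : E) → TangentSpace 𝓘(ℝ, V) y}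
    (h : IsHorizontalFieldNear D X x) :
    ContMDiffAt 𝓘(ℝ, V) 𝓘(ℝ, V).tangent ∞ (fun y => (⟨y, X y⟩ : TangentBundle 𝓘(ℝ, V) E)) x := by
  obtain ⟨U, hU, hx, hX, -⟩ := h
  exact hX.contMDiffAt hU hx

theorem IsHorizontalFieldNear.mdifferentiableAt {X : (y : E) → TangentSpace 𝓘(ℝ, V) y}
    (h : IsHorizontalFieldNear D X x) :
    MDifferentiableAt 𝓘(ℝ, V) 𝓘(ℝ, V).tangent
      (fun y => (⟨y, X y⟩ : TangentBundle 𝓘(ℝ, V) E)) x :=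
  h.contMDiffAt.mdifferentiableAt (by simp)

theorem IsHorizontalFieldNear.smul {X : (y : E) → TangentSpace 𝓘(ℝ, V) y} (c : ℝ)
    (h : IsHorizontalFieldNear D X x) : IsHorizontalFieldNear D (c • X) x := by
  obtain ⟨U, hU, hx, hX, hXD⟩ := h
  exact ⟨U, hU, hx, hX.const_smul_section, fun y hy => (D y).smul_mem c (hXD y hy)⟩

theorem IsHorizontalFieldNear.add {X Y : (y : E) → TangentSpace 𝓘(ℝ, V) y}
    (h : IsHorizontalFieldNear D X x) (h' : IsHorizontalFieldNear D Y x) :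
    IsHorizontalFieldNear D (X + Y) x := by
  obtain ⟨U, hU, hx, hX, hXD⟩ := h
  obtain ⟨U', hU', hx', hX', hXD'⟩ := h'
  refine ⟨U ∩ U', hU.inter hU', ⟨hx, hx'⟩, ?_, fun y hy => (D y).add_mem (hXD y hy.1) (hXD' y hy.2)⟩
  exact ContMDiffOn.add_section (ContMDiffOn.mono hX inter_subset_left)
    (ContMDiffOn.mono hX' inter_subset_right)

/-- Every vector of a smooth distribution extends to a smooth horizontal vector field. -/
theorem exists_horizontalFieldNear (hD : IsSmoothDistribution D) (v : D x) :
    ∃ X, IsHorizontalFieldNear D X x ∧ X x = (v : TangentSpace 𝓘(ℝ, V) x) := by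
  obtain ⟨U, k, X, hU, hx, hX, hspan⟩ := hD x
  have hv : (v : TangentSpace 𝓘(ℝ, V) x) ∈ Submodule.span ℝ (Set.range fun i => X i x) := by
    rw [← (hspan x hx).2]; exact v.2
  obtain ⟨c, hc⟩ := (Submodule.mem_span_range_iff_exists_fun ℝ).1 hv
  refine ⟨fun y => ∑ i, c i • X i y, ⟨U, hU, hx, ?_, fun y hy => ?_⟩, hc⟩
  · exact ContMDiffOn.sum_section fun i _ => ContMDiffOn.const_smul_section (hX i)
  · rw [(hspan y hy).2]
    exact Submodule.sum_mem _ fun i _ => Submodule.smul_mem _ _ (Submodule.subset_span ⟨i, rfl⟩)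

/-- The Lie bracket of two smooth horizontal fields is horizontal at a zero of the first one. -/
theorem mlieBracket_mem_of_eq_zero [FiniteDimensional ℝ V] (hD : IsSmoothDistribution D)
    {X Y : (y : E) → TangentSpace 𝓘(ℝ, V) y} (hX : IsHorizontalFieldNear D X x)
    (h0 : X x = 0) :
    VectorField.mlieBracket 𝓘(ℝ, V) X Y x ∈ D x := by
  obtain ⟨U, k, Z, hU, hx, hZ, hspan⟩ := hD x
  obtain ⟨U', hU', hx', hXs, hXD⟩ := hX
  set e := trivializationAt V (TangentSpace 𝓘(ℝ, V) : E → Type _) x with he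
  have hxe : x ∈ e.baseSet := mem_baseSet_trivializationAt V _ x
  let L : (y : E) → TangentSpace 𝓘(ℝ, V) y →L[ℝ] V := fun y => e.continuousLinearMapAt ℝ y
  have hL : ∀ y ∈ e.baseSet, ∀ u : TangentSpace 𝓘(ℝ, V) y, (e ⟨y, u⟩).2 = L y u := by
    intro y hy u
    simp [L, Bundle.Trivialization.continuousLinearMapAt_apply, Bundle.Trivialization.coe_linearMapAt_of_mem e hy]
  -- the frame and the field in the trivialization
  have smooth_triv : ∀ W : (y : E) → TangentSpace 𝓘(ℝ, V) y,
      ContMDiffAt 𝓘(ℝ, V) 𝓘(ℝ, V).tangent ∞ (fun y => (⟨y, W y⟩ : TangentBundle 𝓘(ℝ, V) E)) x →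
      ContMDiffAt 𝓘(ℝ, V) 𝓘(ℝ, V) ∞ (fun y => L y (W y)) x := by
    intro W hW
    have := (Bundle.contMDiffAt_section (IB := 𝓘(ℝ, V)) (F := V)
      (E := (TangentSpace 𝓘(ℝ, V) : E → Type _)) x).1 hW
    refine this.congr_of_eventuallyEq ?_
    filter_upwards [e.open_baseSet.mem_nhds hxe] with y hy
    exact (hL y hy _).symm
  let A : E → ((Fin k → ℝ) →L[ℝ] V) := fun y =>
    ∑ i, (ContinuousLinearMap.proj (R := ℝ) (φ := fun _ : Fin k => ℝ) i).smulRight (L y (Z i y))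
  have hA : ∀ y c, A y c = ∑ i, c i • L y (Z i y) := by
    intro y c; simp [A]
  have hAinj : Function.Injective (A x) := by
    have hli : LinearIndependent ℝ (fun i => L x (Z i x)) := by
      have hinj : Function.Injective (L x) := by
        intro u u' huu
        have h1 := congrArg (e.symmL ℝ x) huu
        rwa [e.symmL_continuousLinearMapAt hxe, e.symmL_continuousLinearMapAt hxe] at h1
      exact (hspan x hx).1.map' (L x).toLinearMap (LinearMap.ker_eq_bot.2 hinj)
    intro c c' hcc
    rw [hA, hA] at hcc
    refine (linearIndependent_iff_injective_fintypeLinearCombination.1 hli) ?_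
    simpa [Fintype.linearCombination_apply] using hcc
  obtain ⟨B₀, hB₀⟩ := LinearMap.exists_leftInverse_of_injective (A x).toLinearMap
    (LinearMap.ker_eq_bot.2 hAinj)
  let B : V →L[ℝ] (Fin k → ℝ) := LinearMap.toContinuousLinearMap B₀
  let G : E → ((Fin k → ℝ) →L[ℝ] (Fin k → ℝ)) := fun y => B.comp (A y)
  have hGx : G x = ((ContinuousLinearEquiv.refl ℝ (Fin k → ℝ) :
      (Fin k → ℝ) ≃L[ℝ] (Fin k → ℝ)) : (Fin k → ℝ) →L[ℝ] (Fin k → ℝ)) := by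
    ext1 c
    exact congrArg (fun T => T c) hB₀
  have hAs : ContMDiffAt 𝓘(ℝ, V) 𝓘(ℝ, (Fin k → ℝ) →L[ℝ] V) ∞ A x := by
    refine ContMDiffAt.sum fun i _ => ?_
    have h1 := smooth_triv (Z i) ((hZ i).contMDiffAt hU hx)
    exact ((ContinuousLinearMap.smulRightL ℝ (Fin k → ℝ) V
      (ContinuousLinearMap.proj (R := ℝ) (φ := fun _ : Fin k => ℝ) i)).contMDiff.contMDiffAt).comp
        x h1
  have hGs : ContMDiffAt 𝓘(ℝ, V) 𝓘(ℝ, (Fin k → ℝ) →L[ℝ] (Fin k → ℝ)) ∞ G x :=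
    ((ContinuousLinearMap.compL ℝ (Fin k → ℝ) V (Fin k → ℝ) B).contMDiff.contMDiffAt).comp x hAs
  have hGi : ContMDiffAt 𝓘(ℝ, V) 𝓘(ℝ, (Fin k → ℝ) →L[ℝ] (Fin k → ℝ)) ∞
      (fun y => (G y).inverse) x := by
    have h1 := contDiffAt_map_inverse (n := ∞) (ContinuousLinearEquiv.refl ℝ (Fin k → ℝ))
    rw [← hGx] at h1
    exact h1.contMDiffAt.comp x hGs
  let f : E → (Fin k → ℝ) := fun y => (G y).inverse (B (L y (X y)))
  have hf : ContMDiffAt 𝓘(ℝ, V) 𝓘(ℝ, Fin k → ℝ) ∞ f x :=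
    hGi.clm_apply ((B.contMDiff.contMDiffAt).comp x
      (smooth_triv X (hXs.contMDiffAt hU' hx')))
  have hfi : ∀ i, MDifferentiableAt 𝓘(ℝ, V) 𝓘(ℝ, ℝ) (fun y => f y i) x := fun i =>
    (((ContinuousLinearMap.proj (R := ℝ) (φ := fun _ : Fin k => ℝ) i).contMDiff.contMDiffAt
      (n := ∞)).comp x hf).mdifferentiableAt (by simp)
  have hf0 : f x = 0 := by simp [f, h0]
  have hXf : X =ᶠ[𝓝 x] ∑ i, (fun y => f y i) • Z i := by
    have hinv : ∀ᶠ y in 𝓝 x, G y ∈ Set.range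
        ((↑) : ((Fin k → ℝ) ≃L[ℝ] (Fin k → ℝ)) → ((Fin k → ℝ) →L[ℝ] (Fin k → ℝ))) :=
      hGs.continuousAt (by rw [hGx]; exact ContinuousLinearEquiv.nhds _)
    filter_upwards [hinv, hU.mem_nhds hx, hU'.mem_nhds hx'] with y ⟨g, hg⟩ hyU hyU'
    have hXy := hXD y hyU'
    rw [(hspan y hyU).2] at hXy
    obtain ⟨c, hc⟩ := (Submodule.mem_span_range_iff_exists_fun ℝ).1 hXy
    have hLc : B (L y (X y)) = G y c := by
      change _ = B (A y c)
      rw [hA, ← hc]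
      simp
    have hfc : f y = c := by
      change (G y).inverse (B (L y (X y))) = c
      rw [hLc, ← hg, ContinuousLinearMap.inverse_equiv]
      simp
    refine Eq.trans ?_ (Finset.sum_apply y Finset.univ fun i => (fun y => f y i) • Z i).symm
    rw [← hc]
    exact Finset.sum_congr rfl fun i _ => congrArg (fun d : Fin k → ℝ => d i • Z i y) hfc.symm
  have hbr : VectorField.mlieBracket 𝓘(ℝ, V) X Y x =
      VectorField.mlieBracket 𝓘(ℝ, V) (∑ i, (fun y => f y i) • Z i) Y x :=
    Filter.EventuallyEq.mlieBracket_vectorField_eq hXf (Filter.EventuallyEq.refl _ Y)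
  rw [hbr]
  have hZd : ∀ i, MDifferentiableAt 𝓘(ℝ, V) 𝓘(ℝ, V).tangent
      (fun y => (⟨y, Z i y⟩ : TangentBundle 𝓘(ℝ, V) E)) x := fun i =>
    ((hZ i).contMDiffAt hU hx).mdifferentiableAt (by simp)
  have hZf : ∀ i, MDifferentiableAt 𝓘(ℝ, V) 𝓘(ℝ, V).tangent
      (fun y => (⟨y, ((fun y => f y i) • Z i) y⟩ : TangentBundle 𝓘(ℝ, V) E)) x := fun i =>
    (hfi i).smul_section (hZd i)
  have key : ∀ s : Finset (Fin k),
      MDifferentiableAt 𝓘(ℝ, V) 𝓘(ℝ, V).tangent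
        (fun y => (⟨y, (∑ i ∈ s, (fun y => f y i) • Z i) y⟩ : TangentBundle 𝓘(ℝ, V) E)) x ∧
      VectorField.mlieBracket 𝓘(ℝ, V) (∑ i ∈ s, (fun y => f y i) • Z i) Y x ∈ D x := by
    intro s
    induction s using Finset.induction_on with
    | empty =>
      refine ⟨?_, ?_⟩
      · simp only [Finset.sum_empty]
        exact Bundle.mdifferentiable_zeroSection ℝ (TangentSpace 𝓘(ℝ, V) : E → Type _) x
      · simp
    | insert i s his ih =>
      rw [Finset.sum_insert his]
      refine ⟨mdifferentiableAt_add_section (hZf i) ih.1, ?_⟩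
      rw [VectorField.mlieBracket_add_left (hZf i) ih.1]
      refine (D x).add_mem ?_ ih.2
      rw [VectorField.mlieBracket_smul_left (hfi i) (hZd i)]
      have hZD : Z i x ∈ D x := by
        rw [(hspan x hx).2]; exact Submodule.subset_span ⟨i, rfl⟩
      simp only [hf0, Pi.zero_apply, zero_smul, add_zero]
      exact (D x).smul_mem _ hZD
  exact (key Finset.univ).2

/-- The Levi form is computed by any pair of smooth horizontal extensions. -/
theorem leviForm_eq [FiniteDimensional ℝ V] (hD : IsSmoothDistribution D)
    {X Y : (y : E) → TangentSpace 𝓘(ℝ, V) y} (hX : IsHorizontalFieldNear D X x)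
    (hY : IsHorizontalFieldNear D Y x) (v w : D x) (hv : X x = (v : TangentSpace 𝓘(ℝ, V) x))
    (hw : Y x = (w : TangentSpace 𝓘(ℝ, V) x)) :
    leviForm D x v w = Submodule.Quotient.mk (VectorField.mlieBracket 𝓘(ℝ, V) X Y x) := by
  have h : ∃ p : ((y : E) → TangentSpace 𝓘(ℝ, V) y) × ((y : E) → TangentSpace 𝓘(ℝ, V) y),
      IsHorizontalFieldNear D p.1 x ∧ IsHorizontalFieldNear D p.2 x ∧
        p.1 x = (v : TangentSpace 𝓘(ℝ, V) x) ∧ p.2 x = (w : TangentSpace 𝓘(ℝ, V) x) :=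
    ⟨(X, Y), hX, hY, hv, hw⟩
  obtain ⟨hX', hY', hv', hw'⟩ := h.choose_spec
  rw [leviForm, dif_pos h, Submodule.Quotient.eq]
  set X' := h.choose.1
  set Y' := h.choose.2
  -- [W', Z] - [W, Z] is horizontal at x if W, W' agree at x
  have aux : ∀ W W' Z : (y : E) → TangentSpace 𝓘(ℝ, V) y, IsHorizontalFieldNear D W x →
      IsHorizontalFieldNear D W' x → W x = W' x →
      VectorField.mlieBracket 𝓘(ℝ, V) W' Z x - VectorField.mlieBracket 𝓘(ℝ, V) W Z x ∈ D x := by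
    intro W W' Z hW hW' hWW
    have h1 := mlieBracket_mem_of_eq_zero (Y := Z) hD (hW'.add (hW.smul (-1)))
      (by simp [hWW])
    rw [VectorField.mlieBracket_add_left hW'.mdifferentiableAt (hW.smul (-1)).mdifferentiableAt,
      VectorField.mlieBracket_const_smul_left hW.mdifferentiableAt] at h1
    simpa [sub_eq_add_neg] using h1
  have h1 := aux X X' Y' hX hX' (hv.trans hv'.symm)
  have h2 := aux Y' Y X hY' hY (hw'.trans hw.symm)
  rw [VectorField.mlieBracket_swap_apply (V := Y), VectorField.mlieBracket_swap_apply (V := Y')]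
    at h2
  have h3 := (D x).add_mem h1 h2
  convert h3 using 1
  abel

end Distributions

section Horizontal

variable (VM : Type*) [NormedAddCommGroup VM] [NormedSpace ℝ VM]
  {M : Type*} [TopologicalSpace M] [ChartedSpace VM M]
  {VE : Type*} [NormedAddCommGroup VE] [NormedSpace ℝ VE]
  {E : Type*} [TopologicalSpace E] [ChartedSpace VE E]

/-- The distribution `D` on `E` is horizontal for `π : E → M`: `T_xE = Ker(dπ_x) ⊕ D_x`. -/
def IsHorizontalDistribution (π : E → M)
    (D : (x : E) → Submodule ℝ (TangentSpace 𝓘(ℝ, VE) x)) : Prop :=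
  ∀ x : E, IsCompl (LinearMap.ker (mfderiv 𝓘(ℝ, VE) 𝓘(ℝ, VM) π x).toLinearMap) (D x)

/-- `σ : [a, b] → E` is a horizontal lifting of `γ : [a, b] → M`: it is piecewise smooth, its
derivative lies in `D` wherever it exists, and `π ∘ σ = γ`. -/
structure IsHorizontalLift (π : E → M)
    (D : (x : E) → Submodule ℝ (TangentSpace 𝓘(ℝ, VE) x))
    (γ : ℝ → M) (σ : ℝ → E) (a b : ℝ) : Prop where
  smooth : IsPiecewiseSmooth VE σ a b
  horizontal : ∀ t ∈ Icc a b, MDifferentiableWithinAt 𝓘(ℝ, ℝ) 𝓘(ℝ, VE) σ (Icc a b) t →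
    curveDeriv σ a b t ∈ D (σ t)
  lift : ∀ t ∈ Icc a b, π (σ t) = γ t

/-- `s : M → E` is a global smooth horizontal section of `π`. -/
structure IsHorizontalSection (π : E → M)
    (D : (x : E) → Submodule ℝ (TangentSpace 𝓘(ℝ, VE) x)) (s : M → E) : Prop where
  smooth : ContMDiff 𝓘(ℝ, VM) 𝓘(ℝ, VE) ∞ s
  isSection : ∀ m, π (s m) = m
  horizontal : ∀ m,
    LinearMap.range (mfderiv 𝓘(ℝ, VM) 𝓘(ℝ, VE) s m).toLinearMap = D (s m)

end Horizontal

end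

/-!
Let `R ⊆ E` be the set of points which are reached from `e₀` by horizontal lifts of piecewise
solutions of the spray (`IsReachable`). The image of the wanted section is `R`, and the proof makes
`R`, with a topology finer than the one induced by `E`, into a covering space of `M`.

*Local sections.* The horizontal lifts of the solutions of the spray which start at `e ∈ R` satisfy
an ordinary differential equation in a chart (`liftedSpray`), and for a short fixed time `T` their
projections reach every point near `π e` (`exists_family_of_secondOrder`). Their end points thus
define a section `s` of `π` near `π e`. In a chart, let `H` be the operator which lifts tangent
vectors of `M` horizontally. The lifts run through points of `R`, where the Levi form vanishes; this
means that the derivative of `H` has the symmetry `H'(H u) w = H'(H w) u`, i.e. that `H` has no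
curvature there (`IsLiftOperator.curvature_eq`). By Grönwall's inequality this symmetry along a
single lift is enough for the end point to depend horizontally on the end point of the projection
(`hasFDerivAt_endpoint`). Hence `ds = H ∘ s`, and `s` is smooth and horizontal, with values in `R`
(`exists_isHorizontalSectionNear`).

*The leaf.* Horizontal curves over a given curve and horizontal sections are determined by one value
(`PiecewiseOn.eqOn_of_left`, `IsHorizontalSectionNear.eventuallyEq`), so the images of these local
sections are the plaques of a topology on `R` for which `R → M` is a separated local homeomorphism
(`isSectionGerms_reachable`, `IsSectionGerms.isLocalHomeomorph`, `IsSectionGerms.isSeparatedMap`).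

*Covering.* Every point of `M` has a neighborhood which is contracted to it along solutions of the
spray (`IsSpray.exists_normal_nhds`). Concatenation with a piecewise solution that leads to a given
point of `R`, together with the lifting assumption and uniqueness of lifts, shows that solutions of
the spray lift to `R` from any point (`IsReachable.exists_lift`, `exists_isLeafLift`); since the
reverse of a solution is a solution, they lift from both ends. So the neighborhood is evenly covered
(`IsSectionGerms.isEvenlyCovered`), `R → M` is a covering, and it has a section through `e₀` as `M`
is simply connected (`IsSectionGerms.exists_global_section`). Uniqueness holds because two
horizontal sections agree on an open and closed set.
-/

noncomputable section

/-! ### Global sections from germs of sections on a simply connected space -/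

section SectionGerms

variable {M R : Type*} [TopologicalSpace M]

/-- A family of germs of sections of a map of sets `p : R → M`: `G x s` says that `s` is a
distinguished section near `x`. By `eventuallyEq`, the images of the distinguished sections are the
plaques of a topology on `R` for which `p` is a local homeomorphism; by `eventually_ne`, distinct
points of a fibre are separated by plaques. -/
structure IsSectionGerms (p : R → M) (G : M → (M → R) → Prop) : Prop where
  eventually : ∀ {x s}, G x s → ∀ᶠ y in 𝓝 x, G y s
  proj : ∀ {x s}, G x s → p (s x) = x
  eventuallyEq : ∀ {x s s'}, G x s → G x s' → s x = s' x → s =ᶠ[𝓝 x] s'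
  eventually_ne : ∀ {x s s'}, G x s → G x s' → s x ≠ s' x → ∀ᶠ y in 𝓝 x, s y ≠ s' y
  exists_germ : ∀ e, ∃ s, G (p e) s ∧ s (p e) = e

/-- The leaf topology: the finest topology for which every section is continuous at the points near
which it is distinguished. -/
@[reducible] def leafTopology (G : M → (M → R) → Prop) : TopologicalSpace R where
  IsOpen W := ∀ x s, G x s → s x ∈ W → ∀ᶠ y in 𝓝 x, s y ∈ W
  isOpen_univ := fun _ _ _ _ => Filter.Eventually.of_forall fun _ => mem_univ _
  isOpen_inter := fun _ _ h h' x s hs hx => (h x s hs hx.1).and (h' x s hs hx.2)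
  isOpen_sUnion := by
    rintro W h x s hs ⟨w, hw, hx⟩
    filter_upwards [h w hw x s hs hx] with y hy using ⟨w, hw, hy⟩

/-- `σ` is a lift of the path `γ` which locally runs inside distinguished sections. -/
def IsLeafLift (G : M → (M → R) → Prop) (γ : unitInterval → M) (σ : unitInterval → R) : Prop :=
  ∀ t, ∃ s, G (γ t) s ∧ ∀ᶠ t' in 𝓝 t, σ t' = s (γ t')

namespace IsSectionGerms

variable {p : R → M} {G : M → (M → R) → Prop}

theorem continuousAt {x : M} {s : M → R} (hs : G x s) :
    @ContinuousAt _ _ _ (leafTopology G) s x := by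
  let _ := leafTopology G
  intro W hW
  obtain ⟨O, hOW, hO, hx⟩ := mem_nhds_iff.1 hW
  filter_upwards [hO x s hs hx] with y hy using hOW hy

theorem continuous_proj (h : IsSectionGerms p G) :
    @Continuous _ _ (leafTopology G) _ p := by
  let _ := leafTopology G
  refine ⟨fun O hO x s hs hx => ?_⟩
  rw [mem_preimage, h.proj hs] at hx
  filter_upwards [h.eventually hs, hO.mem_nhds hx] with y hy hyO
  rwa [mem_preimage, h.proj hy]

/-- The plaques are open in the leaf topology. -/
theorem isOpen_image (h : IsSectionGerms p G) {s : M → R} {O : Set M} (hO : IsOpen O)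
    (hs : ∀ y ∈ O, G y s) : IsOpen[leafTopology G] (s '' O) := by
  rintro x s' hs' ⟨y, hy, hxy⟩
  obtain rfl : y = x := by rw [← h.proj (hs y hy), hxy, h.proj hs']
  filter_upwards [h.eventuallyEq (hs y hy) hs' hxy, hO.mem_nhds hy] with z hz hzO
  exact ⟨z, hzO, hz⟩

theorem exists_isOpen (h : IsSectionGerms p G) {x : M} {s : M → R} (hs : G x s) :
    ∃ O, IsOpen O ∧ x ∈ O ∧ ∀ y ∈ O, G y s := by
  obtain ⟨O, h1, h2, h3⟩ := mem_nhds_iff.1 (h.eventually hs)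
  exact ⟨O, h2, h3, h1⟩

theorem isLocalHomeomorph (h : IsSectionGerms p G) :
    @IsLocalHomeomorph _ _ (leafTopology G) _ p := by
  let _ := leafTopology G
  refine IsLocalHomeomorph.mk p fun e => ?_
  obtain ⟨s, hs, hse⟩ := h.exists_germ e
  obtain ⟨O, hO, hx, hOs⟩ := h.exists_isOpen hs
  refine ⟨{ toFun := p, invFun := s, source := s '' O, target := O
            map_source' := ?_, map_target' := fun y hy => ⟨y, hy, rfl⟩
            left_inv' := ?_, right_inv' := fun y hy => h.proj (hOs y hy)
            open_source := h.isOpen_image hO hOs, open_target := hO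
            continuousOn_toFun := h.continuous_proj.continuousOn
            continuousOn_invFun := fun y hy => (continuousAt (hOs y hy)).continuousWithinAt },
    ⟨p e, hx, hse⟩, fun _ _ => rfl⟩
  · rintro _ ⟨y, hy, rfl⟩
    rwa [h.proj (hOs y hy)]
  · rintro _ ⟨y, hy, rfl⟩
    rw [h.proj (hOs y hy)]

theorem isSeparatedMap (h : IsSectionGerms p G) : @IsSeparatedMap _ _ (leafTopology G) p := by
  let _ := leafTopology G
  intro e e' hp hne
  obtain ⟨s, hs, hse⟩ := h.exists_germ e
  obtain ⟨s', hs', hse'⟩ := h.exists_germ e'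
  rw [← hp] at hs' hse'
  have hev := (h.eventually hs).and ((h.eventually hs').and
    (h.eventually_ne hs hs' (by rwa [hse, hse'])))
  obtain ⟨O, hOs, hO, hx⟩ := mem_nhds_iff.1 hev
  refine ⟨s '' O, s' '' O, h.isOpen_image hO fun y hy => (hOs hy).1,
    h.isOpen_image hO fun y hy => (hOs hy).2.1, ⟨p e, hx, hse⟩, ⟨p e, hx, hse'⟩, ?_⟩
  rw [Set.disjoint_left]
  rintro _ ⟨y, hy, rfl⟩ ⟨z, hz, hyz⟩
  obtain rfl : z = y := by rw [← h.proj (hOs hz).2.1, hyz, h.proj (hOs hy).1]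
  exact (hOs hy).2.2 hyz.symm

theorem continuous_of_isLeafLift {γ : unitInterval → M} {σ : unitInterval → R} (hγ : Continuous γ)
    (hσ : IsLeafLift G γ σ) : @Continuous _ _ _ (leafTopology G) σ := by
  let _ := leafTopology G
  rw [continuous_iff_continuousAt]
  intro t
  obtain ⟨s, hs, hst⟩ := hσ t
  exact (ContinuousAt.comp (continuousAt hs) hγ.continuousAt).congr
    (hst.mono fun _ h => h.symm)

theorem proj_of_isLeafLift (h : IsSectionGerms p G) {γ : unitInterval → M} {σ : unitInterval → R}
    (hσ : IsLeafLift G γ σ) (t : unitInterval) : p (σ t) = γ t := by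
  obtain ⟨s, hs, hst⟩ := hσ t
  rw [hst.self_of_nhds, h.proj hs]

/-- A point with a contractible neighborhood, such that the contracting paths lift to leaves from
both ends, is evenly covered by the leaves: the lifts of the contracting paths depend continuously
on the end point since `p` is a separated local homeomorphism. -/
theorem isEvenlyCovered (h : IsSectionGerms p G) {x : M} {U : Set M} (hU : IsOpen U) (hx : x ∈ U)
    (Γ : C(unitInterval × U, M)) (h0 : ∀ y, Γ (0, y) = x) (h1 : ∀ y, Γ (1, y) = y)
    (hlift : ∀ (y : U) (e : R), p e = x → ∃ σ, σ 0 = e ∧ IsLeafLift G (fun t => Γ (t, y)) σ)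
    (hlift' : ∀ (y : U) (e : R), p e = y → ∃ σ, σ 1 = e ∧ IsLeafLift G (fun t => Γ (t, y)) σ) :
    @IsEvenlyCovered _ _ (leafTopology G) _ p x (p ⁻¹' {x})
      (@instTopologicalSpaceSubtype _ _ (leafTopology G)) := by
  let _ := leafTopology G
  have hloc := h.isLocalHomeomorph
  have hsep := h.isSeparatedMap
  have hdisc : DiscreteTopology (p ⁻¹' {x}) := by
    have : Subsingleton (p '' (p ⁻¹' {x})) :=
      (Set.subsingleton_singleton.anti (image_preimage_subset p {x})).coe_sort
    have : DiscreteTopology (p '' (p ⁻¹' {x})) := Subsingleton.discreteTopology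
    exact (hloc.isLocalHomeomorphOn).mono (subset_univ _) |>.discreteTopology_of_image
  choose σ hσ0 hσ using hlift
  have hΓ : ∀ y, Continuous fun t => Γ (t, y) := fun y =>
    Γ.continuous.comp (Continuous.prodMk_left y)
  have hcont : ∀ e : p ⁻¹' {x}, Continuous fun q : unitInterval × U => σ q.2 e e.2 q.1 := fun e =>
    hloc.continuous_lift hsep Γ (g := fun q : unitInterval × U => σ q.2 e e.2 q.1)
      (funext fun q => h.proj_of_isLeafLift (hσ q.2 e e.2) q.1)
      (continuous_const.congr fun y => (hσ0 y e e.2).symm)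
      (fun y => continuous_of_isLeafLift (hΓ y) (hσ y e e.2))
  let f : U × (p ⁻¹' {x}) → R := fun q => σ q.1 q.2 q.2.2 1
  have hpf : ∀ q, p (f q) = q.1 := fun q =>
    (h.proj_of_isLeafLift (hσ q.1 q.2 q.2.2) 1).trans (h1 q.1)
  have hfe : ∀ e, Continuous fun y => f (y, e) := fun e =>
    (hcont e).comp (Continuous.prodMk_right (1 : unitInterval))
  have hf : Continuous f := continuous_prod_of_discrete_right.2 hfe
  have huniq : ∀ (y : U) (σ₁ σ₂ : unitInterval → R) (t : unitInterval),
      IsLeafLift G (fun t => Γ (t, y)) σ₁ → IsLeafLift G (fun t => Γ (t, y)) σ₂ →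
        σ₁ t = σ₂ t → σ₁ = σ₂ := by
    intro y σ₁ σ₂ t h₁ h₂ ht
    refine hsep.eq_of_comp_eq hloc.isLocallyInjective (continuous_of_isLeafLift (hΓ y) h₁)
      (continuous_of_isLeafLift (hΓ y) h₂) (funext fun t => ?_) t ht
    exact (h.proj_of_isLeafLift h₁ t).trans (h.proj_of_isLeafLift h₂ t).symm
  have hinj : Function.Injective f := by
    rintro ⟨y, e⟩ ⟨y', e'⟩ hq
    obtain rfl : y = y' := Subtype.ext (by rw [← hpf (y, e), hq, hpf])
    have := congrFun (huniq y _ _ 1 (hσ y e e.2) (hσ y e' e'.2) hq) 0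
    rw [Subtype.ext (((hσ0 y e e.2).symm.trans this).trans (hσ0 y e' e'.2))]
  -- a point over `y ∈ U` is reached from the fibre over `x` by its lift of the contracting path
  have hrange : range f = p ⁻¹' U := by
    ext e
    constructor
    · rintro ⟨q, rfl⟩
      rw [mem_preimage, hpf]
      exact q.1.2
    · intro he
      obtain ⟨σ', hσ1, hσ'⟩ := hlift' ⟨p e, he⟩ e rfl
      have hx0 : p (σ' 0) = x := (h.proj_of_isLeafLift hσ' 0).trans (h0 _)
      refine ⟨(⟨p e, he⟩, ⟨σ' 0, hx0⟩), ?_⟩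
      have := huniq ⟨p e, he⟩ _ _ 0 (hσ ⟨p e, he⟩ (σ' 0) hx0) hσ' (hσ0 _ _ _)
      exact (congrFun this 1).trans hσ1
  have hopen : IsOpenMap f := by
    intro O hO
    have hOe : f '' O = ⋃ e, (fun y => f (y, e)) '' {y | (y, e) ∈ O} := by
      ext z
      simp only [mem_image, mem_iUnion, mem_ofPred_eq, Prod.exists]
      exact exists_comm
    rw [hOe]
    refine isOpen_iUnion fun e => ?_
    -- `p ∘ f (·, e)` is the inclusion of `U`, a local homeomorphism like `p`
    have hl : IsLocalHomeomorph fun y => f (y, e) := by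
      refine IsLocalHomeomorph.of_comp (g := p) ?_ hloc (hfe e)
      convert! hU.isOpenEmbedding_subtypeVal.isLocalHomeomorph using 1
      exact funext fun y => hpf (y, e)
    exact hl.isOpenMap _ (hO.preimage (Continuous.prodMk_left e))
  have hemb : Topology.IsOpenEmbedding f := .of_continuous_injective_isOpenMap hf hinj hopen
  refine ⟨hdisc, U, hx, hU, hU.preimage h.continuous_proj,
    ((hemb.toIsEmbedding.toHomeomorph).trans (Homeomorph.setCongr hrange)).symm, fun e => ?_⟩
  obtain ⟨q, hq⟩ :=
    ((hemb.toIsEmbedding.toHomeomorph).trans (Homeomorph.setCongr hrange)).surjective e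
  rw [← hq, Homeomorph.symm_apply_apply]
  exact (hpf q).symm

/-- Distinguished germs of sections over a simply connected base glue to a global section if every
point of the base has a neighborhood contracted by paths which lift to leaves. -/
theorem exists_global_section [SimplyConnectedSpace M] [LocallyPathConnectedSpace M]
    (h : IsSectionGerms p G)
    (hcontract : ∀ x : M, ∃ U : Set M, IsOpen U ∧ x ∈ U ∧ ∃ Γ : C(unitInterval × U, M),
      (∀ y, Γ (0, y) = x) ∧ (∀ y, Γ (1, y) = y) ∧
      (∀ (y : U) (e : R), p e = x → ∃ σ, σ 0 = e ∧ IsLeafLift G (fun t => Γ (t, y)) σ) ∧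
      (∀ (y : U) (e : R), p e = y → ∃ σ, σ 1 = e ∧ IsLeafLift G (fun t => Γ (t, y)) σ))
    (e₀ : R) :
    ∃ g : M → R, g (p e₀) = e₀ ∧ ∀ x, ∃ s, G x s ∧ g =ᶠ[𝓝 x] s := by
  let _ := leafTopology G
  have hcov : IsCoveringMap p := by
    intro x
    obtain ⟨U, hU, hx, Γ, h0, h1, hl, hl'⟩ := hcontract x
    exact h.isEvenlyCovered hU hx Γ h0 h1 hl hl'
  obtain ⟨g, ⟨hg0, hpg⟩, -⟩ :=
    hcov.existsUnique_continuousMap_lifts (ContinuousMap.id M) (p e₀) e₀ rfl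
  refine ⟨g, hg0, fun x => ?_⟩
  obtain ⟨s, hs, hsx⟩ := h.exists_germ (g x)
  have hpx : ∀ x, p (g x) = x := fun x => congrFun hpg x
  rw [hpx] at hs hsx
  obtain ⟨O, hO, hxO, hOs⟩ := h.exists_isOpen hs
  refine ⟨s, hs, ?_⟩
  have : s '' O ∈ 𝓝 (g x) := (h.isOpen_image hO hOs).mem_nhds ⟨x, hxO, hsx⟩
  filter_upwards [g.continuous.continuousAt this] with y hy
  obtain ⟨z, hz, hzy⟩ := hy
  obtain rfl : z = y := by rw [← h.proj (hOs z hz), hzy, hpx]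
  exact hzy.symm

end IsSectionGerms

end SectionGerms

/-! ### Properties of intervals that hold piecewise -/

namespace PiecewiseOn

variable {P : ℝ → ℝ → Prop} {a b c d : ℝ}

theorem nil (P : ℝ → ℝ → Prop) (a : ℝ) : PiecewiseOn P a a :=
  ⟨0, fun _ => a, fun i j h => absurd h (Subsingleton.elim (α := Fin 1) i j).not_lt, rfl, rfl,
    fun i => i.elim0⟩

theorem cons (hac : a < c) (h : P a c) (hP : PiecewiseOn P c b) : PiecewiseOn P a b := by
  obtain ⟨k, t, ht, h0, hk, hi⟩ := hP
  refine ⟨k + 1, Fin.cons a t, ?_, rfl, ?_, fun i => ?_⟩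
  · refine Fin.strictMono_iff_lt_succ.2 fun i => ?_
    refine Fin.cases ?_ (fun j => ?_) i
    · simpa [h0] using hac
    · rw [← Fin.succ_castSucc, Fin.cons_succ, Fin.cons_succ]
      exact ht j.castSucc_lt_succ
  · rw [← Fin.succ_last, Fin.cons_succ, hk]
  · refine Fin.cases ?_ (fun j => ?_) i
    · simpa [h0] using h
    · rw [← Fin.succ_castSucc, Fin.cons_succ, Fin.cons_succ]
      exact hi j

theorem of (hab : a < b) (h : P a b) : PiecewiseOn P a b := cons hab h (nil P b)

@[elab_as_elim]
theorem induction {Q : ℝ → ℝ → Prop} (hP : PiecewiseOn P a b) (hnil : ∀ a, Q a a)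
    (hcons : ∀ a c b, a < c → P a c → PiecewiseOn P c b → Q c b → Q a b) : Q a b := by
  obtain ⟨k, t, ht, h0, hk, hi⟩ := hP
  induction k generalizing a with
  | zero =>
    rw [← h0, ← hk]
    exact hnil _
  | succ k ih =>
    rw [← h0]
    have h1 : StrictMono (Fin.tail t) := fun i j hij => ht (Fin.succ_lt_succ_iff.2 hij)
    have h2 : Fin.tail t (Fin.last k) = b := by rw [← hk]; rfl
    have h3 : ∀ i : Fin k, P (Fin.tail t i.castSucc) (Fin.tail t i.succ) := fun i => hi i.succ
    refine hcons _ (t 1) b (ht (by simp)) (hi 0) ⟨k, Fin.tail t, h1, rfl, h2, h3⟩ ?_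
    exact ih (Fin.tail t) h1 rfl h2 h3

theorem le (hP : PiecewiseOn P a b) : a ≤ b :=
  hP.induction (fun _ => le_rfl) fun _ _ _ h _ _ h' => h.le.trans h'

theorem trans (hP : PiecewiseOn P a b) (hP' : PiecewiseOn P b c) : PiecewiseOn P a c := by
  have : ∀ c, PiecewiseOn P b c → PiecewiseOn P a c := by
    refine hP.induction (Q := fun a b => ∀ c, PiecewiseOn P b c → PiecewiseOn P a c)
      (fun _ _ h => h) ?_
    intro a c b hac h _ ih d hd
    exact cons hac h (ih d hd)
  exact this c hP'

theorem mono {P' : ℝ → ℝ → Prop} (hP : PiecewiseOn P a b)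
    (h : ∀ c d, a ≤ c → c < d → d ≤ b → P c d → P' c d) : PiecewiseOn P' a b := by
  revert h
  refine hP.induction (Q := fun a b => (∀ c d, a ≤ c → c < d → d ≤ b → P c d → P' c d) →
    PiecewiseOn P' a b) (fun _ _ => nil _ _) ?_
  intro a c b hac h hcb ih hP'
  exact cons hac (hP' _ _ le_rfl hac hcb.le h)
    (ih fun d e hd he he' => hP' d e (hac.le.trans hd) he he')

theorem restrict (hmono : ∀ a b c d, a ≤ c → c < d → d ≤ b → P a b → P c d)
    (hP : PiecewiseOn P a b) (hac : a ≤ c) (hcd : c ≤ d) (hdb : d ≤ b) : PiecewiseOn P c d := by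
  revert c d
  refine hP.induction (Q := fun a b => ∀ {c d}, a ≤ c → c ≤ d → d ≤ b → PiecewiseOn P c d) ?_ ?_
  · intro a c d hac hcd hda
    obtain rfl : c = d := by linarith
    exact nil _ _
  · intro a m b ham h hmb ih c d hac hcd hdb
    rcases hcd.eq_or_lt with rfl | hcd
    · exact nil _ _
    rcases le_total m c with hmc | hcm
    · exact ih hmc hcd.le hdb
    · rcases le_total d m with hdm | hmd
      · exact of hcd (hmono _ _ _ _ hac hcd hdm h)
      · rcases hcm.eq_or_lt with rfl | hcm
        · exact ih le_rfl hcd.le hdb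
        · exact cons hcm (hmono _ _ _ _ hac hcm le_rfl h) (ih le_rfl hmd hdb)

/-- A property of intervals which passes to subintervals and holds piecewise on `[a, b]` holds on
some interval to the right of every `t < b`; a corner may lie at `t`. -/
theorem exists_right (hmono : ∀ a b c d, a ≤ c → c < d → d ≤ b → P a b → P c d)
    (hP : PiecewiseOn P a b) {t : ℝ} (ht : t ∈ Ico a b) : ∃ d ∈ Ioc t b, P t d := by
  have h := hP.restrict hmono ht.1 ht.2.le le_rfl
  have hlt := ht.2
  revert hlt
  refine h.induction (Q := fun t b => t < b → ∃ d ∈ Ioc t b, P t d)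
    (fun _ h => absurd h (lt_irrefl _)) ?_
  intro t c b htc h hcb _ _
  exact ⟨c, ⟨htc, hcb.le⟩, h⟩

theorem exists_left (hmono : ∀ a b c d, a ≤ c → c < d → d ≤ b → P a b → P c d)
    (hP : PiecewiseOn P a b) {t : ℝ} (ht : t ∈ Ioc a b) : ∃ c ∈ Ico a t, P c t := by
  have h := hP.restrict hmono le_rfl ht.1.le ht.2
  have hlt := ht.1
  revert hlt
  refine h.induction (Q := fun a t => a < t → ∃ c ∈ Ico a t, P c t)
    (fun _ h => absurd h (lt_irrefl _)) ?_
  intro a c t hac h hct ih _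
  rcases hct.le.eq_or_lt with rfl | hlt
  · exact ⟨a, ⟨le_rfl, hac⟩, h⟩
  · obtain ⟨d, hd, hPd⟩ := ih hlt
    exact ⟨d, ⟨hac.le.trans hd.1, hd.2⟩, hPd⟩

end PiecewiseOn

/-! ### Second order differential equations in vector spaces -/

section ODE

open Metric
open scoped NNReal

/-- The local flow of a `C¹` vector field exists for a uniform time, stays in a given
neighborhood and is Lipschitz in the initial condition. -/
theorem exists_flow_lipschitzOnWith_of_contDiffAt {X : Type*} [NormedAddCommGroup X]
    [NormedSpace ℝ X] [CompleteSpace X] {F : X → X} {c₀ : X} (hF : ContDiffAt ℝ 1 F c₀) {N : Set X}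
    (hN : N ∈ 𝓝 c₀) :
    ∃ ε > 0, ∃ r > 0, ∃ (L : ℝ≥0) (φ : X → ℝ → X),
      (∀ c ∈ ball c₀ r, φ c 0 = c ∧
        ∀ t ∈ Ioo (-ε) ε, HasDerivAt (φ c) (F (φ c t)) t ∧ φ c t ∈ N) ∧
      ∀ t ∈ Ioo (-ε) ε, LipschitzOnWith L (φ · t) (ball c₀ r) := by
  obtain ⟨ε, hε, a, r, L, K, hr, hpl⟩ := IsPicardLindelof.of_contDiffAt_one hF
  obtain ⟨φ, hφ, L', hL'⟩ :=
    (hpl 0).exists_forall_mem_closedBall_eq_hasDerivWithinAt_lipschitzOnWith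
  simp only [zero_sub, zero_add] at hφ hL'
  have hcont : ContinuousOn (Function.uncurry φ) (closedBall c₀ r ×ˢ Icc (-ε) ε) :=
    continuousOn_prod_of_continuousOn_lipschitzOnWith _ L'
      (fun c hc => HasDerivWithinAt.continuousOn (hφ c hc).2) hL'
  have h0 : φ c₀ 0 = c₀ := (hφ c₀ (mem_closedBall_self r.2)).1
  have hat : ContinuousAt (Function.uncurry φ) (c₀, 0) :=
    hcont.continuousAt (prod_mem_nhds (closedBall_mem_nhds c₀ hr)
      (Icc_mem_nhds (by linarith) hε))
  have hev : ∀ᶠ q in 𝓝 (c₀, (0 : ℝ)), Function.uncurry φ q ∈ N := hat (by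
    change N ∈ 𝓝 (φ c₀ 0)
    rwa [h0])
  obtain ⟨δ, hδ, hδN⟩ := Metric.eventually_nhds_iff.1 hev
  refine ⟨min ε δ, lt_min hε hδ, min r δ, lt_min hr hδ, L', φ, ?_, ?_⟩
  · intro c hc
    have hcr : c ∈ closedBall c₀ r := (ball_subset_ball (min_le_left _ _)).trans
      ball_subset_closedBall hc
    refine ⟨(hφ c hcr).1, fun t ht => ?_⟩
    have htε : t ∈ Ioo (-ε) ε :=
      ⟨by linarith [ht.1, min_le_left ε δ], ht.2.trans_le (min_le_left _ _)⟩
    refine ⟨((hφ c hcr).2 t (Ioo_subset_Icc_self htε)).hasDerivAt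
      (Icc_mem_nhds htε.1 htε.2), hδN (y := (c, t)) ?_⟩
    rw [Prod.dist_eq]
    refine max_lt (lt_of_lt_of_le (mem_ball.1 hc) (min_le_right _ _)) ?_
    change dist t 0 < δ
    rw [Real.dist_0_eq_abs, abs_lt]
    exact ⟨by linarith [ht.1, min_le_right ε δ], ht.2.trans_le (min_le_right _ _)⟩
  · intro t ht
    exact (hL' t ⟨by linarith [ht.1, min_le_left ε δ], ht.2.le.trans (min_le_left _ _)⟩).mono
      ((ball_subset_ball (min_le_left _ _)).trans ball_subset_closedBall)

variable {Z V : Type*} [NormedAddCommGroup Z] [NormedSpace ℝ Z]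
  [NormedAddCommGroup V] [NormedSpace ℝ V]

/-- Consider a second order type system `c' = F c` on `Z × V`, where the second component of `c` is
the velocity of the image under `P : Z → V` of the first one, with stationary point `(z₀, 0)`.
The points `y` near `P z₀` are reached after a short fixed time `T` by the solutions starting at
`(z₀, v)`; the solution depends on `y` in a Lipschitz way. -/
theorem exists_family_of_secondOrder [CompleteSpace Z] [CompleteSpace V] {F : Z × V → Z × V}
    {z₀ : Z} (hF : ContDiffAt ℝ 1 F (z₀, 0)) (hF0 : F (z₀, 0) = 0) {P : Z → V}
    {P' : Z → Z →L[ℝ] V}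
    (hP : ∀ᶠ c in 𝓝 (z₀, (0 : V)), HasFDerivAt P (P' c.1) c.1 ∧ P' c.1 (F c).1 = c.2)
    {N : Set (Z × V)} (hN : N ∈ 𝓝 (z₀, (0 : V))) :
    ∃ T > 0, ∃ ε > T, ∃ U : Set V, IsOpen U ∧ P z₀ ∈ U ∧ ∃ (L : ℝ≥0) (c : V → ℝ → Z × V),
      (∀ y ∈ U, (c y 0).1 = z₀ ∧ P (c y T).1 = y ∧
        ∀ t ∈ Ioo (-ε) ε, HasDerivAt (c y) (F (c y t)) t ∧ c y t ∈ N) ∧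
      (∀ t ∈ Ioo (-ε) ε, LipschitzOnWith L (c · t) U) ∧ c (P z₀) T = (z₀, 0) := by
  obtain ⟨K, s, hs, hK⟩ := hF.exists_lipschitzOnWith
  obtain ⟨ε, hε, r, hr, L, φ, hφ, hL⟩ := exists_flow_lipschitzOnWith_of_contDiffAt hF
    (Filter.inter_mem hN (Filter.inter_mem hs hP))
  -- `K L T ≤ 1 / 2` makes the end point map `v ↦ P (z_v T) / T` a perturbation of the identity
  set T : ℝ := min (ε / 2) (1 / (2 * (K * L + 1))) with hTdef
  have hKL : (0 : ℝ) ≤ K * L := by positivity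
  have hT : 0 < T := lt_min (by linarith) (by positivity)
  have hTε : T < ε := (min_le_left _ _).trans_lt (by linarith)
  have hKLT : K * L * T ≤ 1 / 2 := by
    have : T ≤ 1 / (2 * (K * L + 1)) := min_le_right _ _
    rw [le_div_iff₀ (by positivity)] at this
    nlinarith
  have hsub : Icc 0 T ⊆ Ioo (-ε) ε := fun t ht => ⟨by linarith [ht.1], ht.2.trans_lt hTε⟩
  have hball : ∀ v ∈ ball (0 : V) r, (z₀, v) ∈ ball (z₀, (0 : V)) r := by
    intro v hv
    rw [mem_ball, Prod.dist_eq, dist_self]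
    exact max_lt hr hv
  have hder : ∀ v ∈ ball (0 : V) r, ∀ t ∈ Icc 0 T,
      HasDerivAt (φ (z₀, v)) (F (φ (z₀, v) t)) t := fun v hv t ht =>
    ((hφ _ (hball v hv)).2 t (hsub ht)).1
  have hFd : ∀ v ∈ ball (0 : V) r, ∀ w ∈ ball (0 : V) r, ∀ t ∈ Icc 0 T,
      ‖F (φ (z₀, v) t) - F (φ (z₀, w) t)‖ ≤ K * L * ‖v - w‖ := by
    intro v hv w hw t ht
    have h1 := hK.norm_sub_le ((hφ _ (hball v hv)).2 t (hsub ht)).2.2.1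
      ((hφ _ (hball w hw)).2 t (hsub ht)).2.2.1
    have h2 := (hL t (hsub ht)).norm_sub_le (hball v hv) (hball w hw)
    have h3 : ‖((z₀, v) : Z × V) - (z₀, w)‖ = ‖v - w‖ := by
      simp [Prod.norm_def]
    rw [h3] at h2
    calc _ ≤ _ := h1
      _ ≤ K * (L * ‖v - w‖) := by gcongr
      _ = _ := by ring
  -- the velocity stays close to the initial velocity
  have hsnd : ∀ v ∈ ball (0 : V) r, ∀ w ∈ ball (0 : V) r, ∀ t ∈ Icc 0 T,
      ‖(φ (z₀, v) t).2 - (φ (z₀, w) t).2 - (v - w)‖ ≤ K * L * T * ‖v - w‖ := by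
    intro v hv w hw t ht
    have h1 := norm_image_sub_le_of_norm_deriv_le_segment' (a := 0) (b := T)
      (f := fun t => (φ (z₀, v) t).2 - (φ (z₀, w) t).2)
      (f' := fun t => (F (φ (z₀, v) t)).2 - (F (φ (z₀, w) t)).2) (C := K * L * ‖v - w‖)
      (fun t ht => HasDerivAt.hasDerivWithinAt
        ((hasFDerivAt_snd.comp_hasDerivAt t (hder v hv t ht)).sub
          (hasFDerivAt_snd.comp_hasDerivAt t (hder w hw t ht))))
      (fun t ht => (norm_snd_le (F (φ (z₀, v) t) - F (φ (z₀, w) t))).trans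
        (hFd v hv w hw t (Ico_subset_Icc_self ht))) t ht
    simp only [(hφ _ (hball v hv)).1, (hφ _ (hball w hw)).1] at h1
    calc _ ≤ _ := h1
      _ ≤ K * L * ‖v - w‖ * T := by
        have := ht.2
        gcongr
        linarith
      _ = _ := by ring
  have hPd : ∀ v ∈ ball (0 : V) r, ∀ t ∈ Icc 0 T,
      HasDerivAt (fun t => P (φ (z₀, v) t).1) (φ (z₀, v) t).2 t := by
    intro v hv t ht
    have h1 := ((hφ _ (hball v hv)).2 t (hsub ht)).2.2.2
    have h2 := h1.1.comp_hasDerivAt t (hder v hv t ht).fst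
    rwa [h1.2] at h2
  let ev : V → V := fun v => T⁻¹ • P (φ (z₀, v) T).1
  have hev : ∀ v ∈ ball (0 : V) r, ∀ w ∈ ball (0 : V) r,
      ‖ev v - ev w - (v - w)‖ ≤ 1 / 2 * ‖v - w‖ := by
    intro v hv w hw
    have h1 := norm_image_sub_le_of_norm_deriv_le_segment' (a := 0) (b := T)
      (f := fun t => P (φ (z₀, v) t).1 - P (φ (z₀, w) t).1 - t • (v - w))
      (f' := fun t => (φ (z₀, v) t).2 - (φ (z₀, w) t).2 - (v - w)) (C := K * L * T * ‖v - w‖)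
      (fun t ht => by
        have := ((hPd v hv t ht).sub (hPd w hw t ht)).sub ((hasDerivAt_id t).smul_const (v - w))
        rw [one_smul] at this
        exact HasDerivAt.hasDerivWithinAt this)
      (fun t ht => hsnd v hv w hw t (Ico_subset_Icc_self ht)) T (right_mem_Icc.2 hT.le)
    simp only [(hφ _ (hball v hv)).1, (hφ _ (hball w hw)).1, sub_self, zero_smul, sub_zero] at h1
    have h2 : ev v - ev w - (v - w) =
        T⁻¹ • (P (φ (z₀, v) T).1 - P (φ (z₀, w) T).1 - T • (v - w)) := by
      simp only [ev, smul_sub, smul_smul, inv_mul_cancel₀ hT.ne', one_smul]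
    rw [h2, norm_smul, norm_inv, Real.norm_of_nonneg hT.le, inv_mul_le_iff₀ hT]
    calc _ ≤ _ := h1
      _ ≤ 1 / 2 * ‖v - w‖ * T := by gcongr
      _ = _ := by ring
  have happ : ApproximatesLinearOn ev ((ContinuousLinearEquiv.refl ℝ V : V ≃L[ℝ] V) : V →L[ℝ] V)
      (ball 0 r) (1 / 2) := by
    intro v hv w hw
    simpa using hev v hv w hw
  have hnorm : Subsingleton V ∨
      (1 / 2 : ℝ≥0) < ‖((ContinuousLinearEquiv.refl ℝ V).symm : V →L[ℝ] V)‖₊⁻¹ := by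
    rcases subsingleton_or_nontrivial V with h | h
    · exact Or.inl h
    · right
      have : ‖((ContinuousLinearEquiv.refl ℝ V).symm : V →L[ℝ] V)‖₊ = 1 := by
        rw [ContinuousLinearEquiv.refl_symm, ContinuousLinearEquiv.coe_refl]
        exact ContinuousLinearMap.nnnorm_id
      rw [this, inv_one]
      exact NNReal.half_lt_self one_ne_zero
  let e := happ.toOpenPartialHomeomorph ev (ball 0 r) hnorm isOpen_ball
  have he : ∀ v, e v = ev v := fun v => rfl
  have hesrc : e.source = ball 0 r := rfl
  have hconst : ∀ t ∈ Icc 0 T, φ (z₀, 0) t = (z₀, 0) := by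
    intro t ht
    have h0 := (hφ _ (hball 0 (mem_ball_self hr))).1
    refine ODE_solution_unique_of_mem_Icc_right (v := fun _ => F) (s := fun _ => s) (K := K)
      (a := 0) (b := T) (g := fun _ => (z₀, 0)) (fun _ _ => hK)
      (fun t ht => (hder 0 (mem_ball_self hr) t ht).continuousAt.continuousWithinAt)
      (fun t ht => (hder 0 (mem_ball_self hr) t (Ico_subset_Icc_self ht)).hasDerivWithinAt)
      (fun t ht => ((hφ _ (hball 0 (mem_ball_self hr))).2 t
        (hsub (Ico_subset_Icc_self ht))).2.2.1)
      continuousOn_const (fun t _ => ?_) (fun _ _ => mem_of_mem_nhds hs) h0 ht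
    rw [hF0]
    exact hasDerivWithinAt_const _ _ _
  have hev0 : ev 0 = T⁻¹ • P z₀ := by
    simp only [ev, hconst T (right_mem_Icc.2 hT.le)]
  have hinv : ∀ y ∈ e.target, e.symm y ∈ ball (0 : V) r := fun y hy => e.map_target hy
  refine ⟨T, hT, ε, hTε, (fun y => T⁻¹ • y) ⁻¹' e.target,
    e.open_target.preimage (continuous_const_smul _), ?_, L * (2 * ⟨T⁻¹, (inv_pos.2 hT).le⟩),
    fun y => φ (z₀, e.symm (T⁻¹ • y)), ?_, ?_, ?_⟩
  · rw [mem_preimage, ← hev0, ← he]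
    exact e.map_source (mem_ball_self hr)
  · intro y hy
    have h1 := hφ _ (hball _ (hinv (T⁻¹ • y) hy))
    refine ⟨by dsimp only; rw [h1.1], ?_, fun t ht => ⟨(h1.2 t ht).1, (h1.2 t ht).2.1⟩⟩
    have h2 : T⁻¹ • P (φ (z₀, e.symm (T⁻¹ • y)) T).1 = T⁻¹ • y := e.right_inv hy
    have h3 := congrArg (fun x => T • x) h2
    simpa only [smul_smul, mul_inv_cancel₀ hT.ne', one_smul] using h3
  · intro t ht
    refine (hL t ht).comp (t := ball (z₀, (0 : V)) r) ?_ (fun y hy => hball _ (hinv _ hy))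
    refine LipschitzOnWith.of_dist_le_mul fun y hy y' hy' => ?_
    have h1 := hev _ (hinv (T⁻¹ • y) hy) _ (hinv (T⁻¹ • y') hy')
    have h2 : ev (e.symm (T⁻¹ • y)) = T⁻¹ • y := e.right_inv hy
    have h2' : ev (e.symm (T⁻¹ • y')) = T⁻¹ • y' := e.right_inv hy'
    rw [h2, h2', ← smul_sub] at h1
    have h3 := norm_sub_norm_le (e.symm (T⁻¹ • y) - e.symm (T⁻¹ • y')) (T⁻¹ • (y - y'))
    rw [norm_sub_rev (e.symm (T⁻¹ • y) - e.symm (T⁻¹ • y'))] at h3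
    rw [norm_smul, norm_inv, Real.norm_of_nonneg hT.le] at h3
    rw [Prod.dist_eq, dist_self, max_eq_right dist_nonneg, dist_eq_norm, dist_eq_norm]
    change ‖e.symm (T⁻¹ • y) - e.symm (T⁻¹ • y')‖ ≤ 2 * T⁻¹ * ‖y - y'‖
    linarith
  · have h1 : e.symm (T⁻¹ • P z₀) = 0 := by
      rw [← hev0, ← he]
      exact e.left_inv (mem_ball_self hr)
    dsimp only
    rw [h1, hconst T (right_mem_Icc.2 hT.le)]

/-- Let `y ↦ z y` be a family of curves starting at `z₀`, horizontal for the lift operator `H`, with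
projections `P ∘ z y` of velocity `p y`, and such that `P (z y T) = y`. If the curvature of `H`
vanishes along `z y`, then `y' ↦ z y' T` is horizontal at `y`: the defect
`z y' - z y - H (z y) (P (z y') - P (z y))` satisfies a linear differential inequality up to a
quadratic error, so that it is quadratically small by Grönwall's inequality. -/
theorem hasFDerivAt_endpoint {H : Z → V →L[ℝ] Z} {H' : Z → Z →L[ℝ] V →L[ℝ] Z} {B : Set Z}
    {C L T : ℝ} (hC : 0 < C) (hL : 0 ≤ L) (hT : 0 ≤ T)
    (hrem : ∀ z ∈ B, ∀ z' ∈ B, ‖H z' - H z - H' z (z' - z)‖ ≤ C * ‖z' - z‖ ^ 2)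
    (hH : ∀ z ∈ B, HasFDerivAt H (H' z) z) (hH' : ∀ z ∈ B, ‖H' z‖ ≤ C)
    {U : Set V} {y : V} (hU : U ∈ 𝓝 y) {z : V → ℝ → Z} {p : V → ℝ → V} {P : Z → V} {z₀ : Z}
    (hz0 : ∀ y ∈ U, z y 0 = z₀) (hzT : ∀ y ∈ U, P (z y T) = y)
    (hzB : ∀ y ∈ U, ∀ t ∈ Icc 0 T, z y t ∈ B) (hp : ∀ y ∈ U, ∀ t ∈ Icc 0 T, ‖p y t‖ ≤ C)
    (hz : ∀ y ∈ U, ∀ t ∈ Icc 0 T, HasDerivAt (z y) (H (z y t) (p y t)) t)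
    (hP : ∀ y ∈ U, ∀ t ∈ Icc 0 T, HasDerivAt (fun t => P (z y t)) (p y t) t)
    (hzL : ∀ y ∈ U, ∀ y' ∈ U, ∀ t ∈ Icc 0 T, ‖z y' t - z y t‖ ≤ L * ‖y' - y‖)
    (hpL : ∀ y ∈ U, ∀ y' ∈ U, ∀ t ∈ Icc 0 T, ‖p y' t - p y t‖ ≤ L * ‖y' - y‖)
    (hcurv : ∀ t ∈ Icc 0 T, ∀ u w,
      H' (z y t) (H (z y t) u) w = H' (z y t) (H (z y t) w) u) :
    HasFDerivAt (fun y => z y T) (H (z y T)) y := by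
  have hy : y ∈ U := mem_of_mem_nhds hU
  have hTT : T ∈ Icc 0 T := right_mem_Icc.2 hT
  set A : ℝ := (C ^ 2 + C) * L ^ 2 / C ^ 2 * (Real.exp (C ^ 2 * T) - 1) with hA
  have key : ∀ y' ∈ U, ‖z y' T - z y T - H (z y T) (y' - y)‖ ≤ A * ‖y' - y‖ ^ 2 := by
    intro y' hy'
    let r : ℝ → Z := fun t => z y' t - z y t - H (z y t) (P (z y' t) - P (z y t))
    let r' : ℝ → Z := fun t => H (z y' t) (p y' t) - H (z y t) (p y t) -
      (H' (z y t) (H (z y t) (p y t)) (P (z y' t) - P (z y t)) + H (z y t) (p y' t - p y t))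
    have hr : ∀ t ∈ Icc 0 T, HasDerivAt r (r' t) t := by
      intro t ht
      have h1 : HasDerivAt (fun t => H (z y t)) (H' (z y t) (H (z y t) (p y t))) t :=
        (hH _ (hzB y hy t ht)).comp_hasDerivAt t (hz y hy t ht)
      exact ((hz y' hy' t ht).sub (hz y hy t ht)).sub
        (h1.clm_apply ((hP y' hy' t ht).sub (hP y hy t ht)))
    have hr0 : ‖r 0‖ ≤ 0 := by simp [r, hz0 y hy, hz0 y' hy']
    -- the symmetry of the curvature turns the terms of first order into `H' (z y) r (p y)`
    have hbound : ∀ t ∈ Icc 0 T,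
        ‖r' t‖ ≤ C ^ 2 * ‖r t‖ + (C ^ 2 + C) * L ^ 2 * ‖y' - y‖ ^ 2 := by
      intro t ht
      have e1 : r' t = (H (z y' t) - H (z y t) - H' (z y t) (z y' t - z y t)) (p y' t) +
          H' (z y t) (z y' t - z y t) (p y' t - p y t) + H' (z y t) (r t) (p y t) := by
        have := hcurv t ht (p y t) (P (z y' t) - P (z y t))
        simp only [r', r, this]
        simp only [map_sub, sub_apply]
        abel
      have b0 := hzL y hy y' hy' t ht
      have b1 : ‖(H (z y' t) - H (z y t) - H' (z y t) (z y' t - z y t)) (p y' t)‖ ≤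
          C * (L * ‖y' - y‖) ^ 2 * C := by
        refine (ContinuousLinearMap.le_opNorm _ _).trans ?_
        refine mul_le_mul ((hrem _ (hzB y hy t ht) _ (hzB y' hy' t ht)).trans ?_)
          (hp y' hy' t ht) (norm_nonneg _) (by positivity)
        gcongr
      have b2 : ‖H' (z y t) (z y' t - z y t) (p y' t - p y t)‖ ≤
          C * (L * ‖y' - y‖) * (L * ‖y' - y‖) := by
        refine (ContinuousLinearMap.le_opNorm₂ _ _ _).trans ?_
        have := hpL y hy y' hy' t ht
        have := hH' _ (hzB y hy t ht)
        gcongr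
      have b3 : ‖H' (z y t) (r t) (p y t)‖ ≤ C * ‖r t‖ * C := by
        refine (ContinuousLinearMap.le_opNorm₂ _ _ _).trans ?_
        have := hp y hy t ht
        have := hH' _ (hzB y hy t ht)
        gcongr
      rw [e1]
      refine (norm_add₃_le).trans ?_
      linarith
    have hg := norm_le_gronwallBound_of_norm_deriv_right_le (f := r) (f' := r') (δ := 0)
      (K := C ^ 2) (ε := (C ^ 2 + C) * L ^ 2 * ‖y' - y‖ ^ 2) (a := 0) (b := T)
      (fun t ht => (hr t ht).continuousAt.continuousWithinAt)
      (fun t ht => (hr t (Ico_subset_Icc_self ht)).hasDerivWithinAt) hr0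
      (fun t ht => hbound t (Ico_subset_Icc_self ht)) T hTT
    rw [gronwallBound_of_K_ne_0 (by positivity)] at hg
    simp only [r, hzT y hy, hzT y' hy', zero_mul, zero_add, sub_zero] at hg
    refine hg.trans (le_of_eq ?_)
    rw [hA]
    ring
  have hO : (fun y' => z y' T - z y T - H (z y T) (y' - y)) =O[𝓝 y] fun y' => ‖y' - y‖ ^ 2 := by
    refine Asymptotics.IsBigO.of_bound A ?_
    filter_upwards [hU] with y' hy'
    simpa using key y' hy'
  have h0 := hO.hasFDerivAt (𝕜 := ℝ) one_lt_two
  have h1 := (h0.add (((H (z y T)).hasFDerivAt (x := y)).sub_const (H (z y T) y))).add_const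
    (z y T)
  simp only [zero_add] at h1
  refine h1.congr_of_eventuallyEq (Filter.Eventually.of_forall fun y' => ?_)
  simp

/-- Near a point where it is `C²`, a map has a quadratic Taylor remainder. -/
theorem exists_quadratic_remainder_of_contDiffAt {W : Type*} [NormedAddCommGroup W]
    [NormedSpace ℝ W] {H : Z → W} {z₀ : Z} (hH : ContDiffAt ℝ 2 H z₀) :
    ∃ C > 0, ∀ᶠ ρ in 𝓝[>] (0 : ℝ), ∀ z ∈ ball z₀ ρ, HasFDerivAt H (fderiv ℝ H z) z ∧
      ‖fderiv ℝ H z‖ ≤ C ∧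
      ∀ z' ∈ ball z₀ ρ, ‖H z' - H z - fderiv ℝ H z (z' - z)‖ ≤ C * ‖z' - z‖ ^ 2 := by
  have h1 : ContDiffAt ℝ 1 (fderiv ℝ H) z₀ := hH.fderiv_right (by norm_num)
  obtain ⟨K, s, hs, hK⟩ := h1.exists_lipschitzOnWith
  have h2 : ∀ᶠ z in 𝓝 z₀, ‖fderiv ℝ H z‖ < ‖fderiv ℝ H z₀‖ + 1 :=
    h1.continuousAt.norm.eventually_lt continuousAt_const (by simp)
  have h3 : ∀ᶠ z in 𝓝 z₀, DifferentiableAt ℝ H z := by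
    filter_upwards [hH.eventually (by simp)] with z hz using hz.differentiableAt (by simp)
  obtain ⟨ρ₀, hρ₀, hsub⟩ := Metric.eventually_nhds_iff_ball.1 (h2.and (h3.and hs))
  refine ⟨K + ‖fderiv ℝ H z₀‖ + 1, by positivity, ?_⟩
  filter_upwards [Ioc_mem_nhdsGT hρ₀] with ρ hρ z hz
  have hb := ball_subset_ball (x := z₀) hρ.2
  refine ⟨(hsub z (hb hz)).2.1.hasFDerivAt, (hsub z (hb hz)).1.le.trans ?_, fun z' hz' => ?_⟩
  · linarith [K.2, NNReal.coe_nonneg K]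
  · have hseg : segment ℝ z z' ⊆ ball z₀ ρ := (convex_ball z₀ ρ).segment_subset hz hz'
    have := (convex_segment z z').norm_image_sub_le_of_norm_hasFDerivWithin_le' (f := H)
      (f' := fderiv ℝ H) (φ := fderiv ℝ H z) (C := K * ‖z' - z‖)
      (fun w hw => (hsub w (hb (hseg hw))).2.1.hasFDerivAt.hasFDerivWithinAt)
      (fun w hw => ?_) (left_mem_segment ℝ z z') (right_mem_segment ℝ z z')
    · refine this.trans ?_
      have h0 := norm_nonneg (fderiv ℝ H z₀)
      have h4 := sq_nonneg ‖z' - z‖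
      nlinarith
    · refine (hK.norm_sub_le (hsub w (hb (hseg hw))).2.2 (hsub z (hb hz)).2.2).trans ?_
      gcongr
      obtain ⟨θ, hθ, rfl⟩ := segment_eq_image' ℝ z z' ▸ hw
      rw [add_sub_cancel_left, norm_smul, Real.norm_of_nonneg hθ.1]
      exact mul_le_of_le_one_left (norm_nonneg _) hθ.2

end ODE

/-! ### Calculus in charts -/

section ChartCalculus

open VectorField

variable {V : Type*} [NormedAddCommGroup V] [NormedSpace ℝ V] {H : Type*} [TopologicalSpace H]
  (I : ModelWithCorners ℝ V H)
  {N : Type*} [TopologicalSpace N] [ChartedSpace H N]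

/-- The derivative at `y` of the extended chart at `x`, as a map into the model space. -/
def chartD (x y : N) : TangentSpace I y →L[ℝ] V :=
  mfderiv I 𝓘(ℝ, V) (extChartAt I x) y

/-- The derivative at `z` of the inverse of the extended chart at `x`. -/
def chartDSymm (x : N) (z : V) : V →L[ℝ] TangentSpace I ((extChartAt I x).symm z) :=
  mfderiv 𝓘(ℝ, V) I (extChartAt I x).symm z

/-- The vector field on the domain of the chart at `x` which reads `W` in this chart. -/
def chartLift (x : N) (W : V → V) (y : N) : TangentSpace I y :=
  mpullback I 𝓘(ℝ, V) (extChartAt I x) W y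

variable {I} [IsManifold I ∞ N] {x y : N} {z : V}

theorem contMDiffAt_extChartAt_of_mem (hy : y ∈ (extChartAt I x).source) :
    ContMDiffAt I 𝓘(ℝ, V) ∞ (extChartAt I x) y :=
  contMDiffAt_extChartAt' (by simpa using hy)

theorem contMDiffAt_chartLift [CompleteSpace V] {W : V → V}
    (hy : y ∈ (extChartAt I x).source) (hW : ContDiffAt ℝ ∞ W (extChartAt I x y)) :
    ContMDiffAt I I.tangent ∞
      (fun y => (⟨y, chartLift I x W y⟩ : TangentBundle I N)) y :=
  (contMDiffAt_vectorSpace_iff_contDiffAt.2 hW).mpullback_vectorField_preimage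
    (contMDiffAt_extChartAt_of_mem hy) (isInvertible_mfderiv_extChartAt hy) le_rfl

theorem hasMFDerivAt_extChartAt_of_mem (hy : y ∈ (extChartAt I x).source) :
    HasMFDerivAt I 𝓘(ℝ, V) (extChartAt I x) y (chartD I x y) :=
  ((contMDiffAt_extChartAt_of_mem hy).mdifferentiableAt (by simp)).hasMFDerivAt

theorem chartD_injective (hy : y ∈ (extChartAt I x).source) :
    Function.Injective (chartD I x y) :=
  (isInvertible_mfderiv_extChartAt hy).bijective.1

variable [I.Boundaryless]

theorem contMDiffAt_extChartAt_symm_of_mem (hz : z ∈ (extChartAt I x).target) :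
    ContMDiffAt 𝓘(ℝ, V) I ∞ (extChartAt I x).symm z :=
  (contMDiffOn_extChartAt_symm x).contMDiffAt ((isOpen_extChartAt_target x).mem_nhds hz)

theorem hasMFDerivAt_extChartAt_symm_of_mem (hz : z ∈ (extChartAt I x).target) :
    HasMFDerivAt 𝓘(ℝ, V) I (extChartAt I x).symm z (chartDSymm I x z) :=
  ((contMDiffAt_extChartAt_symm_of_mem hz).mdifferentiableAt (by simp)).hasMFDerivAt

theorem chartD_chartDSymm (hz : z ∈ (extChartAt I x).target) (v : V) :
    chartD I x ((extChartAt I x).symm z) (chartDSymm I x z v) = v := by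
  have h := mfderiv_extChartAt_comp_mfderivWithin_extChartAt_symm (I := I) hz
  rw [I.range_eq_univ, mfderivWithin_univ] at h
  exact DFunLike.congr_fun h v

theorem chartDSymm_chartD (hz : z ∈ (extChartAt I x).target)
    (v : TangentSpace I ((extChartAt I x).symm z)) :
    chartDSymm I x z (chartD I x ((extChartAt I x).symm z) v) = v := by
  have h := mfderivWithin_extChartAt_symm_comp_mfderiv_extChartAt (I := I) hz
  rw [I.range_eq_univ, mfderivWithin_univ] at h
  exact DFunLike.congr_fun h v

theorem isInvertible_mfderiv_extChartAt_symm (hz : z ∈ (extChartAt I x).target) :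
    (mfderiv 𝓘(ℝ, V) I (extChartAt I x).symm z).IsInvertible := by
  have h := isInvertible_mfderivWithin_extChartAt_symm (I := I) hz
  rwa [I.range_eq_univ, mfderivWithin_univ] at h

/-- A smooth vector field on a manifold, read in a chart, is smooth. -/
theorem contDiffAt_chartD [CompleteSpace V] {X : (y : N) → TangentSpace I y}
    (hz : z ∈ (extChartAt I x).target)
    (hX : ContMDiffAt I I.tangent ∞ (fun y => (⟨y, X y⟩ : TangentBundle I N))
      ((extChartAt I x).symm z)) :
    ContDiffAt ℝ ∞ (fun z => chartD I x ((extChartAt I x).symm z) (X ((extChartAt I x).symm z)))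
      z := by
  have h : ContDiffAt ℝ ∞ (mpullback 𝓘(ℝ, V) I (extChartAt I x).symm X : V → V) z :=
    contMDiffAt_vectorSpace_iff_contDiffAt.1 (hX.mpullback_vectorField_preimage
      (contMDiffAt_extChartAt_symm_of_mem hz) (isInvertible_mfderiv_extChartAt_symm hz) le_rfl)
  refine h.congr_of_eventuallyEq ?_
  filter_upwards [(isOpen_extChartAt_target x).mem_nhds hz] with z' hz'
  obtain ⟨e, he⟩ := isInvertible_mfderiv_extChartAt_symm hz'
  have h1 : chartDSymm I x z' (mpullback 𝓘(ℝ, V) I (extChartAt I x).symm X z') =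
      X ((extChartAt I x).symm z') := by
    rw [mpullback_apply]
    unfold chartDSymm
    rw [← he, ContinuousLinearMap.inverse_equiv]
    exact e.apply_symm_apply _
  rw [← h1]
  exact chartD_chartDSymm hz' _

/-- The vector field `chartLift I x W` is the image of `W` under the inverse of the chart. -/
theorem chartLift_symm {W : V → V} (hz : z ∈ (extChartAt I x).target) :
    chartLift I x W ((extChartAt I x).symm z) = chartDSymm I x z (W z) := by
  have hy := (extChartAt I x).map_target hz
  refine chartD_injective hy ?_
  rw [chartD_chartDSymm hz]
  obtain ⟨e, he⟩ := isInvertible_mfderiv_extChartAt (I := I) hy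
  change mfderiv I 𝓘(ℝ, V) (extChartAt I x) ((extChartAt I x).symm z)
    ((mfderiv I 𝓘(ℝ, V) (extChartAt I x) ((extChartAt I x).symm z)).inverse
      (W (extChartAt I x ((extChartAt I x).symm z)))) = W z
  rw [← he, ContinuousLinearMap.inverse_equiv]
  refine (e.apply_symm_apply _).trans ?_
  exact congrArg W ((extChartAt I x).right_inv hz)

/-- Brackets of vector fields may be computed in a chart. -/
theorem mlieBracket_chartLift [CompleteSpace V] {W W' : V → V} (hz : z ∈ (extChartAt I x).target)
    (hW : ContDiffAt ℝ ∞ W z) (hW' : ContDiffAt ℝ ∞ W' z) :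
    mlieBracket I (chartLift I x W) (chartLift I x W') ((extChartAt I x).symm z) =
      chartDSymm I x z (lieBracket ℝ W W' z) := by
  have hmd : ∀ W : V → V, ContDiffAt ℝ ∞ W z → MDifferentiableAt 𝓘(ℝ, V) 𝓘(ℝ, V).tangent
      (fun z => (⟨z, W z⟩ : TangentBundle 𝓘(ℝ, V) V))
      (extChartAt I x ((extChartAt I x).symm z)) := by
    intro W hW
    rw [(extChartAt I x).right_inv hz]
    exact (contMDiffAt_vectorSpace_iff_contDiffAt.2 hW).mdifferentiableAt (by simp)
  have : IsManifold I (minSmoothness ℝ 3) N := by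
    rw [minSmoothness_of_isRCLikeNormedField]
    exact IsManifold.of_le (n := ∞) (WithTop.coe_le_coe.2 (le_top : (3 : ℕ∞) ≤ ⊤))
  have h2 := mpullback_mlieBracket (I := I) (I' := 𝓘(ℝ, V)) (f := extChartAt I x) (n := ∞)
    (hmd W hW) (hmd W' hW') (contMDiffAt_extChartAt_of_mem ((extChartAt I x).map_target hz))
    (by
      rw [minSmoothness_of_isRCLikeNormedField]
      exact WithTop.coe_le_coe.2 (le_top : (2 : ℕ∞) ≤ ⊤))
  have hb : ∀ X Y : (z : V) → TangentSpace 𝓘(ℝ, V) z,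
      mlieBracket 𝓘(ℝ, V) X Y = lieBracket ℝ X Y := by
    intro X Y
    rw [← mlieBracketWithin_univ, mlieBracketWithin_eq_lieBracketWithin]
    exact lieBracketWithin_univ
  exact h2.symm.trans ((congrArg (fun Z : V → V => chartLift I x Z ((extChartAt I x).symm z))
    (hb W W')).trans (chartLift_symm hz))

end ChartCalculus

/-! ### The horizontal lift operator and its curvature -/

section LiftOperator

open VectorField

variable {VM : Type*} [NormedAddCommGroup VM] [NormedSpace ℝ VM]
  {M : Type*} [TopologicalSpace M] [ChartedSpace VM M]
  {VE : Type*} [NormedAddCommGroup VE] [NormedSpace ℝ VE]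
  {E : Type*} [TopologicalSpace E] [ChartedSpace VE E]

variable (VM VE) in
/-- The map `π : E → M` read in the charts at `e` and `π e`. -/
def localProj (π : E → M) (e : E) (z : VE) : VM :=
  extChartAt 𝓘(ℝ, VM) (π e) (π ((extChartAt 𝓘(ℝ, VE) e).symm z))

/-- `H` is the horizontal lift operator of `D`, read in the charts at `e` and `π e`, on an open
neighborhood `O` of `e` in the chart: `H z u` is the horizontal vector at `z` which projects
to `u`. -/
structure IsLiftOperator (π : E → M) (D : (x : E) → Submodule ℝ (TangentSpace 𝓘(ℝ, VE) x)) (e : E)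
    (O : Set VE) (H : VE → VM →L[ℝ] VE) : Prop where
  isOpen : IsOpen O
  mem : extChartAt 𝓘(ℝ, VE) e e ∈ O
  subset_target : O ⊆ (extChartAt 𝓘(ℝ, VE) e).target
  mem_source : ∀ z ∈ O,
    π ((extChartAt 𝓘(ℝ, VE) e).symm z) ∈ (extChartAt 𝓘(ℝ, VM) (π e)).source
  contDiffAt : ∀ z ∈ O, ContDiffAt ℝ ∞ H z
  horizontal : ∀ z ∈ O, ∀ u : VM,
    chartDSymm 𝓘(ℝ, VE) e z (H z u) ∈ D ((extChartAt 𝓘(ℝ, VE) e).symm z)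
  fderiv_lift : ∀ z ∈ O, ∀ u : VM, fderiv ℝ (localProj VM VE π e) z (H z u) = u

variable [IsManifold 𝓘(ℝ, VM) ∞ M] [IsManifold 𝓘(ℝ, VE) ∞ E]
  {π : E → M} {D : (x : E) → Submodule ℝ (TangentSpace 𝓘(ℝ, VE) x)} {e : E}

theorem contDiffAt_localProj (hπ : ContMDiff 𝓘(ℝ, VE) 𝓘(ℝ, VM) ∞ π) {z : VE}
    (hz : z ∈ (extChartAt 𝓘(ℝ, VE) e).target)
    (hzs : π ((extChartAt 𝓘(ℝ, VE) e).symm z) ∈ (extChartAt 𝓘(ℝ, VM) (π e)).source) :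
    ContDiffAt ℝ ∞ (localProj VM VE π e) z := by
  rw [← contMDiffAt_iff_contDiffAt]
  exact (contMDiffAt_extChartAt_of_mem hzs).comp z
    ((hπ _).comp z (contMDiffAt_extChartAt_symm_of_mem hz))

theorem fderiv_localProj_apply (hπ : ContMDiff 𝓘(ℝ, VE) 𝓘(ℝ, VM) ∞ π) {z : VE}
    (hz : z ∈ (extChartAt 𝓘(ℝ, VE) e).target)
    (hzs : π ((extChartAt 𝓘(ℝ, VE) e).symm z) ∈ (extChartAt 𝓘(ℝ, VM) (π e)).source) (v : VE) :
    fderiv ℝ (localProj VM VE π e) z v =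
      chartD 𝓘(ℝ, VM) (π e) (π ((extChartAt 𝓘(ℝ, VE) e).symm z))
        (mfderiv 𝓘(ℝ, VE) 𝓘(ℝ, VM) π ((extChartAt 𝓘(ℝ, VE) e).symm z)
          (chartDSymm 𝓘(ℝ, VE) e z v)) := by
  have h2 : MDifferentiableAt 𝓘(ℝ, VE) 𝓘(ℝ, VM) π ((extChartAt 𝓘(ℝ, VE) e).symm z) :=
    (hπ _).mdifferentiableAt (by simp)
  let L : VE →L[ℝ] VM := (chartD 𝓘(ℝ, VM) (π e) (π ((extChartAt 𝓘(ℝ, VE) e).symm z))).comp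
    ((mfderiv 𝓘(ℝ, VE) 𝓘(ℝ, VM) π ((extChartAt 𝓘(ℝ, VE) e).symm z)).comp
      (chartDSymm 𝓘(ℝ, VE) e z))
  have h3 : HasMFDerivAt 𝓘(ℝ, VE) 𝓘(ℝ, VM) (localProj VM VE π e) z L :=
    (hasMFDerivAt_extChartAt_of_mem hzs).comp z
      (h2.hasMFDerivAt.comp z (hasMFDerivAt_extChartAt_symm_of_mem hz))
  have h4 : HasFDerivAt (localProj VM VE π e) L z := h3.hasFDerivAt
  rw [h4.fderiv]
  rfl

namespace IsLiftOperator

variable {O : Set VE} {H : VE → VM →L[ℝ] VE} {z : VE}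

theorem contDiffAt_proj (h : IsLiftOperator π D e O H) (hπ : ContMDiff 𝓘(ℝ, VE) 𝓘(ℝ, VM) ∞ π)
    (hz : z ∈ O) : ContDiffAt ℝ ∞ (localProj VM VE π e) z :=
  contDiffAt_localProj hπ (h.subset_target hz) (h.mem_source z hz)

/-- A horizontal vector is the lift of its projection. -/
theorem eq_lift (h : IsLiftOperator π D e O H) (hπ : ContMDiff 𝓘(ℝ, VE) 𝓘(ℝ, VM) ∞ π)
    (hDhor : IsHorizontalDistribution VM π D) (hz : z ∈ O) {w : VE}
    (hw : chartDSymm 𝓘(ℝ, VE) e z w ∈ D ((extChartAt 𝓘(ℝ, VE) e).symm z)) :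
    H z (fderiv ℝ (localProj VM VE π e) z w) = w := by
  have hzt := h.subset_target hz
  set w' : VE := H z (fderiv ℝ (localProj VM VE π e) z w) with hw'
  have h1 : chartDSymm 𝓘(ℝ, VE) e z (w' - w) ∈ D ((extChartAt 𝓘(ℝ, VE) e).symm z) := by
    rw [map_sub]
    exact (D _).sub_mem (h.horizontal z hz _) hw
  have h2 : fderiv ℝ (localProj VM VE π e) z (w' - w) = 0 := by
    rw [map_sub, hw', h.fderiv_lift z hz, sub_self]
  rw [fderiv_localProj_apply hπ hzt (h.mem_source z hz)] at h2
  have h3 := (injective_iff_map_eq_zero _).1 (chartD_injective (h.mem_source z hz)) _ h2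
  have h4 : chartDSymm 𝓘(ℝ, VE) e z (w' - w) = 0 :=
    (Submodule.disjoint_def.1 (hDhor _).disjoint) _ h3 h1
  have h5 := chartD_chartDSymm hzt (w' - w)
  rw [h4, map_zero] at h5
  exact sub_eq_zero.1 h5.symm

end IsLiftOperator

variable [FiniteDimensional ℝ VE]

/-- The horizontal lift operator of a smooth horizontal distribution exists near every point. In a
local frame `X` of `D` it is `X ∘ (dπ ∘ X)⁻¹`. -/
theorem exists_isLiftOperator [CompleteSpace VM] (hπ : ContMDiff 𝓘(ℝ, VE) 𝓘(ℝ, VM) ∞ π)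
    (hsubm : ∀ x : E, Function.Surjective (mfderiv 𝓘(ℝ, VE) 𝓘(ℝ, VM) π x))
    (hD : IsSmoothDistribution D) (hDhor : IsHorizontalDistribution VM π D) (e : E) :
    ∃ (O : Set VE) (H : VE → VM →L[ℝ] VE), IsLiftOperator π D e O H := by
  have : CompleteSpace VE := FiniteDimensional.complete ℝ VE
  obtain ⟨U, k, X, hU, heU, hX, hspan⟩ := hD e
  set φ := extChartAt 𝓘(ℝ, VE) e with hφ
  set ψ := extChartAt 𝓘(ℝ, VM) (π e) with hψ
  let O : Set VE := φ.target ∩ φ.symm ⁻¹' (U ∩ π ⁻¹' ψ.source)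
  have hO : IsOpen O := (continuousOn_extChartAt_symm e).isOpen_inter_preimage
    (isOpen_extChartAt_target e)
    (hU.inter ((isOpen_extChartAt_source (π e)).preimage hπ.continuous))
  let Y : Fin k → VE → VE := fun i z => chartD 𝓘(ℝ, VE) e (φ.symm z) (X i (φ.symm z))
  have hY : ∀ i, ∀ z ∈ O, ContDiffAt ℝ ∞ (Y i) z := fun i z hz =>
    contDiffAt_chartD hz.1 ((hX i).contMDiffAt hU hz.2.1)
  have hYX : ∀ i, ∀ z ∈ O, chartDSymm 𝓘(ℝ, VE) e z (Y i z) = X i (φ.symm z) :=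
    fun i z hz => chartDSymm_chartD hz.1 _
  let A : VE → (Fin k → ℝ) →L[ℝ] VE := fun z =>
    ∑ i, (ContinuousLinearMap.proj (R := ℝ) (φ := fun _ : Fin k => ℝ) i).smulRight (Y i z)
  have hA : ∀ z c, A z c = ∑ i, c i • Y i z := by
    intro z c; simp [A]
  have hAs : ∀ z ∈ O, ContDiffAt ℝ ∞ A z := by
    intro z hz
    refine ContDiffAt.sum fun i _ => ?_
    exact ((ContinuousLinearMap.smulRightL ℝ (Fin k → ℝ) VE
      (ContinuousLinearMap.proj (R := ℝ) (φ := fun _ : Fin k => ℝ) i)).contDiff.contDiffAt).comp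
        z (hY i z hz)
  have hAX : ∀ z ∈ O, ∀ c, chartDSymm 𝓘(ℝ, VE) e z (A z c) = ∑ i, c i • X i (φ.symm z) := by
    intro z hz c
    rw [hA, map_sum]
    refine Finset.sum_congr rfl fun i _ => ?_
    rw [map_smul, hYX i z hz]
  have hAD : ∀ z ∈ O, ∀ c, chartDSymm 𝓘(ℝ, VE) e z (A z c) ∈ D (φ.symm z) := by
    intro z hz c
    rw [hAX z hz, (hspan _ hz.2.1).2]
    exact Submodule.sum_mem _ fun i _ => Submodule.smul_mem _ _ (Submodule.subset_span ⟨i, rfl⟩)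
  let B : VE → (Fin k → ℝ) →L[ℝ] VM := fun z => (fderiv ℝ (localProj VM VE π e) z).comp (A z)
  have hP : ∀ z ∈ O, ContDiffAt ℝ ∞ (localProj VM VE π e) z := fun z hz =>
    contDiffAt_localProj hπ hz.1 hz.2.2
  have hBs : ∀ z ∈ O, ContDiffAt ℝ ∞ B z := fun z hz =>
    ((hP z hz).fderiv_right (m := ∞) le_rfl).clm_comp (hAs z hz)
  have hBapply : ∀ z ∈ O, ∀ c, B z c = chartD 𝓘(ℝ, VM) (π e) (π (φ.symm z))
      (mfderiv 𝓘(ℝ, VE) 𝓘(ℝ, VM) π (φ.symm z) (∑ i, c i • X i (φ.symm z))) := by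
    intro z hz c
    rw [← hAX z hz]
    exact fderiv_localProj_apply hπ hz.1 hz.2.2 _
  have hBinj : ∀ z ∈ O, Function.Injective (B z) := by
    intro z hz
    refine (injective_iff_map_eq_zero (B z)).2 fun c hc => ?_
    rw [hBapply z hz] at hc
    have h1 := (injective_iff_map_eq_zero _).1 (chartD_injective hz.2.2) _ hc
    have h2 := (Submodule.disjoint_def.1 (hDhor (φ.symm z)).disjoint) _ h1
      (by rw [← hAX z hz]; exact hAD z hz c)
    exact funext (Fintype.linearIndependent_iff.1 (hspan _ hz.2.1).1 c h2)
  have hBsurj : ∀ z ∈ O, Function.Surjective (B z) := by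
    intro z hz u
    obtain ⟨u, rfl⟩ := (isInvertible_mfderiv_extChartAt hz.2.2).bijective.2 u
    obtain ⟨v, hv⟩ := hsubm (φ.symm z) u
    obtain ⟨v₁, hv₁, v₂, hv₂, rfl⟩ := Submodule.mem_sup.1
      ((hDhor (φ.symm z)).sup_eq_top ▸ Submodule.mem_top (x := v))
    rw [(hspan _ hz.2.1).2] at hv₂
    obtain ⟨c, rfl⟩ := (Submodule.mem_span_range_iff_exists_fun ℝ).1 hv₂
    refine ⟨c, ?_⟩
    rw [map_add, show mfderiv 𝓘(ℝ, VE) 𝓘(ℝ, VM) π (φ.symm z) v₁ = 0 from hv₁, zero_add] at hv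
    rw [hBapply z hz, hv]
    rfl
  have hinv : ∀ z ∈ O, ∃ b : (Fin k → ℝ) ≃L[ℝ] VM, (b : (Fin k → ℝ) →L[ℝ] VM) = B z :=
    fun z hz => ⟨ContinuousLinearEquiv.ofBijective (B z)
      (LinearMap.ker_eq_bot.2 (hBinj z hz)) (LinearMap.range_eq_top.2 (hBsurj z hz)),
      ContinuousLinearEquiv.coe_ofBijective _ _ _⟩
  refine ⟨O, fun z => (A z).comp (B z).inverse, hO, ⟨mem_extChartAt_target e, ?_⟩, fun z hz => hz.1,
    fun z hz => hz.2.2, fun z hz => ?_, fun z hz u => hAD z hz _, fun z hz u => ?_⟩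
  · rw [mem_preimage, hφ, extChartAt_to_inv]
    exact ⟨heU, mem_extChartAt_source (π e)⟩
  · obtain ⟨b, hb⟩ := hinv z hz
    have h1 := contDiffAt_map_inverse (n := ∞) b
    rw [hb] at h1
    exact (hAs z hz).clm_comp (h1.comp z (hBs z hz))
  · obtain ⟨b, hb⟩ := hinv z hz
    change B z ((B z).inverse u) = u
    rw [← hb, ContinuousLinearMap.inverse_equiv]
    exact b.apply_symm_apply u

/-- Where the Levi form vanishes, the bracket of the lifts of two constant vector fields is
horizontal. Being vertical as well, it vanishes. -/
theorem IsLiftOperator.curvature_eq {O : Set VE} {H : VE → VM →L[ℝ] VE} {z : VE}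
    (h : IsLiftOperator π D e O H) (hπ : ContMDiff 𝓘(ℝ, VE) 𝓘(ℝ, VM) ∞ π)
    (hD : IsSmoothDistribution D)
    (hDhor : IsHorizontalDistribution VM π D) (hz : z ∈ O)
    (hlevi : ∀ v w, leviForm D ((extChartAt 𝓘(ℝ, VE) e).symm z) v w = 0) (u w : VM) :
    fderiv ℝ H z (H z u) w = fderiv ℝ H z (H z w) u := by
  have : CompleteSpace VE := FiniteDimensional.complete ℝ VE
  have hzt := h.subset_target hz
  have hHu : ∀ u, ∀ z ∈ O, ContDiffAt ℝ ∞ (fun z => H z u) z := fun u z hz =>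
    (h.contDiffAt z hz).clm_apply contDiffAt_const
  set φ := extChartAt 𝓘(ℝ, VE) e with hφ
  let X : VM → (y : E) → TangentSpace 𝓘(ℝ, VE) y := fun u =>
    chartLift 𝓘(ℝ, VE) e (fun z => H z u)
  have hopen : IsOpen (φ.source ∩ φ ⁻¹' O) :=
    (continuousOn_extChartAt e).isOpen_inter_preimage (isOpen_extChartAt_source e) h.isOpen
  have hmem : φ.symm z ∈ φ.source ∩ φ ⁻¹' O := by
    refine ⟨φ.map_target hzt, ?_⟩
    rwa [mem_preimage, φ.right_inv hzt]
  have hXD : ∀ u, ∀ z ∈ O, X u (φ.symm z) ∈ D (φ.symm z) := by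
    intro u z hz
    have := h.horizontal z hz u
    rwa [← chartLift_symm (W := fun z => H z u) (h.subset_target hz)] at this
  have hX : ∀ u, IsHorizontalFieldNear D (X u) (φ.symm z) := by
    refine fun u => ⟨φ.source ∩ φ ⁻¹' O, hopen, hmem, fun y hy => ?_, fun y hy => ?_⟩
    · exact (contMDiffAt_chartLift hy.1 (hHu u _ hy.2)).contMDiffWithinAt
    · have := hXD u _ hy.2
      rwa [φ.left_inv hy.1] at this
  have h1 := leviForm_eq hD (hX u) (hX w) ⟨_, hXD u z hz⟩ ⟨_, hXD w z hz⟩ rfl rfl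
  rw [hlevi, eq_comm, Submodule.Quotient.mk_eq_zero,
    mlieBracket_chartLift hzt (hHu u z hz) (hHu w z hz)] at h1
  have h2 := h.eq_lift hπ hDhor hz h1
  have hHd : DifferentiableAt ℝ H z := (h.contDiffAt z hz).differentiableAt (by simp)
  have hHfd : ∀ u v, fderiv ℝ (fun z => H z u) z v = fderiv ℝ H z v u := by
    intro u v
    rw [fderiv_clm_apply hHd (differentiableAt_const u)]
    simp
  -- differentiating `dP ∘ H = id` shows that the bracket is vertical
  have hP := h.contDiffAt_proj hπ hz
  have hPd : DifferentiableAt ℝ (fderiv ℝ (localProj VM VE π e)) z :=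
    (hP.fderiv_right (m := ∞) le_rfl).differentiableAt (by simp)
  have hvert : ∀ u v, fderiv ℝ (localProj VM VE π e) z (fderiv ℝ H z v u) =
      - fderiv ℝ (fderiv ℝ (localProj VM VE π e)) z v (H z u) := by
    intro u v
    have hd := (hPd.hasFDerivAt.clm_apply
      ((hHu u z hz).differentiableAt (by simp)).hasFDerivAt).fderiv
    have hconst : (fun z => fderiv ℝ (localProj VM VE π e) z (H z u)) =ᶠ[𝓝 z] fun _ => u := by
      filter_upwards [h.isOpen.mem_nhds hz] with z' hz' using h.fderiv_lift z' hz' u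
    rw [hconst.fderiv_eq] at hd
    have h3 := DFunLike.congr_fun hd v
    simp only [fderiv_fun_const, Pi.zero_apply, zero_apply, add_apply,
      ContinuousLinearMap.comp_apply, ContinuousLinearMap.flip_apply, hHfd] at h3
    exact eq_neg_of_add_eq_zero_left h3.symm
  have hsymm : IsSymmSndFDerivAt ℝ (localProj VM VE π e) z :=
    hP.isSymmSndFDerivAt (by
      rw [minSmoothness_of_isRCLikeNormedField]
      exact WithTop.coe_le_coe.2 (le_top : (2 : ℕ∞) ≤ ⊤))
  have h3 : fderiv ℝ (localProj VM VE π e) z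
      (lieBracket ℝ (fun z => H z u) (fun z => H z w) z) = 0 := by
    rw [lieBracket, map_sub, hHfd, hHfd, hvert, hvert, hsymm (H z u) (H z w), sub_self]
  rw [h3, map_zero, lieBracket, hHfd, hHfd] at h2
  exact (sub_eq_zero.1 h2.symm).symm ▸ rfl

end LiftOperator

/-! ### Velocities of curves and solutions of sprays -/

section Velocity

variable {V : Type*} [NormedAddCommGroup V] [NormedSpace ℝ V] {H : Type*} [TopologicalSpace H]
  {I : ModelWithCorners ℝ V H} {N : Type*} [TopologicalSpace N] [ChartedSpace H N]
  {V' : Type*} [NormedAddCommGroup V'] [NormedSpace ℝ V'] {H' : Type*} [TopologicalSpace H']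
  {I' : ModelWithCorners ℝ V' H'} {N' : Type*} [TopologicalSpace N'] [ChartedSpace H' N']

variable (I) in
/-- The curve `σ`, restricted to the set `s` of times, has velocity `v` at time `t`. -/
def HasVelocityWithinAt (σ : ℝ → N) (s : Set ℝ) (t : ℝ) (v : TangentSpace I (σ t)) : Prop :=
  HasMFDerivWithinAt 𝓘(ℝ, ℝ) I σ s t ((1 : ℝ →L[ℝ] ℝ).smulRight v)

namespace HasVelocityWithinAt

variable {σ τ : ℝ → N} {s s' : Set ℝ} {t : ℝ} {v : TangentSpace I (σ t)}

theorem continuousWithinAt (h : HasVelocityWithinAt I σ s t v) : ContinuousWithinAt σ s t :=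
  HasMFDerivWithinAt.continuousWithinAt h

theorem mdifferentiableWithinAt (h : HasVelocityWithinAt I σ s t v) :
    MDifferentiableWithinAt 𝓘(ℝ, ℝ) I σ s t :=
  HasMFDerivWithinAt.mdifferentiableWithinAt h

theorem mono (h : HasVelocityWithinAt I σ s t v) (hs : s' ⊆ s) :
    HasVelocityWithinAt I σ s' t v :=
  HasMFDerivWithinAt.mono h hs

/-- The velocities belong to the distinct types `TangentSpace I (σ t)` and `TangentSpace I (τ t)`,
so they are compared in the model space. -/
theorem congr' (h : HasVelocityWithinAt I σ s t v) {v' : TangentSpace I (τ t)}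
    (hτ : ∀ t ∈ s, τ t = σ t) (ht : t ∈ s) (hv : (v : V) = v') :
    HasVelocityWithinAt I τ s t v' := by
  subst hv
  have h0 : HasMFDerivWithinAt 𝓘(ℝ, ℝ) I σ s t ((1 : ℝ →L[ℝ] ℝ).smulRight v) := h
  exact h0.congr_mono hτ (hτ t ht) Subset.rfl

theorem congr_velocity (h : HasVelocityWithinAt I σ s t v) {v' : TangentSpace I (σ t)}
    (hv : v' = v) : HasVelocityWithinAt I σ s t v' :=
  hv ▸ h

theorem map {f : N → N'} (h : HasVelocityWithinAt I σ s t v)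
    (hf : MDifferentiableAt I I' f (σ t)) :
    HasVelocityWithinAt I' (fun t => f (σ t)) s t (mfderiv I I' f (σ t) v) := by
  have h1 := hf.hasMFDerivAt.comp_hasMFDerivWithinAt t h
  have h2 : (mfderiv I I' f (σ t)).comp ((1 : ℝ →L[ℝ] ℝ).smulRight v) =
      (1 : ℝ →L[ℝ] ℝ).smulRight (mfderiv I I' f (σ t) v) :=
    ContinuousLinearMap.ext_ring ((congrArg (mfderiv I I' f (σ t)) (one_smul ℝ v)).trans
      (one_smul ℝ (mfderiv I I' f (σ t) v)).symm)
  rw [HasVelocityWithinAt, ← h2]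
  exact h1

theorem comp_affine {c d : ℝ} (h : HasVelocityWithinAt I σ s (c * t + d) v)
    (hs : MapsTo (fun t => c * t + d) s' s) :
    HasVelocityWithinAt I (fun t => σ (c * t + d)) s' t (c • v) := by
  have h1 : HasDerivWithinAt (fun t : ℝ => c * t + d) c s' t := by
    simpa using (((hasDerivAt_id t).const_mul c).add_const d).hasDerivWithinAt
  have h0 : HasMFDerivWithinAt 𝓘(ℝ, ℝ) I σ s ((fun t => c * t + d) t)
      ((1 : ℝ →L[ℝ] ℝ).smulRight v) := h
  have h2 := h0.comp t h1.hasFDerivWithinAt.hasMFDerivWithinAt hs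
  refine h2.congr_mfderiv ?_
  refine ContinuousLinearMap.ext_ring ?_
  change ((1 : ℝ) • c) • v = (1 : ℝ) • c • v
  simp

theorem unique {v' : TangentSpace I (σ t)} (h : HasVelocityWithinAt I σ s t v)
    (h' : HasVelocityWithinAt I σ s t v') (hs : UniqueDiffWithinAt ℝ s t) : v = v' := by
  have h1 := UniqueMDiffWithinAt.eq hs.uniqueMDiffWithinAt h h'
  have h2 := congrArg (fun L : ℝ →L[ℝ] V => L 1) h1
  exact (one_smul ℝ v).symm.trans (h2.trans (one_smul ℝ v'))

theorem hasDerivWithinAt_of_vectorSpace {c : ℝ → V} {v : V}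
    (h : HasVelocityWithinAt 𝓘(ℝ, V) c s t v) : HasDerivWithinAt c v s t :=
  HasMFDerivWithinAt.hasFDerivWithinAt h

end HasVelocityWithinAt

theorem HasDerivWithinAt.hasVelocityWithinAt {c : ℝ → V} {v : V} {s : Set ℝ} {t : ℝ}
    (h : HasDerivWithinAt c v s t) : HasVelocityWithinAt 𝓘(ℝ, V) c s t v :=
  h.hasFDerivWithinAt.hasMFDerivWithinAt

theorem MDifferentiableWithinAt.hasVelocityWithinAt {σ : ℝ → N} {s : Set ℝ} {t : ℝ}
    (h : MDifferentiableWithinAt 𝓘(ℝ, ℝ) I σ s t) :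
    HasVelocityWithinAt I σ s t (mfderivWithin 𝓘(ℝ, ℝ) I σ s t (1 : ℝ)) := by
  refine h.hasMFDerivWithinAt.congr_mfderiv ?_
  exact ContinuousLinearMap.ext_ring (one_smul ℝ _).symm

variable [IsManifold I ∞ N] {x : N}

theorem HasVelocityWithinAt.chart {σ : ℝ → N} {s : Set ℝ} {t : ℝ} {v : TangentSpace I (σ t)}
    (h : HasVelocityWithinAt I σ s t v) (hσ : σ t ∈ (extChartAt I x).source) :
    HasDerivWithinAt (fun t => extChartAt I x (σ t)) (chartD I x (σ t) v) s t :=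
  (h.map (hasMFDerivAt_extChartAt_of_mem hσ).mdifferentiableAt).hasDerivWithinAt_of_vectorSpace

theorem HasDerivWithinAt.chart_symm [I.Boundaryless] {c : ℝ → V} {v : V} {s : Set ℝ} {t : ℝ}
    (h : HasDerivWithinAt c v s t) (hc : c t ∈ (extChartAt I x).target) :
    HasVelocityWithinAt I (fun t => (extChartAt I x).symm (c t)) s t (chartDSymm I x (c t) v) :=
  h.hasVelocityWithinAt.map (hasMFDerivAt_extChartAt_symm_of_mem hc).mdifferentiableAt

end Velocity

section SpraySolutions

variable {V : Type*} [NormedAddCommGroup V] [NormedSpace ℝ V]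
  {M : Type*} [TopologicalSpace M] [ChartedSpace V M]

theorem HasVelocityWithinAt.curveDeriv_eq {γ : ℝ → M} {a b t : ℝ} (hab : a < b)
    (ht : t ∈ Icc a b) {v : TangentSpace 𝓘(ℝ, V) (γ t)}
    (h : HasVelocityWithinAt 𝓘(ℝ, V) γ (Icc a b) t v) : curveDeriv γ a b t = v :=
  h.mdifferentiableWithinAt.hasVelocityWithinAt.unique h (uniqueDiffOn_Icc hab t ht)

variable [IsManifold 𝓘(ℝ, V) ∞ M]
  {S : (v : TangentBundle 𝓘(ℝ, V) M) → TangentSpace 𝓘(ℝ, V).tangent v}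

theorem mdifferentiableAt_tangentScale (c : ℝ) (v : TangentBundle 𝓘(ℝ, V) M) :
    MDifferentiableAt 𝓘(ℝ, V).tangent 𝓘(ℝ, V).tangent
      (tangentScale c : TangentBundle 𝓘(ℝ, V) M → TangentBundle 𝓘(ℝ, V) M) v := by
  have h := (mdifferentiableAt_totalSpace 𝓘(ℝ, V) _).1
    (mdifferentiableAt_id (I := 𝓘(ℝ, V).tangent) (x := v))
  refine (mdifferentiableAt_totalSpace 𝓘(ℝ, V) _).2 ⟨h.1, ?_⟩
  refine (h.2.const_smul c).congr_of_eventuallyEq (Filter.Eventually.of_forall fun u => ?_)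
  exact map_smul (fderivWithin ℝ ((chartAt V v.1).extend 𝓘(ℝ, V) ∘
    ((chartAt V u.1).extend 𝓘(ℝ, V)).symm) (range 𝓘(ℝ, V))
      ((chartAt V u.1).extend 𝓘(ℝ, V) u.1)) c u.2

namespace IsSpray

/-- The solutions of a spray are the projections of its integral curves. -/
theorem isSpraySolution_iff (hS : IsSpray S) {γ : ℝ → M} {a b : ℝ} (hab : a < b) :
    IsSpraySolution S γ a b ↔ ∃ w : ℝ → TangentBundle 𝓘(ℝ, V) M,
      (∀ t ∈ Icc a b, HasVelocityWithinAt 𝓘(ℝ, V).tangent w (Icc a b) t (S (w t))) ∧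
        ∀ t ∈ Icc a b, γ t = (w t).proj := by
  refine ⟨fun h => ⟨curveVelocity γ a b, h.2, fun t ht => rfl⟩, ?_⟩
  rintro ⟨w, hw, hγ⟩
  have h1 : ∀ t ∈ Icc a b, HasVelocityWithinAt 𝓘(ℝ, V) γ (Icc a b) t (w t).2 := by
    intro t ht
    have h2 := (hw t ht).map (f := fun u : TangentBundle 𝓘(ℝ, V) M => u.proj)
      (Bundle.mdifferentiableAt_proj (TangentSpace 𝓘(ℝ, V) : M → Type _))
    exact h2.congr' hγ ht (hS.proj (w t))
  have h2 : ∀ t ∈ Icc a b, curveVelocity γ a b t = w t := by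
    intro t ht
    have h3 := (h1 t ht).curveDeriv_eq hab ht
    have h4 : curveVelocity γ a b t = ⟨γ t, (w t).2⟩ :=
      congrArg (fun u : V => (⟨γ t, u⟩ : TangentBundle 𝓘(ℝ, V) M)) h3
    rw [h4]
    have h5 : ∀ y, y = (w t).proj → (⟨y, (w t).2⟩ : TangentBundle 𝓘(ℝ, V) M) = w t := by
      rintro y rfl
      rfl
    exact h5 _ (hγ t ht)
  refine ⟨fun t ht => (h1 t ht).mdifferentiableWithinAt, fun t ht => ?_⟩
  have h3 : (S (w t) : V × V) = S (curveVelocity γ a b t) := by rw [h2 t ht]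
  exact (hw t ht).congr' h2 ht h3

theorem mono (hS : IsSpray S) {γ : ℝ → M} {a b c d : ℝ} (h : IsSpraySolution S γ a b)
    (hac : a ≤ c) (hcd : c < d) (hdb : d ≤ b) : IsSpraySolution S γ c d := by
  obtain ⟨w, hw, hγ⟩ := (hS.isSpraySolution_iff (hac.trans_lt (hcd.trans_le hdb))).1 h
  have hsub := Icc_subset_Icc hac hdb
  exact (hS.isSpraySolution_iff hcd).2
    ⟨w, fun t ht => (hw t (hsub ht)).mono hsub, fun t ht => hγ t (hsub ht)⟩

theorem congr (hS : IsSpray S) {γ γ' : ℝ → M} {a b : ℝ} (hab : a < b)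
    (h : IsSpraySolution S γ a b) (hγ : ∀ t ∈ Icc a b, γ' t = γ t) : IsSpraySolution S γ' a b := by
  obtain ⟨w, hw, hγ'⟩ := (hS.isSpraySolution_iff hab).1 h
  exact (hS.isSpraySolution_iff hab).2
    ⟨w, hw, fun t ht => (hγ t ht).trans (hγ' t ht)⟩

/-- Solutions of a spray are stable under affine changes of time, by homogeneity. -/
theorem comp_affine (hS : IsSpray S) {γ : ℝ → M} {a b a' b' c d : ℝ} (hab : a < b) (hab' : a' < b')
    (h : IsSpraySolution S γ a b) (hmaps : MapsTo (fun t => c * t + d) (Icc a' b') (Icc a b)) :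
    IsSpraySolution S (fun t => γ (c * t + d)) a' b' := by
  obtain ⟨w, hw, hγ⟩ := (hS.isSpraySolution_iff hab).1 h
  refine (hS.isSpraySolution_iff hab').2
    ⟨fun t => tangentScale c (w (c * t + d)), fun t ht => ?_, fun t ht => hγ _ (hmaps ht)⟩
  have h1 := ((hw _ (hmaps ht)).comp_affine hmaps).map (mdifferentiableAt_tangentScale c _)
  exact h1.congr_velocity ((hS.scale c _).symm.trans
    (map_smul (mfderiv 𝓘(ℝ, V).tangent 𝓘(ℝ, V).tangent (tangentScale c) (w (c * t + d))) c
      (S (w (c * t + d)))).symm)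

/-- Sprays vanish on the zero section: take the factor `0` in the homogeneity. -/
theorem zero (hS : IsSpray S) (x : M) : S ⟨x, 0⟩ = 0 := by
  have h : ∀ w : TangentBundle 𝓘(ℝ, V) M, w = tangentScale 0 ⟨x, 0⟩ → S w = 0 := by
    rintro w rfl
    rw [← hS.scale, zero_smul]
  refine h _ ?_
  unfold tangentScale
  rw [smul_zero]

theorem const (hS : IsSpray S) (x : M) {a b : ℝ} (hab : a < b) :
    IsSpraySolution S (fun _ => x) a b := by
  refine (hS.isSpraySolution_iff hab).2 ⟨fun _ => ⟨x, 0⟩, fun t _ => ?_, fun _ _ => rfl⟩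
  refine (hasMFDerivWithinAt_const _ _ _).congr_mfderiv ?_
  refine ContinuousLinearMap.ext_ring ?_
  exact ((congrArg (fun u : V × V => (1 : ℝ) • u) (hS.zero x)).trans (smul_zero (1 : ℝ))).symm

end IsSpray

end SpraySolutions

/-! ### Sprays in charts -/

section SprayChart

variable {V : Type*} [NormedAddCommGroup V] [NormedSpace ℝ V]
  {M : Type*} [TopologicalSpace M] [ChartedSpace V M] [IsManifold 𝓘(ℝ, V) ∞ M]
  {S : (v : TangentBundle 𝓘(ℝ, V) M) → TangentSpace 𝓘(ℝ, V).tangent v} {x : M}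

variable (V) in
/-- The chart of `TM` over the chart of `M` at `x`. -/
def tangentChart (x : M) : PartialEquiv (TangentBundle 𝓘(ℝ, V) M) (V × V) :=
  extChartAt 𝓘(ℝ, V).tangent (⟨x, 0⟩ : TangentBundle 𝓘(ℝ, V) M)

theorem mem_tangentChart_source {w : TangentBundle 𝓘(ℝ, V) M} :
    w ∈ (tangentChart V x).source ↔ w.proj ∈ (extChartAt 𝓘(ℝ, V) x).source := by
  simp [tangentChart]

theorem mem_tangentChart_target {c : V × V} :
    c ∈ (tangentChart V x).target ↔ c.1 ∈ (extChartAt 𝓘(ℝ, V) x).target := by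
  rw [tangentChart, extChartAt_target, extChartAt_target]
  simp only [ModelWithCorners.range_eq_univ, inter_univ, mem_preimage]
  exact TangentBundle.mem_chart_target_iff (I := 𝓘(ℝ, V)) _ _

theorem tangentChart_apply {w : TangentBundle 𝓘(ℝ, V) M}
    (hw : w.proj ∈ (extChartAt 𝓘(ℝ, V) x).source) :
    tangentChart V x w = (extChartAt 𝓘(ℝ, V) x w.proj, chartD 𝓘(ℝ, V) x w.proj w.2) := by
  have h := (hasMFDerivAt_extChartAt_of_mem hw).mdifferentiableAt
  unfold chartD
  rw [h.mfderiv]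
  rfl

/-- The spray `S`, read in the chart of `TM` over the chart of `M` at `x`. -/
def sprayLocal (S : (v : TangentBundle 𝓘(ℝ, V) M) → TangentSpace 𝓘(ℝ, V).tangent v) (x : M)
    (c : V × V) : V × V :=
  chartD 𝓘(ℝ, V).tangent (⟨x, 0⟩ : TangentBundle 𝓘(ℝ, V) M) ((tangentChart V x).symm c)
    (S ((tangentChart V x).symm c))

theorem contDiffAt_sprayLocal [CompleteSpace V] (hS : IsSpray S) {c : V × V}
    (hc : c.1 ∈ (extChartAt 𝓘(ℝ, V) x).target) : ContDiffAt ℝ ∞ (sprayLocal S x) c :=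
  contDiffAt_chartD (I := 𝓘(ℝ, V).tangent) (mem_tangentChart_target.2 hc) (hS.smooth _)

/-- In a chart, the integral curves of a spray are the solutions of a second order equation. -/
theorem sprayLocal_fst (hS : IsSpray S) {c : V × V}
    (hc : c.1 ∈ (extChartAt 𝓘(ℝ, V) x).target) : (sprayLocal S x c).1 = c.2 := by
  set w := (tangentChart V x).symm c with hw
  have hct := mem_tangentChart_target.2 hc
  have hws : w ∈ (tangentChart V x).source := (tangentChart V x).map_target hct
  have hwc : tangentChart V x w = c := (tangentChart V x).right_inv hct
  have hwp := mem_tangentChart_source.1 hws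
  have h1 := ((ContinuousLinearMap.fst ℝ V V).hasMFDerivAt (x := tangentChart V x w)).comp w
    (hasMFDerivAt_extChartAt_of_mem (I := 𝓘(ℝ, V).tangent) hws)
  have h2 := (hasMFDerivAt_extChartAt_of_mem hwp).comp w
    (Bundle.mdifferentiableAt_proj (TangentSpace 𝓘(ℝ, V) : M → Type _)
      (p := w) (IB := 𝓘(ℝ, V))).hasMFDerivAt
  have h3 : (ContinuousLinearMap.fst ℝ V V : V × V → V) ∘ tangentChart V x =ᶠ[𝓝 w]
      extChartAt 𝓘(ℝ, V) x ∘ Bundle.TotalSpace.proj := Filter.Eventually.of_forall fun u => rfl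
  have h4 := congrArg (fun L : V × V →L[ℝ] V => L (S w))
    (hasMFDerivAt_unique h1 (h2.congr_of_eventuallyEq h3))
  refine h4.trans ?_
  have h5 := congrArg Prod.snd (tangentChart_apply hwp)
  rw [hwc] at h5
  exact (congrArg (fun u => chartD 𝓘(ℝ, V) x w.proj u) (hS.proj w)).trans h5.symm

theorem sprayLocal_zero (hS : IsSpray S) : sprayLocal S x (extChartAt 𝓘(ℝ, V) x x, 0) = 0 := by
  have h1 : tangentChart V x ⟨x, 0⟩ = (extChartAt 𝓘(ℝ, V) x x, 0) := by
    rw [tangentChart_apply (mem_extChartAt_source x)]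
    exact congrArg (Prod.mk _) (map_zero (chartD 𝓘(ℝ, V) x x))
  have h2 : (tangentChart V x).symm (extChartAt 𝓘(ℝ, V) x x, 0) = ⟨x, 0⟩ := by
    rw [← h1]
    exact (tangentChart V x).left_inv (mem_tangentChart_source.2 (mem_extChartAt_source x))
  have h3 : ∀ w : TangentBundle 𝓘(ℝ, V) M, w = ⟨x, 0⟩ →
      chartD 𝓘(ℝ, V).tangent (⟨x, 0⟩ : TangentBundle 𝓘(ℝ, V) M) w (S w) = 0 := by
    rintro w rfl
    rw [hS.zero, map_zero]
  exact h3 _ h2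

/-- A solution of the second order equation of the spray in a chart is a solution of the spray. -/
theorem isSpraySolution_of_hasDerivWithinAt (hS : IsSpray S) {c : ℝ → V × V} {a b : ℝ} (hab : a < b)
    (hc : ∀ t ∈ Icc a b, (c t).1 ∈ (extChartAt 𝓘(ℝ, V) x).target)
    (h : ∀ t ∈ Icc a b, HasDerivWithinAt c (sprayLocal S x (c t)) (Icc a b) t) :
    IsSpraySolution S (fun t => (extChartAt 𝓘(ℝ, V) x).symm (c t).1) a b := by
  refine (hS.isSpraySolution_iff hab).2
    ⟨fun t => (tangentChart V x).symm (c t), fun t ht => ?_, fun t ht => rfl⟩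
  have hct := mem_tangentChart_target.2 (hc t ht)
  exact ((h t ht).chart_symm (I := 𝓘(ℝ, V).tangent) hct).congr_velocity
    (chartDSymm_chartD (I := 𝓘(ℝ, V).tangent) hct _).symm

end SprayChart

/-! ### Horizontal curves -/

section HorizontalCurves

variable {VM : Type*} [NormedAddCommGroup VM] [NormedSpace ℝ VM]
  {M : Type*} [TopologicalSpace M] [ChartedSpace VM M]
  {VE : Type*} [NormedAddCommGroup VE] [NormedSpace ℝ VE]
  {E : Type*} [TopologicalSpace E] [ChartedSpace VE E]

/-- The curve `σ : [c, d] → E` is smooth and horizontal. -/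
def IsHorizontalOn (D : (x : E) → Submodule ℝ (TangentSpace 𝓘(ℝ, VE) x)) (σ : ℝ → E)
    (c d : ℝ) : Prop :=
  ContMDiffOn 𝓘(ℝ, ℝ) 𝓘(ℝ, VE) ∞ σ (Icc c d) ∧
    ∀ t ∈ Icc c d, ∃ v ∈ D (σ t), HasVelocityWithinAt 𝓘(ℝ, VE) σ (Icc c d) t v

variable {π : E → M} {D : (x : E) → Submodule ℝ (TangentSpace 𝓘(ℝ, VE) x)} {e : E}
  {σ σ₁ σ₂ : ℝ → E} {a b c d : ℝ}

namespace IsHorizontalOn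

theorem continuousOn (h : IsHorizontalOn D σ c d) : ContinuousOn σ (Icc c d) :=
  h.1.continuousOn

theorem mono (h : IsHorizontalOn D σ a b) (hac : a ≤ c) (hdb : d ≤ b) :
    IsHorizontalOn D σ c d := by
  have hs := Icc_subset_Icc hac hdb
  refine ⟨h.1.mono hs, fun t ht => ?_⟩
  obtain ⟨v, hv, hσ⟩ := h.2 t (hs ht)
  exact ⟨v, hv, hσ.mono hs⟩

theorem comp_affine {a' b' : ℝ} (h : IsHorizontalOn D σ a b)
    (hmaps : MapsTo (fun t => c * t + d) (Icc a' b') (Icc a b)) :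
    IsHorizontalOn D (fun t => σ (c * t + d)) a' b' := by
  refine ⟨h.1.comp (ContDiff.contMDiff (by fun_prop)).contMDiffOn hmaps, fun t ht => ?_⟩
  obtain ⟨v, hv, hσ⟩ := h.2 _ (hmaps ht)
  exact ⟨c • v, (D _).smul_mem c hv, hσ.comp_affine hmaps⟩

theorem comp_section {s : M → E} {γ : ℝ → M}
    (hs : ∀ t ∈ Icc c d, ContMDiffAt 𝓘(ℝ, VM) 𝓘(ℝ, VE) ∞ s (γ t))
    (hsD : ∀ t ∈ Icc c d, ∀ u, mfderiv 𝓘(ℝ, VM) 𝓘(ℝ, VE) s (γ t) u ∈ D (s (γ t)))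
    (hγ : ContMDiffOn 𝓘(ℝ, ℝ) 𝓘(ℝ, VM) ∞ γ (Icc c d)) :
    IsHorizontalOn D (fun t => s (γ t)) c d := by
  refine ⟨fun t ht => (hs t ht).comp_contMDiffWithinAt t (hγ t ht), fun t ht => ?_⟩
  have h1 := ((hγ t ht).mdifferentiableWithinAt (by simp)).hasVelocityWithinAt
  exact ⟨_, hsD t ht _, h1.map ((hs t ht).mdifferentiableAt (by simp))⟩

end IsHorizontalOn

theorem PiecewiseOn.continuousOn (h : PiecewiseOn (IsHorizontalOn D σ) a b) :
    ContinuousOn σ (Icc a b) := by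
  refine h.induction (Q := fun a b => ContinuousOn σ (Icc a b)) ?_ ?_
  · intro a
    rw [Icc_self]
    exact continuousOn_singleton σ a
  · intro a c b hac h hcb ih
    rw [← Icc_union_Icc_eq_Icc hac.le hcb.le]
    exact h.continuousOn.union_of_isClosed ih isClosed_Icc isClosed_Icc

theorem PiecewiseOn.restrict_horizontal (h : PiecewiseOn (IsHorizontalOn D σ) a b)
    (hac : a ≤ c) (hcd : c ≤ d) (hdb : d ≤ b) : PiecewiseOn (IsHorizontalOn D σ) c d :=
  h.restrict (fun _ _ _ _ h1 _ h2 h => h.mono h1 h2) hac hcd hdb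

/-- Converse of `IsHorizontalLift.piecewiseOn`. Where a curve is differentiable at a corner, its
derivative equals the derivative from one side, which is horizontal. -/
theorem PiecewiseOn.isHorizontalLift {B : Type*} {p : E → B}
    (h : PiecewiseOn (IsHorizontalOn D σ) a b) (hab : a < b) {γ : ℝ → B}
    (hγ : ∀ t ∈ Icc a b, p (σ t) = γ t) : IsHorizontalLift p D γ σ a b := by
  refine ⟨h.mono fun c d _ _ _ h => h.1, fun t ht hd => ?_, hγ⟩
  have hmono : ∀ a b c d, a ≤ c → c < d → d ≤ b → IsHorizontalOn D σ a b →
      IsHorizontalOn D σ c d := fun _ _ _ _ h1 _ h2 h => h.mono h1 h2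
  obtain ⟨c', d', hlt, hac, hdb, htc, hσ⟩ : ∃ c' d', c' < d' ∧ a ≤ c' ∧ d' ≤ b ∧
      t ∈ Icc c' d' ∧ IsHorizontalOn D σ c' d' := by
    rcases ht.2.eq_or_lt with rfl | hlt
    · obtain ⟨c', hc', hσ⟩ := h.exists_left hmono (right_mem_Ioc.2 hab)
      exact ⟨c', t, hc'.2, hc'.1, le_rfl, right_mem_Icc.2 hc'.2.le, hσ⟩
    · obtain ⟨d', hd', hσ⟩ := h.exists_right hmono ⟨ht.1, hlt⟩
      exact ⟨t, d', hd'.1, ht.1, hd'.2, left_mem_Icc.2 hd'.1.le, hσ⟩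
  obtain ⟨v, hv, hvel⟩ := hσ.2 t htc
  have h1 := hd.hasVelocityWithinAt.mono (Icc_subset_Icc hac hdb)
  rw [← h1.unique hvel (uniqueDiffOn_Icc hlt t htc)] at hv
  exact hv

variable [IsManifold 𝓘(ℝ, VM) ∞ M] [IsManifold 𝓘(ℝ, VE) ∞ E]

/-- Horizontality of a vector may be tested in a chart. -/
theorem chartDSymm_chartD_mem_iff {x y : E} (hy : y ∈ (extChartAt 𝓘(ℝ, VE) x).source)
    (v : TangentSpace 𝓘(ℝ, VE) y) :
    chartDSymm 𝓘(ℝ, VE) x (extChartAt 𝓘(ℝ, VE) x y) (chartD 𝓘(ℝ, VE) x y v) ∈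
      D ((extChartAt 𝓘(ℝ, VE) x).symm (extChartAt 𝓘(ℝ, VE) x y)) ↔ v ∈ D y := by
  obtain ⟨z, hz, rfl⟩ : ∃ z ∈ (extChartAt 𝓘(ℝ, VE) x).target, (extChartAt 𝓘(ℝ, VE) x).symm z = y :=
    ⟨_, (extChartAt 𝓘(ℝ, VE) x).map_source hy, (extChartAt 𝓘(ℝ, VE) x).left_inv hy⟩
  have h1 : ∀ z', z' = z → (chartDSymm 𝓘(ℝ, VE) x z'
      (chartD 𝓘(ℝ, VE) x ((extChartAt 𝓘(ℝ, VE) x).symm z) v) ∈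
        D ((extChartAt 𝓘(ℝ, VE) x).symm z') ↔ v ∈ D ((extChartAt 𝓘(ℝ, VE) x).symm z)) := by
    rintro z' rfl
    rw [chartDSymm_chartD hz]
  exact h1 _ ((extChartAt 𝓘(ℝ, VE) x).right_inv hz)

namespace IsLiftOperator

variable {O : Set VE} {H : VE → VM →L[ℝ] VE}

/-- A horizontal curve, read in a chart, is determined by its projection through the lift
operator. -/
theorem exists_hasDerivWithinAt (h : IsLiftOperator π D e O H)
    (hπ : ContMDiff 𝓘(ℝ, VE) 𝓘(ℝ, VM) ∞ π) (hDhor : IsHorizontalDistribution VM π D)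
    {s : Set ℝ} {t : ℝ} {v : TangentSpace 𝓘(ℝ, VE) (σ t)}
    (hσ : HasVelocityWithinAt 𝓘(ℝ, VE) σ s t v) (hv : v ∈ D (σ t))
    (hsrc : σ t ∈ (extChartAt 𝓘(ℝ, VE) e).source) (hO : extChartAt 𝓘(ℝ, VE) e (σ t) ∈ O) :
    ∃ u : VM, HasDerivWithinAt (fun t => extChartAt 𝓘(ℝ, VM) (π e) (π (σ t))) u s t ∧
      HasDerivWithinAt (fun t => extChartAt 𝓘(ℝ, VE) e (σ t))
        (H (extChartAt 𝓘(ℝ, VE) e (σ t)) u) s t := by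
  have h1 := hσ.chart (x := e) hsrc
  have h2 := h.eq_lift hπ hDhor hO ((chartDSymm_chartD_mem_iff hsrc v).2 hv)
  have h3 := ((h.contDiffAt_proj hπ hO).differentiableAt
    (by simp)).hasFDerivAt.comp_hasDerivWithinAt t h1
  refine ⟨_, h3.congr_of_eventuallyEq ?_ ?_, ?_⟩
  · filter_upwards [hσ.continuousWithinAt ((isOpen_extChartAt_source e).mem_nhds hsrc)] with t' ht'
    simp only [Function.comp, localProj]
    rw [(extChartAt 𝓘(ℝ, VE) e).left_inv ht']
  · simp only [Function.comp, localProj]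
    rw [(extChartAt 𝓘(ℝ, VE) e).left_inv hsrc]
  · rw [h2]
    exact h1

end IsLiftOperator

section Uniqueness

variable [CompleteSpace VM] [FiniteDimensional ℝ VE] (hπ : ContMDiff 𝓘(ℝ, VE) 𝓘(ℝ, VM) ∞ π)
    (hsubm : ∀ x : E, Function.Surjective (mfderiv 𝓘(ℝ, VE) 𝓘(ℝ, VM) π x))
    (hD : IsSmoothDistribution D) (hDhor : IsHorizontalDistribution VM π D)

include hπ hsubm hD hDhor

/-- Two horizontal curves with the same projection which start at the same point agree for a short
time, as they solve the same differential equation in a chart. -/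
theorem IsHorizontalOn.eventuallyEq_right (hcd : c < d) (h₁ : IsHorizontalOn D σ₁ c d)
    (h₂ : IsHorizontalOn D σ₂ c d) (hproj : ∀ t ∈ Icc c d, π (σ₁ t) = π (σ₂ t))
    (hc : σ₁ c = σ₂ c) : ∀ᶠ t in 𝓝[>] c, σ₁ t = σ₂ t := by
  obtain ⟨O, H, hH⟩ := exists_isLiftOperator hπ hsubm hD hDhor (σ₁ c)
  set φ := extChartAt 𝓘(ℝ, VE) (σ₁ c) with hφ
  have hcc : c ∈ Icc c d := left_mem_Icc.2 hcd.le
  let g : ℝ → VM := fun t => extChartAt 𝓘(ℝ, VM) (π (σ₁ c)) (π (σ₁ t))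
  have hud := uniqueDiffOn_Icc hcd
  obtain ⟨K, B, hB, hK⟩ :=
    ((hH.contDiffAt _ hH.mem).of_le (m := 1) (by simp)).exists_lipschitzOnWith
  have hgs : ContDiffWithinAt ℝ ∞ g (Icc c d) c := by
    rw [← contMDiffWithinAt_iff_contDiffWithinAt]
    exact (contMDiffAt_extChartAt_of_mem (mem_extChartAt_source _)).comp_contMDiffWithinAt c
      ((hπ _).comp_contMDiffWithinAt c (h₁.1 c hcc))
  have hgc : ContinuousWithinAt (derivWithin g (Icc c d)) (Icc c d) c :=
    ((hgs.fderivWithin_right (m := 0) hud (by simp) hcc).clm_apply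
      contDiffWithinAt_const).continuousWithinAt
  have hgb : ∀ᶠ t in 𝓝[Icc c d] c, ‖derivWithin g (Icc c d) t‖₊ <
      ‖derivWithin g (Icc c d) c‖₊ + 1 :=
    hgc.nnnorm.eventually_lt continuousWithinAt_const (by simp)
  have hnear : ∀ σ, IsHorizontalOn D σ c d → σ c = σ₁ c →
      ∀ᶠ t in 𝓝[Icc c d] c, σ t ∈ φ.source ∧ φ (σ t) ∈ O ∧ φ (σ t) ∈ B := by
    intro σ hσ hσc
    have h1 : ContinuousWithinAt σ (Icc c d) c := hσ.continuousOn c hcc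
    have h2 : Filter.Tendsto σ (𝓝[Icc c d] c) (𝓝 (σ₁ c)) := hσc ▸ h1
    have h3 := (continuousAt_extChartAt (I := 𝓘(ℝ, VE)) (σ₁ c)).tendsto.comp h2
    exact (h2.eventually (extChartAt_source_mem_nhds (σ₁ c))).and
      ((h3.eventually (hH.isOpen.mem_nhds hH.mem)).and (h3.eventually hB))
  have hall := (hgb.and ((hnear σ₁ h₁ rfl).and (hnear σ₂ h₂ hc.symm)))
  rw [nhdsWithin_Icc_eq_nhdsGE hcd] at hall
  obtain ⟨d', hd'c, hsub⟩ := mem_nhdsGE_iff_exists_Icc_subset.1 hall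
  have hderiv : ∀ σ, IsHorizontalOn D σ c d → (∀ t ∈ Icc c d, π (σ₁ t) = π (σ t)) →
      (∀ t ∈ Icc c d', σ t ∈ φ.source ∧ φ (σ t) ∈ O ∧ φ (σ t) ∈ B) →
      ∀ t ∈ Icc c d', t ∈ Icc c d → HasDerivWithinAt (fun t => φ (σ t))
        (H (φ (σ t)) (derivWithin g (Icc c d) t)) (Icc c d) t := by
    intro σ hσ hσπ hmem t ht ht'
    obtain ⟨v, hv, hvel⟩ := hσ.2 t ht'
    obtain ⟨u, hu, hu'⟩ := hH.exists_hasDerivWithinAt hπ hDhor hvel hv (hmem t ht).1 (hmem t ht).2.1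
    have h4 : HasDerivWithinAt g u (Icc c d) t :=
      hu.congr (fun t ht => by simp only [g, hσπ t ht]) (by simp only [g, hσπ t ht'])
    rwa [h4.derivWithin (hud t ht')]
  set d'' := min d d' with hd''
  have hsub' : Icc c d'' ⊆ Icc c d' := Icc_subset_Icc_right (min_le_right _ _)
  have hsub'' : Icc c d'' ⊆ Icc c d := Icc_subset_Icc_right (min_le_left _ _)
  have hlt : c < d'' := lt_min hcd hd'c
  have hright : ∀ (f : ℝ → VE) (f' : VE) (t : ℝ), t ∈ Ico c d'' →
      HasDerivWithinAt f f' (Icc c d) t → HasDerivWithinAt f f' (Ici t) t := by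
    intro f f' t ht hf
    refine (hf.mono (Icc_subset_Icc_left ht.1)).mono_of_mem_nhdsWithin ?_
    exact Icc_mem_nhdsGE (ht.2.trans_le (min_le_left _ _))
  have hd1 := hderiv σ₁ h₁ (fun _ _ => rfl) fun t ht => (hsub ht).2.1
  have hd2 := hderiv σ₂ h₂ hproj fun t ht => (hsub ht).2.2
  have huniq := ODE_solution_unique_of_mem_Icc_right
    (v := fun t z => H z (derivWithin g (Icc c d) t)) (s := fun _ => B)
    (f := fun t => φ (σ₁ t)) (g := fun t => φ (σ₂ t)) (a := c) (b := d'')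
    (K := K * (‖derivWithin g (Icc c d) c‖₊ + 1))
    (fun t ht => ?_)
    (fun t ht => (hd1 t (hsub' ht) (hsub'' ht)).continuousWithinAt.mono hsub'')
    (fun t ht => hright _ _ t ht (hd1 t (hsub' (Ico_subset_Icc_self ht))
      (hsub'' (Ico_subset_Icc_self ht))))
    (fun t ht => (hsub (hsub' (Ico_subset_Icc_self ht))).2.1.2.2)
    (fun t ht => (hd2 t (hsub' ht) (hsub'' ht)).continuousWithinAt.mono hsub'')
    (fun t ht => hright _ _ t ht (hd2 t (hsub' (Ico_subset_Icc_self ht))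
      (hsub'' (Ico_subset_Icc_self ht))))
    (fun t ht => (hsub (hsub' (Ico_subset_Icc_self ht))).2.2.2.2)
    (congrArg φ hc)
  · filter_upwards [Ioo_mem_nhdsGT hlt] with t ht
    have ht' := Ioo_subset_Icc_self ht
    exact φ.injOn (hsub (hsub' ht')).2.1.1 (hsub (hsub' ht')).2.2.1 (huniq ht')
  · refine LipschitzOnWith.of_dist_le_mul fun z hz z' hz' => ?_
    have h5 : ‖derivWithin g (Icc c d) t‖ ≤ ‖derivWithin g (Icc c d) c‖ + 1 :=
      (hsub (hsub' (Ico_subset_Icc_self ht))).1.le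
    have h6 := hK.dist_le_mul z hz z' hz'
    rw [dist_eq_norm] at h6
    rw [dist_eq_norm, ← sub_apply]
    refine (ContinuousLinearMap.le_opNorm _ _).trans ?_
    push_cast
    rw [mul_right_comm]
    gcongr

/-- Uniqueness of piecewise smooth horizontal lifts. -/
theorem PiecewiseOn.eqOn_of_left [T2Space E] (h₁ : PiecewiseOn (IsHorizontalOn D σ₁) a b)
    (h₂ : PiecewiseOn (IsHorizontalOn D σ₂) a b) (hproj : ∀ t ∈ Icc a b, π (σ₁ t) = π (σ₂ t))
    (ha : σ₁ a = σ₂ a) : ∀ t ∈ Icc a b, σ₁ t = σ₂ t := by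
  have hclosed : IsClosed ({t | σ₁ t = σ₂ t} ∩ Icc a b) := by
    rw [inter_comm]
    exact (h₁.continuousOn.prodMk h₂.continuousOn).preimage_isClosed_of_isClosed isClosed_Icc
      isClosed_diagonal
  refine hclosed.Icc_subset_of_forall_mem_nhdsWithin ha ?_
  rintro t ⟨ht, htab⟩
  have hmono : ∀ σ : ℝ → E, ∀ a b c d, a ≤ c → c < d → d ≤ b → IsHorizontalOn D σ a b →
      IsHorizontalOn D σ c d := fun _ _ _ _ _ h1 _ h2 h => h.mono h1 h2
  obtain ⟨d₁, hd₁, hσ₁⟩ := h₁.exists_right (hmono _) htab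
  obtain ⟨d₂, hd₂, hσ₂⟩ := h₂.exists_right (hmono _) htab
  exact IsHorizontalOn.eventuallyEq_right hπ hsubm hD hDhor (lt_min hd₁.1 hd₂.1)
    (hσ₁.mono le_rfl (min_le_left _ _)) (hσ₂.mono le_rfl (min_le_right _ _))
    (fun u hu => hproj u ⟨htab.1.trans hu.1, hu.2.trans ((min_le_left _ _).trans hd₁.2)⟩) ht

/-- Two smooth horizontal curves with the same projection which agree at some time agree. -/
theorem IsHorizontalOn.eqOn [T2Space E] (h₁ : IsHorizontalOn D σ₁ c d)
    (h₂ : IsHorizontalOn D σ₂ c d) (hproj : ∀ t ∈ Icc c d, π (σ₁ t) = π (σ₂ t)) {t₀ : ℝ}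
    (ht₀ : t₀ ∈ Icc c d) (h : σ₁ t₀ = σ₂ t₀) : ∀ t ∈ Icc c d, σ₁ t = σ₂ t := by
  intro t ht
  rcases lt_trichotomy t t₀ with hlt | rfl | hlt
  · -- reversal of time reduces the claim to the other case
    have hmaps : MapsTo (fun u => (-1 : ℝ) * u + t₀) (Icc 0 (t₀ - t)) (Icc c d) := fun u hu =>
      ⟨by linarith [hu.2, ht.1], by linarith [hu.1, ht₀.2]⟩
    have h3 := PiecewiseOn.eqOn_of_left hπ hsubm hD hDhor
      (PiecewiseOn.of (sub_pos.2 hlt) (h₁.comp_affine hmaps))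
      (PiecewiseOn.of (sub_pos.2 hlt) (h₂.comp_affine hmaps)) (fun u hu => hproj _ (hmaps hu))
      (by simpa using h) (t₀ - t) (right_mem_Icc.2 (sub_pos.2 hlt).le)
    simpa using h3
  · exact h
  · exact PiecewiseOn.eqOn_of_left hπ hsubm hD hDhor (PiecewiseOn.of hlt (h₁.mono ht₀.1 ht.2))
      (PiecewiseOn.of hlt (h₂.mono ht₀.1 ht.2))
      (fun u hu => hproj u ⟨ht₀.1.trans hu.1, hu.2.trans ht.2⟩) h t (right_mem_Icc.2 hlt.le)

/-- As `D` is closed, a smooth curve whose derivative is horizontal at all interior times is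
horizontal. -/
theorem isHorizontalOn_of_Ioo (hcd : c < d) (hσ : ContMDiffOn 𝓘(ℝ, ℝ) 𝓘(ℝ, VE) ∞ σ (Icc c d))
    (hσD : ∀ t ∈ Ioo c d, ∃ v ∈ D (σ t), HasVelocityWithinAt 𝓘(ℝ, VE) σ (Icc c d) t v) :
    IsHorizontalOn D σ c d := by
  refine ⟨hσ, fun t₀ ht₀ => ?_⟩
  obtain ⟨O, H, hH⟩ := exists_isLiftOperator hπ hsubm hD hDhor (σ t₀)
  set φ := extChartAt 𝓘(ℝ, VE) (σ t₀) with hφ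
  have hud := uniqueDiffOn_Icc hcd
  let f : ℝ → VE := fun t => φ (σ t)
  have hvel := ((hσ t₀ ht₀).mdifferentiableWithinAt (by simp)).hasVelocityWithinAt
  set v := mfderivWithin 𝓘(ℝ, ℝ) 𝓘(ℝ, VE) σ (Icc c d) t₀ (1 : ℝ) with hv
  refine ⟨v, ?_, hvel⟩
  have hsrc : σ t₀ ∈ φ.source := mem_extChartAt_source _
  rw [← chartDSymm_chartD_mem_iff hsrc]
  have hf0 : derivWithin f (Icc c d) t₀ = chartD 𝓘(ℝ, VE) (σ t₀) (σ t₀) v :=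
    (hvel.chart hsrc).derivWithin (hud t₀ ht₀)
  have hfs : ContDiffWithinAt ℝ ∞ f (Icc c d) t₀ := by
    rw [← contMDiffWithinAt_iff_contDiffWithinAt]
    exact (contMDiffAt_extChartAt_of_mem hsrc).comp_contMDiffWithinAt t₀ (hσ t₀ ht₀)
  have hfc : ContinuousWithinAt (derivWithin f (Icc c d)) (Icc c d) t₀ :=
    ((hfs.fderivWithin_right (m := 0) hud (by simp) ht₀).clm_apply
      contDiffWithinAt_const).continuousWithinAt
  have hHc := (hH.contDiffAt _ hH.mem).continuousAt
  have hPc := ((hH.contDiffAt_proj hπ hH.mem).continuousAt_fderiv (by simp))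
  have hlim : ContinuousWithinAt (fun t => H (f t)
      (fderiv ℝ (localProj VM VE π (σ t₀)) (f t) (derivWithin f (Icc c d) t))) (Icc c d) t₀ :=
    (hHc.comp_continuousWithinAt (f := f) hfs.continuousWithinAt).clm_apply
      ((hPc.comp_continuousWithinAt (f := f) hfs.continuousWithinAt).clm_apply hfc)
  have hne : (𝓝[Ioo c d] t₀).NeBot :=
    mem_closure_iff_nhdsWithin_neBot.1 (by rwa [closure_Ioo hcd.ne])
  have hev : ∀ᶠ t in 𝓝[Ioo c d] t₀, H (f t)
      (fderiv ℝ (localProj VM VE π (σ t₀)) (f t) (derivWithin f (Icc c d) t)) =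
        derivWithin f (Icc c d) t := by
    have h1 : ∀ᶠ t in 𝓝[Ioo c d] t₀, σ t ∈ φ.source :=
      ((hσ t₀ ht₀).continuousWithinAt.mono Ioo_subset_Icc_self)
        ((isOpen_extChartAt_source _).mem_nhds hsrc)
    have h2 : ∀ᶠ t in 𝓝[Ioo c d] t₀, f t ∈ O :=
      (hfs.continuousWithinAt.mono Ioo_subset_Icc_self) (hH.isOpen.mem_nhds hH.mem)
    filter_upwards [h1, h2, self_mem_nhdsWithin] with t ht1 ht2 ht
    obtain ⟨w, hw, hw'⟩ := hσD t ht
    have h3 := (hw'.chart ht1).derivWithin (hud t (Ioo_subset_Icc_self ht))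
    refine hH.eq_lift hπ hDhor ht2 ?_
    have h4 : derivWithin f (Icc c d) t = chartD 𝓘(ℝ, VE) (σ t₀) (σ t) w := h3
    rw [h4]
    exact (chartDSymm_chartD_mem_iff ht1 w).2 hw
  have hlim1 := (hlim.mono Ioo_subset_Icc_self).tendsto
  have hlim2 := (hfc.mono Ioo_subset_Icc_self).tendsto
  have heq := tendsto_nhds_unique (hlim1.congr' hev) hlim2
  rw [← hf0, ← heq]
  exact hH.horizontal _ hH.mem _

/-- A horizontal lift is smooth and horizontal, up to the end points, on the intervals of a
partition. -/
theorem IsHorizontalLift.piecewiseOn {γ : ℝ → M} (h : IsHorizontalLift π D γ σ a b) :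
    PiecewiseOn (IsHorizontalOn D σ) a b := by
  refine h.smooth.mono fun c d hac hcd hdb hσ => ?_
  refine isHorizontalOn_of_Ioo hπ hsubm hD hDhor hcd hσ fun t ht => ?_
  have hsub := Icc_subset_Icc hac hdb
  have htab := hsub (Ioo_subset_Icc_self ht)
  have hd : MDifferentiableAt 𝓘(ℝ, ℝ) 𝓘(ℝ, VE) σ t :=
    ((hσ t (Ioo_subset_Icc_self ht)).contMDiffAt (Icc_mem_nhds ht.1 ht.2)).mdifferentiableAt
      (by simp)
  exact ⟨_, h.horizontal t htab hd.mdifferentiableWithinAt,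
    hd.mdifferentiableWithinAt.hasVelocityWithinAt.mono hsub⟩

end Uniqueness

end HorizontalCurves

/-! ### Local horizontal sections -/

section LocalSections

variable {VM : Type*} [NormedAddCommGroup VM] [NormedSpace ℝ VM]
  {M : Type*} [TopologicalSpace M] [ChartedSpace VM M]
  {VE : Type*} [NormedAddCommGroup VE] [NormedSpace ℝ VE]
  {E : Type*} [TopologicalSpace E] [ChartedSpace VE E]

/-- A solution of the equation `df = H ∘ f` with smooth `H` is smooth. -/
theorem contDiffOn_of_hasFDerivAt_comp {H : VE → VM →L[ℝ] VE} {f : VM → VE} {U : Set VM}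
    (hU : IsOpen U) (hf : ∀ y ∈ U, HasFDerivAt f (H (f y)) y)
    (hH : ∀ y ∈ U, ContDiffAt ℝ ∞ H (f y)) : ContDiffOn ℝ ∞ f U := by
  refine contDiffOn_infty.2 fun n => ?_
  induction n with
  | zero =>
    exact contDiffOn_zero.2 fun y hy => (hf y hy).continuousAt.continuousWithinAt
  | succ n ih =>
    refine (contDiffOn_succ_iff_fderiv_of_isOpen hU).2
      ⟨fun y hy => (hf y hy).differentiableAt.differentiableWithinAt,
        fun h => absurd h (WithTop.coe_ne_top (a := (n : ℕ∞))), ?_⟩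
    have h1 : ContDiffOn ℝ n (fun y => H (f y)) U := fun y hy =>
      ((hH y hy).of_le (mod_cast le_top)).comp_contDiffWithinAt y (ih y hy)
    exact h1.congr fun y hy => (hf y hy).fderiv

variable (VM VE) in
/-- Near `x`, the map `s : M → E` is a smooth horizontal section of `π`. -/
def IsHorizontalSectionNear (π : E → M) (D : (x : E) → Submodule ℝ (TangentSpace 𝓘(ℝ, VE) x))
    (s : M → E) (x : M) : Prop :=
  ∀ᶠ y in 𝓝 x, ContMDiffAt 𝓘(ℝ, VM) 𝓘(ℝ, VE) ∞ s y ∧ π (s y) = y ∧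
    ∀ u, mfderiv 𝓘(ℝ, VM) 𝓘(ℝ, VE) s y u ∈ D (s y)

variable {π : E → M} {D : (x : E) → Submodule ℝ (TangentSpace 𝓘(ℝ, VE) x)}
  {s s₁ s₂ : M → E} {x : M} {σ : ℝ → E} {a b c d t : ℝ}

/-- A section with horizontal derivative has range all of `D`, since `dπ` is injective on `D`. -/
theorem IsHorizontalSectionNear.range_mfderiv (hs : IsHorizontalSectionNear VM VE π D s x)
    (hπ : ContMDiff 𝓘(ℝ, VE) 𝓘(ℝ, VM) ∞ π) (hDhor : IsHorizontalDistribution VM π D) :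
    LinearMap.range (mfderiv 𝓘(ℝ, VM) 𝓘(ℝ, VE) s x).toLinearMap = D (s x) := by
  obtain ⟨hsm, hproj, hsD⟩ := hs.self_of_nhds
  refine le_antisymm ?_ fun v hv => ?_
  · rintro _ ⟨u, rfl⟩
    exact hsD u
  · have h1 := ((hπ (s x)).mdifferentiableAt (by simp)).hasMFDerivAt.comp x
      (hsm.mdifferentiableAt (by simp)).hasMFDerivAt
    have h2 : π ∘ s =ᶠ[𝓝 x] id := hs.mono fun y hy => hy.2.1
    have h3 := hasMFDerivAt_unique ((hasMFDerivAt_id x).congr_of_eventuallyEq h2) h1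
    have h4 : ∀ u : VM, (mfderiv 𝓘(ℝ, VE) 𝓘(ℝ, VM) π (s x)
        (mfderiv 𝓘(ℝ, VM) 𝓘(ℝ, VE) s x u) : VM) = u := fun u =>
      (congrArg (fun L : VM →L[ℝ] VM => L u) h3).symm
    set u : VM := mfderiv 𝓘(ℝ, VE) 𝓘(ℝ, VM) π (s x) v with hu
    refine ⟨u, ?_⟩
    have h5 : mfderiv 𝓘(ℝ, VM) 𝓘(ℝ, VE) s x u - v ∈ D (s x) := (D _).sub_mem (hsD u) hv
    have h6 : mfderiv 𝓘(ℝ, VE) 𝓘(ℝ, VM) π (s x) (mfderiv 𝓘(ℝ, VM) 𝓘(ℝ, VE) s x u - v) = 0 := by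
      rw [map_sub]
      exact sub_eq_zero.2 (h4 u)
    exact sub_eq_zero.1 (Submodule.disjoint_def.1 (hDhor (s x)).disjoint _ h6 h5)

section Uniqueness

variable [IsManifold 𝓘(ℝ, VM) ∞ M] [IsManifold 𝓘(ℝ, VE) ∞ E]
    [T2Space E] [CompleteSpace VM] [FiniteDimensional ℝ VE]
    (hπ : ContMDiff 𝓘(ℝ, VE) 𝓘(ℝ, VM) ∞ π)
    (hsubm : ∀ x : E, Function.Surjective (mfderiv 𝓘(ℝ, VE) 𝓘(ℝ, VM) π x))
    (hD : IsSmoothDistribution D) (hDhor : IsHorizontalDistribution VM π D)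

include hπ hsubm hD hDhor

theorem IsHorizontalSectionNear.eventually_comp_eq_of_isHorizontalOn
    (hs : IsHorizontalSectionNear VM VE π D s (π (σ t))) (ht : t ∈ Icc c d)
    (hst : s (π (σ t)) = σ t) (hσ : IsHorizontalOn D σ c d) :
    ∀ᶠ t' in 𝓝[Icc c d] t, s (π (σ t')) = σ t' := by
  have h1 := (hπ.continuous.continuousAt.comp_continuousWithinAt
    (hσ.continuousOn t ht)).eventually hs
  obtain ⟨δ, hδ, hsub⟩ := Metric.mem_nhdsWithin_iff.1 h1
  have hconn : OrdConnected (Metric.ball t δ ∩ Icc c d) :=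
    (convex_ball t δ).ordConnected.inter ordConnected_Icc
  have htm : t ∈ Metric.ball t δ ∩ Icc c d := ⟨Metric.mem_ball_self hδ, ht⟩
  filter_upwards [inter_mem_nhdsWithin (Icc c d) (Metric.ball_mem_nhds t hδ)] with t' ht'
  rw [inter_comm] at ht'
  have hu : uIcc t t' ⊆ Metric.ball t δ ∩ Icc c d := hconn.uIcc_subset htm ht'
  have hσ' : IsHorizontalOn D σ (min t t') (max t t') :=
    hσ.mono (le_min ht.1 ht'.2.1) (max_le ht.2 ht'.2.2)
  have hcomp : IsHorizontalOn D (fun t => s (π (σ t))) (min t t') (max t t') :=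
    IsHorizontalOn.comp_section (fun u hu' => (hsub (hu hu')).1)
      (fun u hu' => (hsub (hu hu')).2.2) (hπ.comp_contMDiffOn hσ'.1)
  exact hcomp.eqOn hπ hsubm hD hDhor hσ' (fun u hu' => (hsub (hu hu')).2.1)
    left_mem_uIcc hst t' right_mem_uIcc

/-- A horizontal section which meets a horizontal curve contains the curve, locally. -/
theorem IsHorizontalSectionNear.eventually_comp_eq
    (hs : IsHorizontalSectionNear VM VE π D s (π (σ t))) (ht : t ∈ Icc a b)
    (hst : s (π (σ t)) = σ t) (hσ : PiecewiseOn (IsHorizontalOn D σ) a b) :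
    ∀ᶠ t' in 𝓝[Icc a b] t, s (π (σ t')) = σ t' := by
  have hmono : ∀ a b c d, a ≤ c → c < d → d ≤ b → IsHorizontalOn D σ a b →
      IsHorizontalOn D σ c d := fun _ _ _ _ h1 _ h2 h => h.mono h1 h2
  rw [← Icc_union_Icc_eq_Icc ht.1 ht.2, nhdsWithin_union]
  refine Filter.eventually_sup.2 ⟨?_, ?_⟩
  · rcases ht.1.eq_or_lt with rfl | hlt
    · simpa using hst
    · obtain ⟨c, hc, hσc⟩ := hσ.exists_left hmono ⟨hlt, ht.2⟩
      rw [nhdsWithin_Icc_eq_nhdsLE hlt, ← nhdsWithin_Icc_eq_nhdsLE hc.2]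
      exact hs.eventually_comp_eq_of_isHorizontalOn hπ hsubm hD hDhor
        (right_mem_Icc.2 hc.2.le) hst hσc
  · rcases ht.2.eq_or_lt with rfl | hlt
    · simpa using hst
    · obtain ⟨d, hd, hσd⟩ := hσ.exists_right hmono ⟨ht.1, hlt⟩
      rw [nhdsWithin_Icc_eq_nhdsGE hlt, ← nhdsWithin_Icc_eq_nhdsGE hd.1]
      exact hs.eventually_comp_eq_of_isHorizontalOn hπ hsubm hD hDhor
        (left_mem_Icc.2 hd.1.le) hst hσd

/-- Horizontal sections are determined by their value at one point, locally. -/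
theorem IsHorizontalSectionNear.eventuallyEq (h₁ : IsHorizontalSectionNear VM VE π D s₁ x)
    (h₂ : IsHorizontalSectionNear VM VE π D s₂ x) (hx : s₁ x = s₂ x) : s₁ =ᶠ[𝓝 x] s₂ := by
  set ψ := extChartAt 𝓘(ℝ, VM) x with hψ
  have h3 : ∀ᶠ z in 𝓝 (ψ x), ψ.symm z ∈ {y | (ContMDiffAt 𝓘(ℝ, VM) 𝓘(ℝ, VE) ∞ s₁ y ∧
      π (s₁ y) = y ∧ ∀ u, mfderiv 𝓘(ℝ, VM) 𝓘(ℝ, VE) s₁ y u ∈ D (s₁ y)) ∧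
      ContMDiffAt 𝓘(ℝ, VM) 𝓘(ℝ, VE) ∞ s₂ y ∧
      π (s₂ y) = y ∧ ∀ u, mfderiv 𝓘(ℝ, VM) 𝓘(ℝ, VE) s₂ y u ∈ D (s₂ y)} := by
    refine (continuousAt_extChartAt_symm x).tendsto.eventually ?_
    rw [extChartAt_to_inv]
    exact h₁.and h₂
  obtain ⟨δ, hδ, hsub⟩ := Metric.eventually_nhds_iff_ball.1
    (h3.and (extChartAt_target_mem_nhds x))
  filter_upwards [extChartAt_source_mem_nhds (I := 𝓘(ℝ, VM)) x,
    (continuousAt_extChartAt (I := 𝓘(ℝ, VM)) x) (Metric.ball_mem_nhds _ hδ)] with y hy hyb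
  let l : ℝ → VM := fun t => ψ x + t • (ψ y - ψ x)
  have hl : ∀ t ∈ Icc (0 : ℝ) 1, l t ∈ Metric.ball (ψ x) δ := fun t ht =>
    (convex_ball (ψ x) δ).add_smul_sub_mem (Metric.mem_ball_self hδ) hyb ht
  have hlc : ContMDiff 𝓘(ℝ, ℝ) 𝓘(ℝ, VM) ∞ l := ContDiff.contMDiff (by fun_prop)
  have hγ : ContMDiffOn 𝓘(ℝ, ℝ) 𝓘(ℝ, VM) ∞ (fun t => ψ.symm (l t)) (Icc 0 1) := fun t ht =>
    (contMDiffAt_extChartAt_symm_of_mem (hsub _ (hl t ht)).2).comp_contMDiffWithinAt t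
      (hlc t).contMDiffWithinAt
  have hc₁ : IsHorizontalOn D (fun t => s₁ (ψ.symm (l t))) 0 1 :=
    IsHorizontalOn.comp_section (fun t ht => (hsub _ (hl t ht)).1.1.1)
      (fun t ht => (hsub _ (hl t ht)).1.1.2.2) hγ
  have hc₂ : IsHorizontalOn D (fun t => s₂ (ψ.symm (l t))) 0 1 :=
    IsHorizontalOn.comp_section (fun t ht => (hsub _ (hl t ht)).1.2.1)
      (fun t ht => (hsub _ (hl t ht)).1.2.2.2) hγ
  have h4 := hc₁.eqOn hπ hsubm hD hDhor hc₂
    (fun t ht => by rw [(hsub _ (hl t ht)).1.1.2.1, (hsub _ (hl t ht)).1.2.2.1])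
    (left_mem_Icc.2 zero_le_one)
    (by simp only [l, zero_smul, add_zero]; rwa [hψ, extChartAt_to_inv])
    1 (right_mem_Icc.2 zero_le_one)
  simp only [l, one_smul, add_sub_cancel] at h4
  rwa [ψ.left_inv hy] at h4

end Uniqueness

end LocalSections

/-! ### Existence of local horizontal sections -/

section LocalExistence

variable {VM : Type*} [NormedAddCommGroup VM] [NormedSpace ℝ VM]
  {M : Type*} [TopologicalSpace M] [ChartedSpace VM M]
  {VE : Type*} [NormedAddCommGroup VE] [NormedSpace ℝ VE]
  {E : Type*} [TopologicalSpace E] [ChartedSpace VE E]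
  {π : E → M} {D : (x : E) → Submodule ℝ (TangentSpace 𝓘(ℝ, VE) x)} {e : E}

namespace IsLiftOperator

variable {O : Set VE} {H : VE → VM →L[ℝ] VE}

theorem localProj_mem_target (h : IsLiftOperator π D e O H) {z : VE} (hz : z ∈ O) :
    localProj VM VE π e z ∈ (extChartAt 𝓘(ℝ, VM) (π e)).target :=
  (extChartAt 𝓘(ℝ, VM) (π e)).map_source (h.mem_source z hz)

theorem symm_localProj (h : IsLiftOperator π D e O H) {z : VE} (hz : z ∈ O) :
    (extChartAt 𝓘(ℝ, VM) (π e)).symm (localProj VM VE π e z) =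
      π ((extChartAt 𝓘(ℝ, VE) e).symm z) :=
  (extChartAt 𝓘(ℝ, VM) (π e)).left_inv (h.mem_source z hz)

end IsLiftOperator

variable [IsManifold 𝓘(ℝ, VM) ∞ M]
  {S : (v : TangentBundle 𝓘(ℝ, VM) M) → TangentSpace 𝓘(ℝ, VM).tangent v}

variable (S) in
/-- The equation of the horizontal lifts of the solutions of the spray `S`, read in a chart at `e`.
In the pair `(z, p)`, the point `z` runs through the lift and `p` is the velocity of the
projection. -/
def liftedSpray (π : E → M) (e : E) (H : VE → VM →L[ℝ] VE) (c : VE × VM) : VE × VM :=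
  (H c.1 c.2, (sprayLocal S (π e) (localProj VM VE π e c.1, c.2)).2)

namespace IsLiftOperator

variable {O : Set VE} {H : VE → VM →L[ℝ] VE}

theorem liftedSpray_zero (hS : IsSpray S) :
    liftedSpray S π e H (extChartAt 𝓘(ℝ, VE) e e, 0) = 0 := by
  have h1 : localProj VM VE π e (extChartAt 𝓘(ℝ, VE) e e) = extChartAt 𝓘(ℝ, VM) (π e) (π e) := by
    rw [localProj, extChartAt_to_inv]
  rw [liftedSpray, h1, sprayLocal_zero hS, map_zero]
  rfl

variable [IsManifold 𝓘(ℝ, VE) ∞ E]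

theorem contDiffAt_liftedSpray [CompleteSpace VM] (h : IsLiftOperator π D e O H) (hS : IsSpray S)
    (hπ : ContMDiff 𝓘(ℝ, VE) 𝓘(ℝ, VM) ∞ π) {c : VE × VM} (hc : c.1 ∈ O) :
    ContDiffAt ℝ ∞ (liftedSpray S π e H) c := by
  have h1 : ContDiffAt ℝ ∞ (fun c : VE × VM => (localProj VM VE π e c.1, c.2)) c :=
    ((h.contDiffAt_proj hπ hc).comp c contDiffAt_fst).prodMk contDiffAt_snd
  have h2 : ContDiffAt ℝ ∞ (fun c : VE × VM => sprayLocal S (π e)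
      (localProj VM VE π e c.1, c.2)) c :=
    ContDiffAt.comp (g := sprayLocal S (π e)) c
      (contDiffAt_sprayLocal hS (h.localProj_mem_target hc)) h1
  exact (((h.contDiffAt _ hc).comp c contDiffAt_fst).clm_apply contDiffAt_snd).prodMk h2.snd

variable {c : ℝ → VE × VM} {s : Set ℝ} {t : ℝ}

/-- The second component of a solution of `liftedSpray` is the velocity of the projection. -/
theorem hasDerivAt_localProj (h : IsLiftOperator π D e O H)
    (hπ : ContMDiff 𝓘(ℝ, VE) 𝓘(ℝ, VM) ∞ π) (hc : HasDerivAt c (liftedSpray S π e H (c t)) t)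
    (hO : (c t).1 ∈ O) : HasDerivAt (fun t => localProj VM VE π e (c t).1) (c t).2 t := by
  have h1 := ((h.contDiffAt_proj hπ hO).differentiableAt (by simp)).hasFDerivAt.comp_hasDerivAt t
    hc.fst
  rwa [liftedSpray, h.fderiv_lift _ hO] at h1

/-- A solution of `liftedSpray` is a smooth horizontal curve. -/
theorem isHorizontalOn [CompleteSpace VM] [CompleteSpace VE] (h : IsLiftOperator π D e O H)
    (hS : IsSpray S) (hπ : ContMDiff 𝓘(ℝ, VE) 𝓘(ℝ, VM) ∞ π) {T : ℝ}
    (hc : ∀ t ∈ Icc 0 T, HasDerivAt c (liftedSpray S π e H (c t)) t ∧ (c t).1 ∈ O) :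
    IsHorizontalOn D (fun t => (extChartAt 𝓘(ℝ, VE) e).symm (c t).1) 0 T := by
  have h1 : ContDiffOn ℝ ∞ c (Icc 0 T) := by
    refine ODE.contDiffOn_enat_Icc_of_hasDerivWithinAt (n := ⊤)
      (f := fun _ => liftedSpray S π e H) (u := O ×ˢ univ) ?_
      (fun t ht => (hc t ht).1.hasDerivWithinAt) fun t ht => ⟨(hc t ht).2, mem_univ _⟩
    rintro ⟨t, c⟩ ⟨-, hc, -⟩
    exact ((h.contDiffAt_liftedSpray hS hπ hc).comp (t, c) contDiffAt_snd).contDiffWithinAt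
  refine ⟨fun t ht => ?_, fun t ht => ?_⟩
  · exact (contMDiffAt_extChartAt_symm_of_mem
      (h.subset_target (hc t ht).2)).comp_contMDiffWithinAt t
        (contMDiffWithinAt_iff_contDiffWithinAt.2 (h1 t ht).fst)
  · have h2 : HasDerivAt (fun t => (c t).1) (H (c t).1 (c t).2) t := (hc t ht).1.fst
    exact ⟨_, h.horizontal _ (hc t ht).2 (c t).2,
      h2.hasDerivWithinAt.chart_symm (h.subset_target (hc t ht).2)⟩

/-- A solution of `liftedSpray` projects to a solution of the spray. -/
theorem isSpraySolution (h : IsLiftOperator π D e O H)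
    (hS : IsSpray S) (hπ : ContMDiff 𝓘(ℝ, VE) 𝓘(ℝ, VM) ∞ π) {T : ℝ} (hT : 0 < T)
    (hc : ∀ t ∈ Icc 0 T, HasDerivAt c (liftedSpray S π e H (c t)) t ∧ (c t).1 ∈ O) :
    IsSpraySolution S (fun t => π ((extChartAt 𝓘(ℝ, VE) e).symm (c t).1)) 0 T := by
  refine hS.congr hT (isSpraySolution_of_hasDerivWithinAt (x := π e) hS hT
    (c := fun t => (localProj VM VE π e (c t).1, (c t).2))
    (fun t ht => h.localProj_mem_target (hc t ht).2) fun t ht => ?_)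
    fun t ht => (h.symm_localProj (hc t ht).2).symm
  have h1 : sprayLocal S (π e) (localProj VM VE π e (c t).1, (c t).2) =
      ((c t).2, (liftedSpray S π e H (c t)).2) :=
    Prod.ext (sprayLocal_fst hS (h.localProj_mem_target (hc t ht).2)) rfl
  rw [h1]
  exact ((h.hasDerivAt_localProj hπ (hc t ht).1 (hc t ht).2).prodMk
    (hc t ht).1.snd).hasDerivWithinAt

end IsLiftOperator

/-- If the Levi form vanishes along the horizontal lifts starting at `e` of the solutions of
the spray, then these lifts sweep out a horizontal section near `π e`. -/
theorem exists_isHorizontalSectionNear [IsManifold 𝓘(ℝ, VE) ∞ E] [FiniteDimensional ℝ VM]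
    [FiniteDimensional ℝ VE]
    (hπ : ContMDiff 𝓘(ℝ, VE) 𝓘(ℝ, VM) ∞ π)
    (hsubm : ∀ x : E, Function.Surjective (mfderiv 𝓘(ℝ, VE) 𝓘(ℝ, VM) π x))
    (hD : IsSmoothDistribution D) (hDhor : IsHorizontalDistribution VM π D) (hS : IsSpray S)
    (e : E) (hlevi : ∀ (σ : ℝ → E) (T : ℝ), 0 < T → σ 0 = e → IsHorizontalOn D σ 0 T →
      IsSpraySolution S (fun t => π (σ t)) 0 T →
      ∀ t ∈ Icc 0 T, ∀ v w, leviForm D (σ t) v w = 0) :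
    ∃ s : M → E, IsHorizontalSectionNear VM VE π D s (π e) ∧ s (π e) = e ∧
      ∀ᶠ y in 𝓝 (π e), ∃ (σ : ℝ → E) (T : ℝ), 0 < T ∧ σ 0 = e ∧ IsHorizontalOn D σ 0 T ∧
        IsSpraySolution S (fun t => π (σ t)) 0 T ∧ σ T = s y := by
  have : CompleteSpace VE := FiniteDimensional.complete ℝ VE
  have : CompleteSpace VM := FiniteDimensional.complete ℝ VM
  obtain ⟨O, H, hH⟩ := exists_isLiftOperator hπ hsubm hD hDhor e
  set φ := extChartAt 𝓘(ℝ, VE) e with hφ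
  set ψ := extChartAt 𝓘(ℝ, VM) (π e) with hψ
  set z₀ := φ e with hz₀
  have hPz₀ : localProj VM VE π e z₀ = ψ (π e) := by
    rw [localProj, hz₀, hφ, extChartAt_to_inv]
  obtain ⟨C, hC, hCρ⟩ := exists_quadratic_remainder_of_contDiffAt
    ((hH.contDiffAt z₀ hH.mem).of_le (m := 2) (WithTop.coe_le_coe.2 (le_top : (2 : ℕ∞) ≤ ⊤)))
  obtain ⟨δ, hδ, hδO⟩ := Metric.isOpen_iff.1 hH.isOpen z₀ hH.mem
  have hρ' : ∀ᶠ ρ in 𝓝[>] (0 : ℝ), ρ ∈ Ioc 0 δ := Ioc_mem_nhdsGT hδ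
  obtain ⟨ρ, hρ, hρδ⟩ := (hCρ.and hρ').exists
  have hρ0 : 0 < ρ := hρδ.1
  have hBO : Metric.ball z₀ ρ ⊆ O := (Metric.ball_subset_ball hρδ.2).trans hδO
  have hN : {c : VE × VM | c.1 ∈ Metric.ball z₀ ρ ∧ ‖c.2‖ < 1} ∈ 𝓝 (z₀, (0 : VM)) := by
    filter_upwards [prod_mem_nhds (Metric.ball_mem_nhds z₀ hρ0)
      (Metric.ball_mem_nhds (0 : VM) one_pos)] with c hc
    exact ⟨hc.1, mem_ball_zero_iff.1 hc.2⟩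
  obtain ⟨T, hT, ε, hTε, U, hU, hUz₀, L, c, hc, hcL, hc₀⟩ := exists_family_of_secondOrder
    (F := liftedSpray S π e H) (z₀ := z₀)
    ((hH.contDiffAt_liftedSpray hS hπ (c := (z₀, 0)) hH.mem).of_le (by simp))
    (IsLiftOperator.liftedSpray_zero hS) (P := localProj VM VE π e)
    (P' := fderiv ℝ (localProj VM VE π e))
    (by
      filter_upwards [continuousAt_fst (hH.isOpen.mem_nhds hH.mem)] with c hc
      exact ⟨((hH.contDiffAt_proj hπ hc).differentiableAt (by simp)).hasFDerivAt,
        hH.fderiv_lift _ hc _⟩) hN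
  have hsub : Icc 0 T ⊆ Ioo (-ε) ε := fun t ht => ⟨by linarith [ht.1], ht.2.trans_lt hTε⟩
  have hcO : ∀ y ∈ U, ∀ t ∈ Icc 0 T,
      HasDerivAt (c y) (liftedSpray S π e H (c y t)) t ∧ (c y t).1 ∈ O := fun y hy t ht =>
    ⟨((hc y hy).2.2 t (hsub ht)).1, hBO ((hc y hy).2.2 t (hsub ht)).2.1⟩
  have hcB : ∀ y ∈ U, ∀ t ∈ Icc 0 T, (c y t).1 ∈ Metric.ball z₀ ρ ∧ ‖(c y t).2‖ < 1 :=
    fun y hy t ht => ((hc y hy).2.2 t (hsub ht)).2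
  have hTT : T ∈ Icc 0 T := right_mem_Icc.2 hT.le
  let σ : VM → ℝ → E := fun y t => φ.symm (c y t).1
  have hσ0 : ∀ y ∈ U, σ y 0 = e := by
    intro y hy
    simp only [σ, (hc y hy).1, hz₀, hφ, extChartAt_to_inv]
  have hσD : ∀ y ∈ U, IsHorizontalOn D (σ y) 0 T := fun y hy => hH.isHorizontalOn hS hπ (hcO y hy)
  have hσS : ∀ y ∈ U, IsSpraySolution S (fun t => π (σ y t)) 0 T := fun y hy =>
    hH.isSpraySolution hS hπ hT (hcO y hy)
  -- the section, read in the charts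
  let f : VM → VE := fun y => (c y T).1
  have hf : ∀ y ∈ U, HasFDerivAt f (H (f y)) y := by
    intro y hy
    have hL : ∀ y ∈ U, ∀ y' ∈ U, ∀ t ∈ Icc 0 T, ‖c y' t - c y t‖ ≤ L * ‖y' - y‖ :=
      fun y hy y' hy' t ht => (hcL t (hsub ht)).norm_sub_le hy' hy
    -- `C + 1` bounds the derivatives of `H` as well as the velocities, which are less than `1`
    refine hasFDerivAt_endpoint (H' := fderiv ℝ H) (B := Metric.ball z₀ ρ) (C := C + 1)
      (L := L) (T := T) (by positivity) L.2 hT.le ?_ (fun z hz => (hρ z hz).1)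
      (fun z hz => (hρ z hz).2.1.trans (by linarith)) (hU.mem_nhds hy)
      (z := fun y t => (c y t).1) (p := fun y t => (c y t).2) (P := localProj VM VE π e) (z₀ := z₀)
      (fun y hy => (hc y hy).1) (fun y hy => (hc y hy).2.1) (fun y hy t ht => (hcB y hy t ht).1)
      (fun y hy t ht => (hcB y hy t ht).2.le.trans (by linarith))
      (fun y hy t ht => (hcO y hy t ht).1.fst)
      (fun y hy t ht => hH.hasDerivAt_localProj hπ (hcO y hy t ht).1 (hcO y hy t ht).2)
      (fun y hy y' hy' t ht => (norm_fst_le (c y' t - c y t)).trans (hL y hy y' hy' t ht))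
      (fun y hy y' hy' t ht => (norm_snd_le (c y' t - c y t)).trans (hL y hy y' hy' t ht))
      (fun t ht u w => hH.curvature_eq hπ hD hDhor (hcO y hy t ht).2
        (hlevi (σ y) T hT (hσ0 y hy) (hσD y hy) (hσS y hy) t ht) u w)
    intro z hz z' hz'
    refine ((hρ z hz).2.2 z' hz').trans ?_
    gcongr
    linarith
  have hfO : ∀ y ∈ U, f y ∈ O := fun y hy => (hcO y hy T hTT).2
  have hfs : ContDiffOn ℝ ∞ f U :=
    contDiffOn_of_hasFDerivAt_comp hU hf fun y hy => hH.contDiffAt _ (hfO y hy)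
  have hW : ∀ᶠ m in 𝓝 (π e), m ∈ ψ.source ∧ ψ m ∈ U := by
    filter_upwards [extChartAt_source_mem_nhds (I := 𝓘(ℝ, VM)) (π e),
      (continuousAt_extChartAt (I := 𝓘(ℝ, VM)) (π e)) (hU.mem_nhds (hPz₀ ▸ hUz₀))] with m hm hm'
    exact ⟨hm, hm'⟩
  refine ⟨fun m => φ.symm (f (ψ m)), ?_, ?_, ?_⟩
  · filter_upwards [hW] with m hm
    have hft := hH.subset_target (hfO _ hm.2)
    refine ⟨?_, ?_, fun u => ?_⟩
    · exact (contMDiffAt_extChartAt_symm_of_mem hft).comp m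
        (((hfs.contDiffAt (hU.mem_nhds hm.2)).contMDiffAt).comp m
          (contMDiffAt_extChartAt_of_mem hm.1))
    · rw [← hH.symm_localProj (hfO _ hm.2), (hc _ hm.2).2.1]
      exact ψ.left_inv hm.1
    · have h1 := (hasMFDerivAt_extChartAt_symm_of_mem hft).comp m
        ((hf _ hm.2).hasMFDerivAt.comp m (hasMFDerivAt_extChartAt_of_mem hm.1))
      have h2 := hH.horizontal _ (hfO _ hm.2) (chartD 𝓘(ℝ, VM) (π e) m u)
      have h3 := h1.mfderiv
      have h4 := congrArg (fun L : VM →L[ℝ] VE => L u) h3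
      exact (congrArg (fun w : VE => w ∈ D (φ.symm (f (ψ m)))) h4).mpr h2
  · simp only [f, ← hPz₀, hc₀]
    rw [hz₀, hφ, extChartAt_to_inv]
  · filter_upwards [hW] with m hm
    exact ⟨σ (ψ m), T, hT, hσ0 _ hm.2, hσD _ hm.2, hσS _ hm.2, rfl⟩

end LocalExistence

/-! ### Normal neighborhoods and reachable points -/

section NormalNeighborhoods

variable {V : Type*} [NormedAddCommGroup V] [NormedSpace ℝ V] [FiniteDimensional ℝ V]
  {M : Type*} [TopologicalSpace M] [ChartedSpace V M] [IsManifold 𝓘(ℝ, V) ∞ M]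
  {S : (v : TangentBundle 𝓘(ℝ, V) M) → TangentSpace 𝓘(ℝ, V).tangent v}

/-- Every point `x` has a neighborhood `U` whose points are joined to `x` by solutions of the spray
which depend continuously on the end point. -/
theorem IsSpray.exists_normal_nhds (hS : IsSpray S) (x : M) :
    ∃ T > 0, ∃ U : Set M, IsOpen U ∧ x ∈ U ∧ ∃ Γ : M → ℝ → M,
      (∀ y ∈ U, Γ y 0 = x ∧ Γ y T = y ∧ IsSpraySolution S (Γ y) 0 T) ∧
        ContinuousOn (Function.uncurry Γ) (U ×ˢ Icc 0 T) := by
  have : CompleteSpace V := FiniteDimensional.complete ℝ V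
  set ψ := extChartAt 𝓘(ℝ, V) x with hψ
  have hN : {c : V × V | c.1 ∈ ψ.target} ∈ 𝓝 (ψ x, (0 : V)) := by
    filter_upwards [prod_mem_nhds (extChartAt_target_mem_nhds (I := 𝓘(ℝ, V)) x)
      (Filter.univ_mem (f := 𝓝 (0 : V)))] with c hc using hc.1
  obtain ⟨T, hT, ε, hTε, U, hU, hxU, L, c, hc, hcL, -⟩ := exists_family_of_secondOrder
    (F := sprayLocal S x) (z₀ := ψ x)
    ((contDiffAt_sprayLocal hS (c := (ψ x, 0)) (mem_extChartAt_target x)).of_le (by simp))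
    (sprayLocal_zero hS) (P := id) (P' := fun _ => ContinuousLinearMap.id ℝ V)
    (by
      filter_upwards [hN] with c hc
      exact ⟨hasFDerivAt_id _, sprayLocal_fst hS hc⟩) hN
  have hsub : Icc 0 T ⊆ Ioo (-ε) ε := fun t ht => ⟨by linarith [ht.1], ht.2.trans_lt hTε⟩
  have hcont : ContinuousOn (Function.uncurry c) (U ×ˢ Icc 0 T) :=
    continuousOn_prod_of_continuousOn_lipschitzOnWith _ L
      (fun y hy t ht => ((hc y hy).2.2 t (hsub ht)).1.continuousAt.continuousWithinAt)
      fun t ht => hcL t (hsub ht)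
  refine ⟨T, hT, ψ.source ∩ ψ ⁻¹' U, (continuousOn_extChartAt x).isOpen_inter_preimage
    (isOpen_extChartAt_source x) hU, ⟨mem_extChartAt_source x, hxU⟩,
    fun y t => ψ.symm (c (ψ y) t).1, fun y hy => ⟨?_, ?_, ?_⟩, ?_⟩
  · dsimp only
    rw [(hc _ hy.2).1, hψ, extChartAt_to_inv]
  · have h1 : (c (ψ y) T).1 = ψ y := (hc _ hy.2).2.1
    dsimp only
    rw [h1, ψ.left_inv hy.1]
  · exact isSpraySolution_of_hasDerivWithinAt hS hT
      (fun t ht => ((hc _ hy.2).2.2 t (hsub ht)).2)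
      fun t ht => ((hc _ hy.2).2.2 t (hsub ht)).1.hasDerivWithinAt
  · have h1 : ContinuousOn (fun q : M × ℝ => (ψ q.1, q.2)) ((ψ.source ∩ ψ ⁻¹' U) ×ˢ Icc 0 T) :=
      ((continuousOn_extChartAt x).comp continuousOn_fst fun q hq => hq.1.1).prodMk
        continuousOn_snd
    have h2 := hcont.comp h1 fun q hq => ⟨hq.1.2, hq.2⟩
    exact (continuousOn_extChartAt_symm x).comp h2.fst
      fun q hq => ((hc _ hq.1.2).2.2 _ (hsub hq.2)).2

end NormalNeighborhoods

theorem PiecewiseOn.sub_const {P P' : ℝ → ℝ → Prop} {a b : ℝ} (h : PiecewiseOn P a b) (k : ℝ)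
    (hP : ∀ c d, P c d → P' (c - k) (d - k)) : PiecewiseOn P' (a - k) (b - k) := by
  refine h.induction (Q := fun a b => PiecewiseOn P' (a - k) (b - k)) (fun _ => nil _ _) ?_
  intro a c b hac h _ ih
  exact cons (sub_lt_sub_right hac k) (hP _ _ h) ih

section Reachability

variable {VM : Type*} [NormedAddCommGroup VM] [NormedSpace ℝ VM]
  {M : Type*} [TopologicalSpace M] [ChartedSpace VM M] [IsManifold 𝓘(ℝ, VM) ∞ M]
  {VE : Type*} [NormedAddCommGroup VE] [NormedSpace ℝ VE]
  {E : Type*} [TopologicalSpace E] [ChartedSpace VE E]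

/-- The point `e` is the end point of a horizontal lift, starting at `e₀`, of a piecewise solution
of the spray `S`. -/
def IsReachable (S : (v : TangentBundle 𝓘(ℝ, VM) M) → TangentSpace 𝓘(ℝ, VM).tangent v) (π : E → M)
    (D : (x : E) → Submodule ℝ (TangentSpace 𝓘(ℝ, VE) x)) (e₀ e : E) : Prop :=
  ∃ (a b : ℝ) (γ : ℝ → M) (σ : ℝ → E), a < b ∧ IsPiecewiseSpraySolution S γ a b ∧
    IsHorizontalLift π D γ σ a b ∧ σ a = e₀ ∧ σ b = e

variable {S : (v : TangentBundle 𝓘(ℝ, VM) M) → TangentSpace 𝓘(ℝ, VM).tangent v}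
  {π : E → M} {D : (x : E) → Submodule ℝ (TangentSpace 𝓘(ℝ, VE) x)} {e₀ e : E}

theorem IsReachable.refl (hS : IsSpray S) (π : E → M)
    (D : (x : E) → Submodule ℝ (TangentSpace 𝓘(ℝ, VE) x)) (e₀ : E) :
    IsReachable S π D e₀ e₀ := by
  have h : IsHorizontalOn D (fun _ => e₀) 0 1 := by
    refine ⟨contMDiffOn_const, fun t _ => ⟨0, (D e₀).zero_mem, ?_⟩⟩
    refine (hasMFDerivWithinAt_const _ _ _).congr_mfderiv ?_
    exact ContinuousLinearMap.ext_ring (smul_zero (A := VE) (1 : ℝ)).symm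
  exact ⟨0, 1, fun _ => π e₀, fun _ => e₀, one_pos, PiecewiseOn.of one_pos (hS.const _ one_pos),
    (PiecewiseOn.of one_pos h).isHorizontalLift one_pos fun _ _ => rfl, rfl, rfl⟩

variable [FiniteDimensional ℝ VM] [FiniteDimensional ℝ VE] [IsManifold 𝓘(ℝ, VE) ∞ E] [T2Space E]

/-- Solutions of the spray which start below a reachable point `e` have horizontal lifts starting at
`e`, and these run through reachable points: the lift of the concatenation with a solution leading
to `e` passes through `e`, as lifts are unique. -/
theorem IsReachable.exists_lift (h : IsReachable S π D e₀ e) (hS : IsSpray S)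
    (hπ : ContMDiff 𝓘(ℝ, VE) 𝓘(ℝ, VM) ∞ π)
    (hsubm : ∀ x : E, Function.Surjective (mfderiv 𝓘(ℝ, VE) 𝓘(ℝ, VM) π x))
    (hD : IsSmoothDistribution D) (hDhor : IsHorizontalDistribution VM π D)
    (hlift : ∀ (a b : ℝ) (γ : ℝ → M), a < b → IsPiecewiseSpraySolution S γ a b → γ a = π e₀ →
      ∃ σ : ℝ → E, IsHorizontalLift π D γ σ a b ∧ σ a = e₀)
    {η : ℝ → M} {T : ℝ} (hT : 0 < T) (hη : IsSpraySolution S η 0 T) (hη0 : η 0 = π e) :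
    ∃ ρ : ℝ → E, ρ 0 = e ∧ PiecewiseOn (IsHorizontalOn D ρ) 0 T ∧
      ∀ t ∈ Icc 0 T, π (ρ t) = η t ∧ IsReachable S π D e₀ (ρ t) := by
  have : CompleteSpace VM := FiniteDimensional.complete ℝ VM
  obtain ⟨a, b, γ, σ, hab, hγ, hσ, hσa, hσb⟩ := h
  -- the given solution ending below `e`, continued by `η`
  let γ' : ℝ → M := fun t => if t ≤ b then γ t else η (1 * t + -b)
  have hγ'1 : ∀ t ∈ Icc a b, γ' t = γ t := fun t ht => if_pos ht.2
  have hγ'2 : ∀ t ∈ Icc b (b + T), γ' t = η (1 * t + -b) := by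
    intro t ht
    rcases ht.1.eq_or_lt with rfl | hlt
    · rw [hγ'1 b (right_mem_Icc.2 hab.le), ← hσ.lift b (right_mem_Icc.2 hab.le), hσb, one_mul,
        add_neg_cancel, hη0]
    · exact if_neg hlt.not_ge
  have hbT : b < b + T := lt_add_of_pos_right b hT
  have hγ' : IsPiecewiseSpraySolution S γ' a (b + T) := by
    refine PiecewiseOn.trans (b := b) ?_ (PiecewiseOn.of hbT ?_)
    · exact PiecewiseOn.mono hγ fun c d hac hcd hdb h =>
        hS.congr hcd h fun t ht => hγ'1 t (Icc_subset_Icc hac hdb ht)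
    · refine hS.congr hbT (hS.comp_affine hT hbT hη ?_) hγ'2
      intro t ht
      exact ⟨by linarith [ht.1], by linarith [ht.2]⟩
  have haT := hab.trans hbT
  obtain ⟨σ', hσ', hσ'a⟩ := hlift a (b + T) γ' haT hγ' (by
    rw [hγ'1 a (left_mem_Icc.2 hab.le), ← hσ.lift a (left_mem_Icc.2 hab.le), hσa])
  have hpw := hσ'.piecewiseOn hπ hsubm hD hDhor
  have hσ'b : σ' b = e := by
    rw [← hσb]
    refine PiecewiseOn.eqOn_of_left hπ hsubm hD hDhor
      (hpw.restrict_horizontal le_rfl hab.le hbT.le) (hσ.piecewiseOn hπ hsubm hD hDhor)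
      (fun t ht => ?_) (hσ'a.trans hσa.symm) b (right_mem_Icc.2 hab.le)
    rw [hσ'.lift t (Icc_subset_Icc_right hbT.le ht), hγ'1 t ht, hσ.lift t ht]
  refine ⟨fun t => σ' (1 * t + b), by simpa using hσ'b, ?_, fun t ht => ?_⟩
  · have h1 := (hpw.restrict_horizontal hab.le hbT.le le_rfl).sub_const
      (P' := IsHorizontalOn D fun t => σ' (1 * t + b)) b fun c d h => by
        refine h.comp_affine fun t ht => ?_
        exact ⟨by linarith [ht.1], by linarith [ht.2]⟩
    simpa using h1
  · have htb : 1 * t + b ∈ Icc b (b + T) := ⟨by linarith [ht.1], by linarith [ht.2]⟩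
    have hat : a < 1 * t + b := hab.trans_le htb.1
    refine ⟨?_, a, 1 * t + b, γ', σ', hat, ?_, ?_, hσ'a, rfl⟩
    · rw [hσ'.lift _ (Icc_subset_Icc_left hab.le htb), hγ'2 _ htb]
      congr 1
      ring
    · exact hγ'.restrict (fun _ _ _ _ h1 h2 h3 h => hS.mono h h1 h2 h3) le_rfl hat.le htb.2
    · exact (hpw.restrict_horizontal le_rfl hat.le htb.2).isHorizontalLift hat
        fun t ht => hσ'.lift t (Icc_subset_Icc_right htb.2 ht)

end Reachability

/-! ### The leaf of reachable points -/

section ReachableGerms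

variable {VM : Type*} [NormedAddCommGroup VM] [NormedSpace ℝ VM]
  {M : Type*} [TopologicalSpace M] [ChartedSpace VM M]
  {VE : Type*} [NormedAddCommGroup VE] [NormedSpace ℝ VE]
  {E : Type*} [TopologicalSpace E] [ChartedSpace VE E]
  {π : E → M} {D : (x : E) → Submodule ℝ (TangentSpace 𝓘(ℝ, VE) x)} {e₀ : E}

theorem IsHorizontalSectionNear.congr {s s' : M → E} {x : M}
    (h : IsHorizontalSectionNear VM VE π D s x) (hs : s' =ᶠ[𝓝 x] s) :
    IsHorizontalSectionNear VM VE π D s' x := by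
  refine (h.and hs.eventually_nhds).mono fun y ⟨⟨h1, h2, h3⟩, hy⟩ => ?_
  have heq : s' =ᶠ[𝓝 y] s := hy
  have hy' : s' y = s y := hy.self_of_nhds
  refine ⟨h1.congr_of_eventuallyEq heq, hy' ▸ h2, fun u => ?_⟩
  have h4 : ∀ e, e = s y →
      (show TangentSpace 𝓘(ℝ, VE) e from mfderiv 𝓘(ℝ, VM) 𝓘(ℝ, VE) s y u) ∈ D e := by
    rintro e rfl
    exact h3 u
  have h5 := congrArg (fun L : VM →L[ℝ] VE => L u) (heq.mfderiv_eq (I := 𝓘(ℝ, VM)) (I' := 𝓘(ℝ, VE)))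
  exact (congrArg (fun w : VE => (show TangentSpace 𝓘(ℝ, VE) (s' y) from w) ∈ D (s' y)) h5).mpr
    (h4 _ hy')

theorem IsHorizontalSection.isHorizontalSectionNear {s : M → E}
    (h : IsHorizontalSection VM π D s) (x : M) : IsHorizontalSectionNear VM VE π D s x :=
  Filter.Eventually.of_forall fun y =>
    ⟨h.smooth y, h.isSection y, fun u => h.horizontal y ▸ LinearMap.mem_range_self _ u⟩

variable [IsManifold 𝓘(ℝ, VM) ∞ M]
  {S : (v : TangentBundle 𝓘(ℝ, VM) M) → TangentSpace 𝓘(ℝ, VM).tangent v}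

/-- The map `s` into the set of reachable points is a smooth horizontal section near `x`. -/
def IsReachableGerm (S : (v : TangentBundle 𝓘(ℝ, VM) M) → TangentSpace 𝓘(ℝ, VM).tangent v)
    (π : E → M) (D : (x : E) → Submodule ℝ (TangentSpace 𝓘(ℝ, VE) x)) (e₀ : E) (x : M)
    (s : M → {e // IsReachable S π D e₀ e}) : Prop :=
  IsHorizontalSectionNear VM VE π D (fun y => (s y : E)) x

variable [FiniteDimensional ℝ VM] [FiniteDimensional ℝ VE] [IsManifold 𝓘(ℝ, VE) ∞ E] [T2Space E]
  (hS : IsSpray S) (hπ : ContMDiff 𝓘(ℝ, VE) 𝓘(ℝ, VM) ∞ π)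
  (hsubm : ∀ x : E, Function.Surjective (mfderiv 𝓘(ℝ, VE) 𝓘(ℝ, VM) π x))
  (hD : IsSmoothDistribution D) (hDhor : IsHorizontalDistribution VM π D)
  (hlift : ∀ (a b : ℝ) (γ : ℝ → M), a < b → IsPiecewiseSpraySolution S γ a b → γ a = π e₀ →
    ∃ σ : ℝ → E, IsHorizontalLift π D γ σ a b ∧ σ a = e₀)

include hS hπ hsubm hD hDhor hlift

/-- Horizontal lifts of solutions which start at a reachable point run through reachable points,
since they agree with the lifts of `IsReachable.exists_lift`. -/
theorem isReachable_of_isHorizontalOn {σ : ℝ → E} {T : ℝ} (hT : 0 < T)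
    (hσ0 : IsReachable S π D e₀ (σ 0)) (hσ : IsHorizontalOn D σ 0 T)
    (hσS : IsSpraySolution S (fun t => π (σ t)) 0 T) {t : ℝ} (ht : t ∈ Icc 0 T) :
    IsReachable S π D e₀ (σ t) := by
  have : CompleteSpace VM := FiniteDimensional.complete ℝ VM
  obtain ⟨ρ, hρ0, hρ, hρπ⟩ := hσ0.exists_lift hS hπ hsubm hD hDhor hlift hT hσS rfl
  rw [← PiecewiseOn.eqOn_of_left hπ hsubm hD hDhor hρ (PiecewiseOn.of hT hσ)
    (fun t ht => (hρπ t ht).1) hρ0 t ht]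
  exact (hρπ t ht).2

/-- The set of reachable points is a union of local horizontal sections with values in it. -/
theorem isSectionGerms_reachable
    (hlevi : ∀ e, IsReachable S π D e₀ e → ∀ v w, leviForm D e v w = 0) :
    IsSectionGerms (fun r : {e // IsReachable S π D e₀ e} => π r) (IsReachableGerm S π D e₀) := by
  have : CompleteSpace VM := FiniteDimensional.complete ℝ VM
  unfold IsReachableGerm
  refine ⟨fun h => h.eventually_nhds, fun h => h.self_of_nhds.2.1, fun h h' hx => ?_,
    fun h h' hx => ?_, fun r => ?_⟩
  · filter_upwards [h.eventuallyEq hπ hsubm hD hDhor h' (congrArg Subtype.val hx)] with y hy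
    exact Subtype.ext hy
  · filter_upwards [(h.self_of_nhds.1.continuousAt.prodMk h'.self_of_nhds.1.continuousAt)
      (isClosed_diagonal.isOpen_compl.mem_nhds fun h => hx (Subtype.ext h))] with y hy hy'
    exact hy (congrArg Subtype.val hy')
  · have hreach : ∀ (σ : ℝ → E) (T : ℝ), 0 < T → σ 0 = r → IsHorizontalOn D σ 0 T →
        IsSpraySolution S (fun t => π (σ t)) 0 T → ∀ t ∈ Icc 0 T, IsReachable S π D e₀ (σ t) :=
      fun σ T hT hσ0 hσ hσS t ht => isReachable_of_isHorizontalOn hS hπ hsubm hD hDhor hlift hT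
        (hσ0 ▸ r.2) hσ hσS ht
    obtain ⟨s, hs, hsr, hsreach⟩ := exists_isHorizontalSectionNear hπ hsubm hD hDhor hS r
      fun σ T hT hσ0 hσ hσS t ht => hlevi _ (hreach σ T hT hσ0 hσ hσS t ht)
    classical
    have heq : (fun y => ((if h : IsReachable S π D e₀ (s y) then ⟨s y, h⟩ else r :
        {e // IsReachable S π D e₀ e}) : E)) =ᶠ[𝓝 (π r)] s := by
      filter_upwards [hsreach] with y ⟨σ, T, hT, hσ0, hσ, hσS, hσT⟩
      have h : IsReachable S π D e₀ (s y) :=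
        hσT ▸ hreach σ T hT hσ0 hσ hσS T (right_mem_Icc.2 hT.le)
      rw [dif_pos h]
    exact ⟨fun y => if h : IsReachable S π D e₀ (s y) then ⟨s y, h⟩ else r, hs.congr heq,
      Subtype.ext (heq.self_of_nhds.trans hsr)⟩

/-- Solutions `η` of the spray lift to the leaf. The reparametrization `θ` of the time interval
allows for both directions. -/
theorem exists_isLeafLift (hlevi : ∀ e, IsReachable S π D e₀ e → ∀ v w, leviForm D e v w = 0)
    {η : ℝ → M} {T : ℝ} (hT : 0 < T) (hη : IsSpraySolution S η 0 T)
    (r : {e // IsReachable S π D e₀ e}) (hr : π r = η 0) {θ : unitInterval → ℝ}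
    (hθ : Continuous θ) (hθT : ∀ t, θ t ∈ Icc 0 T) :
    ∃ ρ : unitInterval → {e // IsReachable S π D e₀ e}, (∀ t, θ t = 0 → ρ t = r) ∧
      IsLeafLift (IsReachableGerm S π D e₀) (fun t => η (θ t)) ρ := by
  have : CompleteSpace VM := FiniteDimensional.complete ℝ VM
  obtain ⟨ρ, hρ0, hρ, hρη⟩ := r.2.exists_lift hS hπ hsubm hD hDhor hlift hT hη hr.symm
  refine ⟨fun t => ⟨ρ (θ t), (hρη _ (hθT t)).2⟩, fun t ht => Subtype.ext (by simp [ht, hρ0]),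
    fun t => ?_⟩
  obtain ⟨s, hs, hst⟩ := (isSectionGerms_reachable hS hπ hsubm hD hDhor hlift hlevi).exists_germ
    ⟨ρ (θ t), (hρη _ (hθT t)).2⟩
  have hs' : IsHorizontalSectionNear VM VE π D (fun y => (s y : E)) (π (ρ (θ t))) := hs
  refine ⟨s, ?_, ?_⟩
  · have h0 : IsReachableGerm S π D e₀ (π (ρ (θ t))) s := hs
    rwa [(hρη _ (hθT t)).1] at h0
  have h1 := hs'.eventually_comp_eq hπ hsubm hD hDhor (hθT t) (congrArg Subtype.val hst) hρ
  have h2 : Filter.Tendsto θ (𝓝 t) (𝓝[Icc 0 T] (θ t)) :=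
    tendsto_nhdsWithin_iff.2 ⟨hθ.tendsto t, Filter.Eventually.of_forall hθT⟩
  filter_upwards [h2.eventually h1] with t' ht'
  rw [(hρη _ (hθT t')).1] at ht'
  exact Subtype.ext ht'.symm

end ReachableGerms

end

theorem theorem3p11
    {VM : Type*} [NormedAddCommGroup VM] [NormedSpace ℝ VM] [FiniteDimensional ℝ VM]
    {M : Type*} [TopologicalSpace M] [T2Space M] [ChartedSpace VM M] [IsManifold 𝓘(ℝ, VM) ∞ M]
    {VE : Type*} [NormedAddCommGroup VE] [NormedSpace ℝ VE] [FiniteDimensional ℝ VE]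
    {E : Type*} [TopologicalSpace E] [T2Space E] [ChartedSpace VE E] [IsManifold 𝓘(ℝ, VE) ∞ E]
    [SimplyConnectedSpace M]
    (π : E → M) (hπ : ContMDiff 𝓘(ℝ, VE) 𝓘(ℝ, VM) ∞ π)
    (hsubm : ∀ x : E, Function.Surjective (mfderiv 𝓘(ℝ, VE) 𝓘(ℝ, VM) π x))
    (D : (x : E) → Submodule ℝ (TangentSpace 𝓘(ℝ, VE) x))
    (hD : IsSmoothDistribution D) (hDhor : IsHorizontalDistribution VM π D)
    (S : (v : TangentBundle 𝓘(ℝ, VM) M) → TangentSpace 𝓘(ℝ, VM).tangent v) (hS : IsSpray S)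
    (x₀ : M) (e₀ : E) (he₀ : π e₀ = x₀)
    (hlift : ∀ (a b : ℝ) (γ : ℝ → M), a < b → IsPiecewiseSpraySolution S γ a b → γ a = x₀ →
      ∃ σ : ℝ → E, IsHorizontalLift π D γ σ a b ∧ σ a = e₀)
    (hlevi : ∀ (a b : ℝ) (γ : ℝ → M) (σ : ℝ → E), a < b → IsPiecewiseSpraySolution S γ a b →
      IsHorizontalLift π D γ σ a b → σ a = e₀ → ∀ v w : D (σ b), leviForm D (σ b) v w = 0) :
    ∃! s : M → E, IsHorizontalSection VM π D s ∧ s x₀ = e₀ := by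
  subst he₀
  have : CompleteSpace VM := FiniteDimensional.complete ℝ VM
  have : LocallyPathConnectedSpace M := ChartedSpace.locallyPathConnectedSpace VM M
  have hlevi' : ∀ e, IsReachable S π D e₀ e → ∀ v w, leviForm D e v w = 0 := by
    rintro _ ⟨a, b, γ, σ, hab, hγ, hσ, hσa, rfl⟩
    exact hlevi a b γ σ hab hγ hσ hσa
  have hcontract : ∀ x : M, ∃ U : Set M, IsOpen U ∧ x ∈ U ∧ ∃ Γ : C(unitInterval × U, M),
      (∀ y, Γ (0, y) = x) ∧ (∀ y, Γ (1, y) = y) ∧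
      (∀ (y : U) (e : {e // IsReachable S π D e₀ e}), π e = x → ∃ σ, σ 0 = e ∧
        IsLeafLift (IsReachableGerm S π D e₀) (fun t => Γ (t, y)) σ) ∧
      (∀ (y : U) (e : {e // IsReachable S π D e₀ e}), π e = y → ∃ σ, σ 1 = e ∧
        IsLeafLift (IsReachableGerm S π D e₀) (fun t => Γ (t, y)) σ) := by
    intro x
    obtain ⟨T, hT, U, hU, hxU, Γ, hΓ, hΓc⟩ := hS.exists_normal_nhds x
    have hmem : ∀ t : unitInterval, T * (t : ℝ) ∈ Icc 0 T := fun t =>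
      ⟨mul_nonneg hT.le t.2.1, mul_le_of_le_one_right hT.le t.2.2⟩
    refine ⟨U, hU, hxU, ⟨fun q => Γ q.2 (T * q.1), ?_⟩, fun y => ?_, fun y => ?_,
      fun y e he => ?_, fun y e he => ?_⟩
    · exact hΓc.comp_continuous (f := fun q : unitInterval × U => ((q.2 : M), T * (q.1 : ℝ)))
        (by fun_prop) fun q => ⟨q.2.2, hmem q.1⟩
    · change Γ y (T * ((0 : unitInterval) : ℝ)) = x
      simpa using (hΓ y y.2).1
    · change Γ y (T * ((1 : unitInterval) : ℝ)) = y
      simpa using (hΓ y y.2).2.1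
    · obtain ⟨ρ, hρ, hρ'⟩ := exists_isLeafLift hS hπ hsubm hD hDhor hlift hlevi' hT
        (hΓ y y.2).2.2 e (he.trans (hΓ y y.2).1.symm) (θ := fun t => T * (t : ℝ)) (by fun_prop) hmem
      exact ⟨ρ, hρ 0 (by simp), hρ'⟩
    · -- the reversed curve is a solution as well
      have hrev : IsSpraySolution S (fun t => Γ y (-1 * t + T)) 0 T :=
        hS.comp_affine hT hT (hΓ y y.2).2.2 fun t ht =>
          ⟨by linarith [ht.2], by linarith [ht.1]⟩
      obtain ⟨ρ, hρ, hρ'⟩ := exists_isLeafLift hS hπ hsubm hD hDhor hlift hlevi' hT hrev e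
        (by simpa using he.trans (hΓ y y.2).2.1.symm) (θ := fun t => T - T * (t : ℝ))
        (by fun_prop) fun t => ⟨sub_nonneg.2 (hmem t).2, sub_le_self T (hmem t).1⟩
      have hθ : (fun t : unitInterval => Γ y (-1 * (T - T * (t : ℝ)) + T)) =
          fun t : unitInterval => Γ y (T * (t : ℝ)) := funext fun t => congrArg (Γ y) (by ring)
      rw [hθ] at hρ'
      exact ⟨ρ, hρ 1 (by simp), hρ'⟩
  obtain ⟨g, hg₀, hg⟩ := (isSectionGerms_reachable hS hπ hsubm hD hDhor hlift
    hlevi').exists_global_section hcontract ⟨e₀, IsReachable.refl hS π D e₀⟩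
  have hgs : ∀ x, IsHorizontalSectionNear VM VE π D (fun y => (g y : E)) x := by
    intro x
    obtain ⟨s, hs, hgs⟩ := hg x
    exact IsHorizontalSectionNear.congr hs (hgs.mono fun y hy => congrArg Subtype.val hy)
  refine ⟨fun y => g y, ⟨⟨fun x => (hgs x).self_of_nhds.1, fun x => (hgs x).self_of_nhds.2.1,
    fun x => (hgs x).range_mfderiv hπ hDhor⟩, congrArg Subtype.val hg₀⟩, ?_⟩
  rintro s ⟨hs, hs₀⟩
  have hclopen : IsClopen {x | s x = g x} := by
    refine ⟨isClosed_eq hs.smooth.continuous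
      (continuous_iff_continuousAt.2 fun x => (hgs x).self_of_nhds.1.continuousAt), ?_⟩
    exact isOpen_iff_mem_nhds.2 fun x hx =>
      (hs.isHorizontalSectionNear x).eventuallyEq hπ hsubm hD hDhor (hgs x) hx
  have huniv := hclopen.eq_univ ⟨π e₀, hs₀.trans (congrArg Subtype.val hg₀).symm⟩
  exact funext fun x => huniv.ge (mem_univ x)
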